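/- Let $\Bbbk$ be a field and let $Q\subseteq\mathbb N^r$ be a pointed affine semigroup, i.e. a finitely generated submonoid of $\mathbb N^r$, with minimal generating set $a_1,\dots,a_n$ (each $a_i$ lies outside the submonoid generated by the others). Let $R=\Bbbk[x_1,\dots,x_n]$ be $\mathbb Z^r$-graded by $\deg x_i=a_i$, and regard $\Bbbk[Q]$ as a $\mathbb Z^r$-graded $R$-module via $x_i\mapsto t^{a_i}$. Let $\mathcal A$ be the action category of $\mathbb N^n$ on $\mathbb Z^r$: its objects are the elements of $\mathbb Z^r$, its morphisms $c\to d$ are the $m\in\mathbb N^n$ with $c+\sum_i m_ia_i=d$, and composition is addition. For a small category $\mathcal C$, a $\Bbbk\mathcal C$-module is a functor from $\mathcal C$ to $\Bbbk$-modules; it is free if it is isomorphic to a direct sum of modules $\Bbbk[\operatorname{mor}_{\mathcal C}(c,-)]$. The functor $M\mapsto\bigoplus_{c\in\mathbb Z^r}M(c)$ identifies $\Bbbk\mathcal A$-modules with $\mathbb Z^r$-graded $R$-modules, so $\Bbbk[Q]$ is also a $\Bbbk\mathcal A$-module, $c\mapsto\Bbbk[Q]_c$. Let $P_\bullet$ be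 a minimal projective resolution of the $\Bbbk\mathcal A$-module $\Bbbk[Q]$ (i.e. $P_0\to\Bbbk[Q]$ and all $P_{j+1}\to\operatorname{im}(P_{j+1}\to P_j)$ are projective covers). The Betti category $\mathcal B=\mathcal B(\Bbbk[Q])$ is the full subcategory of $\mathcal A$ on those objects $c$ for which, for some $j$, $P_j(c)$ is not the sum of the images of the maps $P_j(u)$ over all non-isomorphisms $u\colon b\to c$. Let $\varrho\colon\mathcal B\to\mathcal A$ be the inclusion, let $\operatorname{ind}_\varrho$ be induction (left Kan extension) along $\varrho$, and let $\mathrm{const}_\Bbbk$ be the constant $\Bbbk\mathcal B$-module with value $\Bbbk$. Let $B_\bullet(\mathrm{const}_\Bbbk)$ be its normalized bar resolution: the simplicial module $$F^u_j(-)=\bigoplus_{c_0\to\dots\to c_j}\Bbbk[\operatorname{mor}_{\mathcal B}(c_j,-)]\otimes\mathrm{const}_\Bbbk(c_0)$$ (sum over all $j$-simplices of the nerve of $\mathcal B$), with the alternating sum of the face maps as differential, modulo the subcomplex generated by the degeneracies, and augmented to $\mathrm{const}_\Bbbk$ by the structure maps. Then $\mathrm{const}_\Bbbk\cong\Bbbk[Q]\circ\varrho$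 via the isomorphism sending $1\in\Bbbk=\mathrm{const}_\Bbbk(c)$ to $t^c$ for each object $c$ of $\mathcal B$, and $\operatorname{ind}_\varrho B_\bullet(\mathrm{const}_\Bbbk)$, with the augmentation to $\Bbbk[Q]$ adjoint to $B_0(\mathrm{const}_\Bbbk)\to\mathrm{const}_\Bbbk\cong\Bbbk[Q]\circ\varrho$, is a free resolution of $\Bbbk[Q]$ as a $\Bbbk\mathcal A$-module. In particular, the functor $M\mapsto\bigoplus_cM(c)$ turns it into a canonical finite free $\mathbb Z^r$-graded resolution $F_\bullet(\Bbbk[Q])$ of the graded $R$-module $\Bbbk[Q]$: a bounded exact complex with degree-preserving maps whose terms are free $R$-modules with finite bases of homogeneous elements. -/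

import Mathlib

open CategoryTheory
universe u
namespace Toric

section Bar
open scoped DirectSum
variable {k : Type u} [CommRing k] {C : Type} [SmallCategory C]

/-- Pairs consisting of an `n`-simplex `c₀ ⟶ ⋯ ⟶ cₙ` of the nerve and a morphism `cₙ ⟶ c`. -/
abbrev BarIndex (C : Type) [SmallCategory C] (n : ℕ) (c : C) : Type :=
  Σ s : ComposableArrows C n, (s.right ⟶ c)

/-- The `k`-module `⨁ k[mor(cₙ, c)] ⊗ M(c₀)`, the sum over all `n`-simplices `c₀ ⟶ ⋯ ⟶ cₙ` of the
nerve; since `k[S] ⊗ V = ⨁_S V`, it is written as a sum of copies of `M(c₀)` indexed by pairs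
(simplex, morphism `cₙ ⟶ c`). -/
abbrev BarSum (M : C ⥤ ModuleCat.{u} k) (n : ℕ) (c : C) : Type u :=
  ⨁ p : BarIndex C n c, M.obj p.1.left

open Classical in
/-- The inclusion of the summand `v ⊗ M(c₀)` indexed by the simplex `s`. -/
noncomputable def barGen (M : C ⥤ ModuleCat.{u} k) {n : ℕ} {c : C} (s : ComposableArrows C n)
    (v : s.right ⟶ c) : M.obj s.left →ₗ[k] BarSum M n c :=
  DirectSum.lof k (BarIndex C n c) (fun p => M.obj p.1.left) ⟨s, v⟩

open Classical in
/-- The linear map out of the direct sum with given restrictions to the summands. -/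
noncomputable def barDesc (M : C ⥤ ModuleCat.{u} k) {n : ℕ} {c : C} {V : Type u} [AddCommGroup V]
    [Module k V] (φ : ∀ (s : ComposableArrows C n) (_ : s.right ⟶ c), M.obj s.left →ₗ[k] V) :
    BarSum M n c →ₗ[k] V :=
  DirectSum.toModule k (BarIndex C n c) V fun p => φ p.1 p.2

@[simp]
theorem barDesc_gen (M : C ⥤ ModuleCat.{u} k) {n : ℕ} {c : C} {V : Type u} [AddCommGroup V]
    [Module k V] (φ : ∀ (s : ComposableArrows C n) (_ : s.right ⟶ c), M.obj s.left →ₗ[k] V)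
    (s : ComposableArrows C n) (v : s.right ⟶ c) (x : M.obj s.left) :
    barDesc M φ (barGen M s v x) = φ s v x := by
  simp [barDesc, barGen]

theorem barSum_ext (M : C ⥤ ModuleCat.{u} k) {n : ℕ} {c : C} {V : Type u} [AddCommGroup V]
    [Module k V] {f g : BarSum M n c →ₗ[k] V}
    (h : ∀ (s : ComposableArrows C n) (v : s.right ⟶ c) (x : M.obj s.left),
      f (barGen M s v x) = g (barGen M s v x)) : f = g := by
  classical
  refine DirectSum.linearMap_ext _ fun p => LinearMap.ext fun x => ?_
  have := h p.1 p.2 x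
  simp only [barGen] at this
  simp only [LinearMap.comp_apply]
  convert this

theorem barGen_congr (M : C ⥤ ModuleCat.{u} k) {n : ℕ} {c : C} {s t : ComposableArrows C n}
    (h : s = t) {v : s.right ⟶ c} {w : t.right ⟶ c} {x : M.obj s.left} {y : M.obj t.left}
    (hv : HEq v w) (hx : HEq x y) : barGen M s v x = barGen M t w y := by
  subst h
  rw [eq_of_heq hv, eq_of_heq hx]

/-- The simplicial structure of the nerve: reindexing a simplex along `θ`. -/
def pullSimplex {m n : SimplexCategory} (θ : m ⟶ n) (s : ComposableArrows C n.len) :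
    ComposableArrows C m.len :=
  θ.toOrderHom.monotone.functor ⋙ s

/-- The morphism from the first object of `s` to the first object of its reindexing. -/
def pullLeft {m n : SimplexCategory} (θ : m ⟶ n) (s : ComposableArrows C n.len) :
    s.left ⟶ (pullSimplex θ s).left :=
  s.map (homOfLE (Fin.zero_le _))

/-- The morphism from the last object of the reindexing of `s` to the last object of `s`. -/
def pullRight {m n : SimplexCategory} (θ : m ⟶ n) (s : ComposableArrows C n.len) :
    (pullSimplex θ s).right ⟶ s.right :=
  s.map (homOfLE (Fin.le_last _))

/-- Functoriality in `c`: post-composition `k[mor(cₙ, c)] → k[mor(cₙ, d)]`. -/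
noncomputable def barPush (M : C ⥤ ModuleCat.{u} k) (n : ℕ) {c d : C} (f : c ⟶ d) :
    BarSum M n c →ₗ[k] BarSum M n d :=
  barDesc M fun s v => barGen M s (v ≫ f)

/-- The simplicial operator of `θ`. For the `i`-th face this composes two neighbouring morphisms if
`0 < i < n`, applies `M(u₁)` to the coefficient if `i = 0`, and precomposes `cₙ ⟶ c` with `uₙ` if
`i = n`; for a degeneracy it inserts an identity. -/
noncomputable def barPull (M : C ⥤ ModuleCat.{u} k) {m n : SimplexCategory} (θ : m ⟶ n) (c : C) :
    BarSum M n.len c →ₗ[k] BarSum M m.len c :=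
  barDesc M fun s v =>
    barGen M (pullSimplex θ s) (pullRight θ s ≫ v) ∘ₗ (M.map (pullLeft θ s)).hom

@[simp]
theorem barPush_gen (M : C ⥤ ModuleCat.{u} k) (n : ℕ) {c d : C} (f : c ⟶ d)
    (s : ComposableArrows C n) (v : s.right ⟶ c) (x : M.obj s.left) :
    barPush M n f (barGen M s v x) = barGen M s (v ≫ f) x :=
  barDesc_gen ..

@[simp]
theorem barPull_gen (M : C ⥤ ModuleCat.{u} k) {m n : SimplexCategory} (θ : m ⟶ n) {c : C}
    (s : ComposableArrows C n.len) (v : s.right ⟶ c) (x : M.obj s.left) :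
    barPull M θ c (barGen M s v x) =
      barGen M (pullSimplex θ s) (pullRight θ s ≫ v) ((M.map (pullLeft θ s)).hom x) :=
  barDesc_gen ..

theorem barPull_id (M : C ⥤ ModuleCat.{u} k) (n : SimplexCategory) (c : C) :
    barPull M (𝟙 n) c = LinearMap.id := by
  refine barSum_ext M fun s v x => ?_
  rw [barPull_gen]
  have h1 : pullRight (𝟙 n) s = 𝟙 s.right := s.map_id _
  have h2 : pullLeft (𝟙 n) s = 𝟙 s.left := s.map_id _
  refine barGen_congr M rfl ?_ ?_
  · exact heq_of_eq ((congrArg (fun g : s.right ⟶ s.right => g ≫ v) h1).trans (Category.id_comp v))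
  · refine heq_of_eq ((congrArg (fun g : s.left ⟶ s.left => (M.map g).hom x) h2).trans ?_)
    rw [M.map_id]; rfl

theorem barPull_comp (M : C ⥤ ModuleCat.{u} k) {l m n : SimplexCategory} (η : l ⟶ m) (θ : m ⟶ n)
    (c : C) : barPull M (η ≫ θ) c = barPull M η c ∘ₗ barPull M θ c := by
  refine barSum_ext M fun s v x => ?_
  have h1 : pullRight (η ≫ θ) s = pullRight η (pullSimplex θ s) ≫ pullRight θ s :=
    s.map_comp (X := θ.toOrderHom (η.toOrderHom (Fin.last _))) (Y := θ.toOrderHom (Fin.last _))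
      (Z := Fin.last _) (homOfLE (θ.toOrderHom.monotone (Fin.le_last _))) (homOfLE (Fin.le_last _))
  have h2 : pullLeft (η ≫ θ) s = pullLeft θ s ≫ pullLeft η (pullSimplex θ s) :=
    s.map_comp (X := 0) (Y := θ.toOrderHom 0) (Z := θ.toOrderHom (η.toOrderHom 0))
      (homOfLE (Fin.zero_le _)) (homOfLE (θ.toOrderHom.monotone (Fin.zero_le _)))
  rw [LinearMap.comp_apply, barPull_gen, barPull_gen, barPull_gen]
  refine barGen_congr M rfl ?_ ?_
  · exact heq_of_eq ((congrArg (fun g : (pullSimplex η (pullSimplex θ s)).right ⟶ s.right => g ≫ v)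
      h1).trans (Category.assoc _ _ _))
  · refine heq_of_eq ((congrArg (fun g : s.left ⟶ (pullSimplex η (pullSimplex θ s)).left =>
      (M.map g).hom x) h2).trans ?_)
    rw [M.map_comp]; rfl

theorem barPull_push (M : C ⥤ ModuleCat.{u} k) {m n : SimplexCategory} (θ : m ⟶ n) {c d : C}
    (f : c ⟶ d) :
    barPull M θ d ∘ₗ barPush M n.len f = barPush M m.len f ∘ₗ barPull M θ c := by
  refine barSum_ext M fun s v x => ?_
  simp only [LinearMap.comp_apply, barPush_gen, barPull_gen, Category.assoc]

/-- The `n`-th term of the unnormalized bar resolution of `M`. -/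
noncomputable def barObj (M : C ⥤ ModuleCat.{u} k) (n : ℕ) : C ⥤ ModuleCat.{u} k where
  obj c := ModuleCat.of k (BarSum M n c)
  map f := ModuleCat.ofHom (barPush M n f)
  map_id c := by
    ext : 1
    exact barSum_ext M fun s v x => by simp
  map_comp f g := by
    ext : 1
    exact barSum_ext M fun s v x => by simp

/-- The unnormalized bar resolution of `M` as a simplicial module over `C`. -/
noncomputable def simplicialBar (M : C ⥤ ModuleCat.{u} k) :
    SimplicialObject (C ⥤ ModuleCat.{u} k) where
  obj n := barObj M n.unop.len
  map θ :=
    { app := fun c => ModuleCat.ofHom (barPull M θ.unop c)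
      naturality := fun c d f => by
        ext : 1
        exact barPull_push M θ.unop f }
  map_id n := by
    ext c : 3
    exact barPull_id M n.unop c
  map_comp f g := by
    ext c : 3
    exact barPull_comp M g.unop f.unop c

theorem simplicialBar_map_app (M : C ⥤ ModuleCat.{u} k) {m n : SimplexCategory} (θ : m ⟶ n) (c : C) :
    (((simplicialBar M).map θ.op).app c).hom = barPull M θ c := rfl

/-- The structure maps `k[mor(c₀, c)] ⊗ M(c₀) → M(c)`. -/
noncomputable def barEval (M : C ⥤ ModuleCat.{u} k) (c : C) : BarSum M 0 c →ₗ[k] M.obj c :=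
  barDesc M fun _ v => (M.map v).hom

theorem barEval_push (M : C ⥤ ModuleCat.{u} k) {c d : C} (f : c ⟶ d) :
    barEval M d ∘ₗ barPush M 0 f = (M.map f).hom ∘ₗ barEval M c := by
  refine barSum_ext M fun s v x => ?_
  rw [LinearMap.comp_apply, LinearMap.comp_apply, barPush_gen, barEval, barEval, barDesc_gen,
    barDesc_gen, M.map_comp]
  rfl

/-- The augmentation of the unnormalized bar resolution. -/
noncomputable def barAug (M : C ⥤ ModuleCat.{u} k) : barObj M 0 ⟶ M where
  app c := ModuleCat.ofHom (barEval M c)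
  naturality c d f := by
    ext : 1
    exact barEval_push M f

end Bar

section Normalized
open scoped Simplicial
variable {k : Type u} [CommRing k] {C : Type} [SmallCategory C]
  (X : SimplicialObject (C ⥤ ModuleCat.{u} k))

/-- The submodule generated by the images of the degeneracy maps. -/
def degenerate (n : ℕ) (c : C) : Submodule k ((X _⦋n⦌).obj c) :=
  match n with
  | 0 => ⊥
  | n + 1 => ⨆ i : Fin (n + 1), LinearMap.range ((X.σ i).app c).hom

theorem degenerate_le_map (n : ℕ) {c d : C} (f : c ⟶ d) :
    degenerate X n c ≤ (degenerate X n d).comap ((X _⦋n⦌).map f).hom := by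
  cases n with
  | zero => exact bot_le
  | succ n =>
    refine iSup_le fun i => ?_
    rintro _ ⟨x, rfl⟩
    refine Submodule.mem_iSup_of_mem i ⟨((X _⦋n⦌).map f).hom x, ?_⟩
    exact congrArg (fun g => g.hom x) ((X.σ i).naturality f)

theorem degenerate_le_d (n : ℕ) (c : C) :
    degenerate X (n + 1) c ≤
      (degenerate X n c).comap
        ((AlgebraicTopology.AlternatingFaceMapComplex.objD X n).app c).hom := by
  refine iSup_le fun j => ?_
  rintro _ ⟨x, rfl⟩
  have key : ∀ i : Fin (n + 2), i ≠ j.castSucc → i ≠ j.succ →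
      ((X.δ i).app c).hom (((X.σ j).app c).hom x) ∈ degenerate X n c := by
    intro i h1 h2
    cases n with
    | zero =>
      exfalso
      have := j.isLt; have := i.isLt
      simp only [ne_eq, Fin.ext_iff, Fin.val_castSucc, Fin.val_succ] at h1 h2
      omega
    | succ n =>
      rcases lt_or_ge i j.castSucc with h | h
      · obtain ⟨j', rfl⟩ := Fin.exists_succ_eq.mpr (show j ≠ 0 by rintro rfl; exact absurd h (Fin.not_lt_zero _))
        obtain ⟨i', rfl⟩ := Fin.exists_castSucc_eq.mpr (show i ≠ Fin.last _ by
          rintro rfl; exact absurd h (not_lt.mpr (Fin.le_last _)))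
        have hle : i' ≤ j'.castSucc := by
          simp only [Fin.lt_def, Fin.le_def, Fin.val_castSucc, Fin.val_succ] at h ⊢
          omega
        have e := X.δ_comp_σ_of_le hle
        refine Submodule.mem_iSup_of_mem j' ⟨((X.δ i').app c).hom x, ?_⟩
        exact (congrArg (fun g => (g.app c).hom x) e).symm
      · obtain ⟨i', rfl⟩ := Fin.exists_succ_eq.mpr (show i ≠ 0 by
          rintro rfl
          exact h1 (le_antisymm (Fin.zero_le _) h))
        obtain ⟨j', rfl⟩ := Fin.exists_castSucc_eq.mpr (show j ≠ Fin.last _ by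
          rintro rfl
          have := i'.isLt
          simp only [ne_eq, Fin.ext_iff, Fin.le_def, Fin.val_castSucc, Fin.val_succ,
            Fin.val_last] at *
          omega)
        have hlt : j'.castSucc < i' := by
          simp only [ne_eq, Fin.ext_iff, Fin.le_def, Fin.lt_def, Fin.val_castSucc,
            Fin.val_succ] at *
          omega
        have e := X.δ_comp_σ_of_gt hlt
        refine Submodule.mem_iSup_of_mem j' ⟨((X.δ i').app c).hom x, ?_⟩
        exact (congrArg (fun g => (g.app c).hom x) e).symm
  rw [Submodule.mem_comap, ← Submodule.Quotient.mk_eq_zero]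
  have hs : ((AlgebraicTopology.AlternatingFaceMapComplex.objD X n).app c).hom
      (((X.σ j).app c).hom x) =
      ∑ i : Fin (n + 2), (-1 : ℤ) ^ (i : ℕ) • ((X.δ i).app c).hom (((X.σ j).app c).hom x) := by
    simp [AlgebraicTopology.AlternatingFaceMapComplex.objD]
  have e1 : ((X.δ j.castSucc).app c).hom (((X.σ j).app c).hom x) = x :=
    congrArg (fun g => (g.app c).hom x) (X.δ_comp_σ_self (i := j))
  have e2 : ((X.δ j.succ).app c).hom (((X.σ j).app c).hom x) = x :=
    congrArg (fun g => (g.app c).hom x) (X.δ_comp_σ_succ (i := j))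
  rw [hs, ← Submodule.mkQ_apply, map_sum, Fintype.sum_eq_add j.castSucc j.succ
    (Fin.castSucc_lt_succ).ne]
  · rw [e1, e2]
    simp [pow_succ]
  · rintro i ⟨h1, h2⟩
    rw [Submodule.mkQ_apply, Submodule.Quotient.mk_eq_zero]
    exact (degenerate X n c).toAddSubgroup.zsmul_mem (key i h1 h2) _

/-- The quotient of the `n`-th term by the degenerate submodule. -/
noncomputable def normalizedObj (n : ℕ) : C ⥤ ModuleCat.{u} k where
  obj c := ModuleCat.of k (((X _⦋n⦌).obj c) ⧸ degenerate X n c)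
  map f := ModuleCat.ofHom (Submodule.mapQ _ _ ((X _⦋n⦌).map f).hom (degenerate_le_map X n f))
  map_id c := by
    ext : 1
    refine Submodule.linearMap_qext _ (LinearMap.ext fun x => ?_)
    simp
  map_comp f g := by
    ext : 1
    refine Submodule.linearMap_qext _ (LinearMap.ext fun x => ?_)
    simp

/-- The map induced on the quotients by the alternating sum of the face maps. -/
noncomputable def normalizedD (n : ℕ) : normalizedObj X (n + 1) ⟶ normalizedObj X n where
  app c := ModuleCat.ofHom (Submodule.mapQ _ _
    ((AlgebraicTopology.AlternatingFaceMapComplex.objD X n).app c).hom (degenerate_le_d X n c))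
  naturality c d f := by
    ext : 1
    refine Submodule.linearMap_qext _ (LinearMap.ext fun x => ?_)
    exact congrArg (Submodule.mkQ _) (congrArg (fun g => g.hom x)
      ((AlgebraicTopology.AlternatingFaceMapComplex.objD X n).naturality f))

/-- The normalized chain complex: unnormalized complex modulo degenerate subcomplex. -/
noncomputable def normalizedComplex : ChainComplex (C ⥤ ModuleCat.{u} k) ℕ :=
  ChainComplex.of (normalizedObj X) (normalizedD X) fun n => by
    ext c : 3
    refine Submodule.linearMap_qext _ (LinearMap.ext fun x => ?_)
    exact congrArg (Submodule.mkQ _) (congrArg (fun g => (g.app c).hom x)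
      (AlgebraicTopology.AlternatingFaceMapComplex.d_squared X n))

theorem normalizedComplex_d (n : ℕ) : (normalizedComplex X).d (n + 1) n = normalizedD X n :=
  ChainComplex.of_d (normalizedObj X) (normalizedD X) n

end Normalized

section
variable {k : Type u} [CommRing k] {C : Type} [SmallCategory C]
/-- The normalized bar resolution of `M`. -/
noncomputable def normalizedBar (M : C ⥤ ModuleCat.{u} k) : ChainComplex (C ⥤ ModuleCat.{u} k) ℕ :=
  normalizedComplex (simplicialBar M)

/-- The augmentation of the normalized bar resolution. -/
noncomputable def normalizedBarAug (M : C ⥤ ModuleCat.{u} k) : (normalizedBar M).X 0 ⟶ M where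
  app c := ModuleCat.ofHom (Submodule.liftQ (degenerate (simplicialBar M) 0 c)
      ((barAug M).app c).hom bot_le)
  naturality c d f := by
    ext : 1
    refine Submodule.linearMap_qext _ (LinearMap.ext fun x => ?_)
    exact congrArg (fun g => g.hom x) ((barAug M).naturality f)
end

section Resolutions
variable {k : Type u} [CommRing k] {C : Type} [SmallCategory C]

/-- The free module `⨁_c ⨁_{B(c)} k[mor(c, -)]` over the category `C`. -/
noncomputable def freeModule (k : Type u) [CommRing k] {C : Type} [SmallCategory C]
    (B : C → Type u) : C ⥤ ModuleCat.{u} k where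
  obj d := ModuleCat.of k ((Σ c : C, B c × (c ⟶ d)) →₀ k)
  map f := ModuleCat.ofHom (Finsupp.lmapDomain k k fun p => ⟨p.1, p.2.1, p.2.2 ≫ f⟩)
  map_id d := by
    ext : 1
    refine Finsupp.lhom_ext fun p x => ?_
    simp
  map_comp f g := by
    ext : 1
    refine Finsupp.lhom_ext fun p x => ?_
    simp

def IsFreeModule (M : C ⥤ ModuleCat.{u} k) : Prop :=
  ∃ B : C → Type u, Nonempty (M ≅ freeModule k B)

/-- The complex `P` with augmentation `ε` is a resolution of `M` (exactness is object-wise). -/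
structure IsResolution (P : ChainComplex (C ⥤ ModuleCat.{u} k) ℕ) {M : C ⥤ ModuleCat.{u} k}
    (ε : P.X 0 ⟶ M) : Prop where
  surjective : ∀ c, Function.Surjective (ε.app c).hom
  exact_zero : ∀ c, Function.Exact ((P.d 1 0).app c).hom (ε.app c).hom
  exact_succ : ∀ n c,
    Function.Exact ((P.d (n + 2) (n + 1)).app c).hom ((P.d (n + 1) n).app c).hom

structure IsFreeResolution (P : ChainComplex (C ⥤ ModuleCat.{u} k) ℕ) {M : C ⥤ ModuleCat.{u} k}
    (ε : P.X 0 ⟶ M) : Prop extends IsResolution P ε where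
  free : ∀ n, IsFreeModule (P.X n)

/-- A superfluous epimorphism with projective source. -/
structure IsProjectiveCover {A : Type*} [Category A] {P M : A} (f : P ⟶ M) : Prop where
  projective : Projective P
  epi : Epi f
  superfluous : ∀ ⦃K : A⦄ (g : K ⟶ P), Epi g ↔ Epi (g ≫ f)

/-- A resolution for which `ε : P₀ ⟶ M` and all `Pₙ₊₁ ⟶ im d` are projective covers. -/
structure IsMinimalProjectiveResolution (P : ChainComplex (C ⥤ ModuleCat.{u} k) ℕ)
    {M : C ⥤ ModuleCat.{u} k} (ε : P.X 0 ⟶ M) : Prop extends IsResolution P ε where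
  cover_zero : IsProjectiveCover ε
  cover_succ : ∀ n, IsProjectiveCover (Limits.factorThruImage (P.d (n + 1) n))

/-- The submodule of `M(c)` generated by the images of all non-isomorphisms into `c`. -/
def jrad (M : C ⥤ ModuleCat.{u} k) (c : C) : Submodule k (M.obj c) :=
  ⨆ (b : C) (u : b ⟶ c) (_ : ¬ IsIso u), LinearMap.range (M.map u).hom

/-- The value at `c` of the splitting functor. -/
abbrev spl (M : C ⥤ ModuleCat.{u} k) (c : C) : Type u := M.obj c ⧸ jrad M c

/-- The objects `c` such that the splitting functor does not vanish at `c` on a minimal projective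
resolution of `M`. (Minimal projective resolutions are unique up to isomorphism.) -/
def bettiObjects (M : C ⥤ ModuleCat.{u} k) : ObjectProperty C := fun c =>
  ∃ (P : ChainComplex (C ⥤ ModuleCat.{u} k) ℕ) (ε : P.X 0 ⟶ M),
    IsMinimalProjectiveResolution P ε ∧ ∃ n, Nontrivial (spl (P.X n) c)

/-- The Betti category of `M`: the full subcategory on the objects above. -/
abbrev BettiCategory (M : C ⥤ ModuleCat.{u} k) : Type := (bettiObjects M).FullSubcategory

abbrev bettiInclusion (M : C ⥤ ModuleCat.{u} k) : BettiCategory M ⥤ C := (bettiObjects M).ι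

end Resolutions

section Induction
variable {k : Type u} [CommRing k] {C D : Type} [SmallCategory C] [SmallCategory D]

/-- Induction along `α`, i.e. left Kan extension, the left adjoint of restriction along `α`. -/
noncomputable abbrev indFunctor (k : Type u) [CommRing k] (α : C ⥤ D) :
    (C ⥤ ModuleCat.{u} k) ⥤ (D ⥤ ModuleCat.{u} k) := α.lan

instance (α : C ⥤ D) : (indFunctor k α).Additive :=
  (α.lanAdjunction (ModuleCat.{u} k)).left_adjoint_additive

/-- Induction applied to a chain complex of modules. -/
noncomputable def inducedComplex (α : C ⥤ D) (P : ChainComplex (C ⥤ ModuleCat.{u} k) ℕ) :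
    ChainComplex (D ⥤ ModuleCat.{u} k) ℕ :=
  ((indFunctor k α).mapHomologicalComplex _).obj P

/-- The augmentation `ind P₀ ⟶ ind M ≅ ind (res N) ⟶ N` of the induced complex, obtained from an
augmentation `ε : P₀ ⟶ M` and an isomorphism `e : M ≅ res N`; it is the adjoint of `ε ≫ e`. -/
noncomputable def inducedAug (α : C ⥤ D) (P : ChainComplex (C ⥤ ModuleCat.{u} k) ℕ)
    {M : C ⥤ ModuleCat.{u} k} (ε : P.X 0 ⟶ M) {N : D ⥤ ModuleCat.{u} k} (e : M ≅ α ⋙ N) :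
    (inducedComplex α P).X 0 ⟶ N :=
  ((α.lanAdjunction (ModuleCat.{u} k)).homEquiv (P.X 0) N).symm (ε ≫ e.hom)

end Induction

section Action
variable {σ Γ : Type} [AddCommGroup Γ]

/-- A copy of `Γ`, on which the exponent vectors `ℕ^σ` act through `w`. -/
def GradingGroup (_ : σ → Γ) : Type := Γ

def GradingGroup.val {w : σ → Γ} (c : GradingGroup w) : Γ := c

noncomputable instance (w : σ → Γ) : MulAction (Multiplicative (σ →₀ ℕ)) (GradingGroup w) where
  smul m c := (Finsupp.weight w m.toAdd + c.val : Γ)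
  one_smul c := by
    change Finsupp.weight w (0 : σ →₀ ℕ) + c.val = c.val
    rw [map_zero, zero_add]
  mul_smul m m' c := by
    change Finsupp.weight w (m.toAdd + m'.toAdd) + c.val =
      Finsupp.weight w m.toAdd + (Finsupp.weight w m'.toAdd + c.val)
    rw [map_add, add_assoc]

/-- The action category of `ℕ^σ` acting on `Γ` by `m • c = ∑ mᵢ w(i) + c`. -/
abbrev ActCat (w : σ → Γ) : Type :=
  ActionCategory (Multiplicative (σ →₀ ℕ)) (GradingGroup w)

namespace ActCat

/-- The object of the action category given by `γ`. -/
noncomputable def of (w : σ → Γ) (γ : Γ) : ActCat w :=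
  ActionCategory.objEquiv (Multiplicative (σ →₀ ℕ)) (GradingGroup w) γ

/-- The element of `Γ` underlying an object of the action category. -/
noncomputable def deg {w : σ → Γ} (c : ActCat w) : Γ := GradingGroup.val (ActionCategory.back c)

/-- The exponent vector underlying a morphism of the action category. -/
noncomputable def expo {w : σ → Γ} {c d : ActCat w} (f : c ⟶ d) : σ →₀ ℕ :=
  Multiplicative.toAdd f.val

theorem weight_expo {w : σ → Γ} {c d : ActCat w} (f : c ⟶ d) :
    Finsupp.weight w (expo f) + c.deg = d.deg :=
  f.property

theorem expo_id {w : σ → Γ} (c : ActCat w) : expo (𝟙 c) = 0 := rfl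

theorem expo_comp {w : σ → Γ} {c d e : ActCat w} (f : c ⟶ d) (g : d ⟶ e) :
    expo (f ≫ g) = expo g + expo f := rfl

/-- The morphism given by an exponent vector of the right weight. -/
noncomputable def homMk {w : σ → Γ} (m : σ →₀ ℕ) {c d : ActCat w} (h : Finsupp.weight w m + c.deg = d.deg) :
    c ⟶ d :=
  ⟨Multiplicative.ofAdd m, h⟩

theorem hom_ext {w : σ → Γ} {c d : ActCat w} {f g : c ⟶ d} (h : expo f = expo g) : f = g :=
  Subtype.ext h

theorem expo_homMk {w : σ → Γ} (m : σ →₀ ℕ) {c d : ActCat w}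
    (h : Finsupp.weight w m + c.deg = d.deg) : expo (homMk m h) = m := rfl

theorem deg_of (w : σ → Γ) (γ : Γ) : (of w γ).deg = γ := rfl

end ActCat
end Action

section Total
open scoped DirectSum
variable {σ Γ : Type} [AddCommGroup Γ] [DecidableEq Γ] {k : Type u} [CommRing k] {w : σ → Γ}

/-- The total module `⨁_γ M(γ)` of a module over the action category. -/
def TotalSum (M : ActCat w ⥤ ModuleCat.{u} k) : Type u := ⨁ γ : Γ, M.obj (ActCat.of w γ)

noncomputable instance (M : ActCat w ⥤ ModuleCat.{u} k) : AddCommGroup (TotalSum M) :=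
  inferInstanceAs (AddCommGroup (⨁ γ : Γ, M.obj (ActCat.of w γ)))

noncomputable instance (M : ActCat w ⥤ ModuleCat.{u} k) : Module k (TotalSum M) :=
  inferInstanceAs (Module k (⨁ γ : Γ, M.obj (ActCat.of w γ)))

namespace TotalSum

/-- The inclusion of the component of degree `γ`. -/
noncomputable def incl (M : ActCat w ⥤ ModuleCat.{u} k) (γ : Γ) :
    M.obj (ActCat.of w γ) →ₗ[k] TotalSum M :=
  DirectSum.lof k Γ (fun γ => M.obj (ActCat.of w γ)) γ

/-- The linear map out of the total module with given restrictions to the components. -/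
noncomputable def desc (M : ActCat w ⥤ ModuleCat.{u} k) {V : Type*} [AddCommGroup V] [Module k V]
    (φ : ∀ γ, M.obj (ActCat.of w γ) →ₗ[k] V) : TotalSum M →ₗ[k] V :=
  DirectSum.toModule k Γ V φ

theorem desc_incl (M : ActCat w ⥤ ModuleCat.{u} k) {V : Type*} [AddCommGroup V] [Module k V]
    (φ : ∀ γ, M.obj (ActCat.of w γ) →ₗ[k] V) (γ : Γ) (x : M.obj (ActCat.of w γ)) :
    desc M φ (incl M γ x) = φ γ x :=
  DirectSum.toModule_lof (M := fun γ => M.obj (ActCat.of w γ)) (φ := φ) k γ x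

theorem hom_ext (M : ActCat w ⥤ ModuleCat.{u} k) {V : Type*} [AddCommGroup V] [Module k V]
    {f g : TotalSum M →ₗ[k] V} (h : ∀ γ x, f (incl M γ x) = g (incl M γ x)) : f = g :=
  DirectSum.linearMap_ext _ fun γ => LinearMap.ext fun x => h γ x

/-- Multiplication by the monomial `x^m`: on the component of degree `γ` it is `M` applied to the
morphism `m : γ ⟶ ∑ mᵢ w(i) + γ`. -/
noncomputable def monomialAct (M : ActCat w ⥤ ModuleCat.{u} k) (m : σ →₀ ℕ) :
    TotalSum M →ₗ[k] TotalSum M :=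
  desc M fun γ => incl M (Finsupp.weight w m + γ) ∘ₗ
    (M.map (ActCat.homMk (d := ActCat.of w (Finsupp.weight w m + γ)) m rfl)).hom

theorem monomialAct_incl (M : ActCat w ⥤ ModuleCat.{u} k) (m : σ →₀ ℕ) {γ δ : Γ}
    (f : ActCat.of w γ ⟶ ActCat.of w δ) (hf : ActCat.expo f = m) (x : M.obj (ActCat.of w γ)) :
    monomialAct M m (incl M γ x) = incl M δ ((M.map f).hom x) := by
  have h : Finsupp.weight w m + γ = δ := hf ▸ ActCat.weight_expo f
  subst h
  rw [monomialAct, desc_incl, LinearMap.comp_apply]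
  congr 4
  exact ActCat.hom_ext hf.symm

theorem monomialAct_zero (M : ActCat w ⥤ ModuleCat.{u} k) : monomialAct M 0 = LinearMap.id := by
  refine hom_ext M fun γ x => ?_
  rw [monomialAct_incl M 0 (𝟙 _) rfl, M.map_id]
  rfl

theorem monomialAct_add (M : ActCat w ⥤ ModuleCat.{u} k) (m m' : σ →₀ ℕ) :
    monomialAct M (m + m') = monomialAct M m ∘ₗ monomialAct M m' := by
  refine hom_ext M fun γ x => ?_
  let f : ActCat.of w γ ⟶ ActCat.of w (Finsupp.weight w m' + γ) := ActCat.homMk m' rfl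
  let g : ActCat.of w (Finsupp.weight w m' + γ) ⟶
    ActCat.of w (Finsupp.weight w m + (Finsupp.weight w m' + γ)) := ActCat.homMk m rfl
  rw [LinearMap.comp_apply, monomialAct_incl M m' f rfl, monomialAct_incl M m g rfl,
    monomialAct_incl M (m + m') (f ≫ g) rfl, M.map_comp]
  rfl

/-- The action of the polynomial ring on the total module. -/
noncomputable def polyAct (M : ActCat w ⥤ ModuleCat.{u} k) :
    MvPolynomial σ k →ₐ[k] Module.End k (TotalSum M) :=
  AddMonoidAlgebra.lift k (Module.End k (TotalSum M)) (σ →₀ ℕ)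
    { toFun := fun m => monomialAct M m.toAdd
      map_one' := monomialAct_zero M
      map_mul' := fun m m' => monomialAct_add M m.toAdd m'.toAdd }

noncomputable instance (M : ActCat w ⥤ ModuleCat.{u} k) :
    Module (MvPolynomial σ k) (TotalSum M) :=
  Module.compHom (TotalSum M) (polyAct M).toRingHom

theorem monomial_smul (M : ActCat w ⥤ ModuleCat.{u} k) (m : σ →₀ ℕ) (a : k) (x : TotalSum M) :
    MvPolynomial.monomial m a • x = a • monomialAct M m x := by
  change polyAct M (MvPolynomial.monomial m a) x = _
  rw [polyAct, MvPolynomial.monomial, ]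
  simp [AddMonoidAlgebra.lift_single]

/-- The map induced on total modules by a homomorphism of modules over the action category. -/
noncomputable def mapLinear {M N : ActCat w ⥤ ModuleCat.{u} k} (f : M ⟶ N) :
    TotalSum M →ₗ[k] TotalSum N :=
  desc M fun γ => incl N γ ∘ₗ (f.app (ActCat.of w γ)).hom

theorem mapLinear_incl {M N : ActCat w ⥤ ModuleCat.{u} k} (f : M ⟶ N) (γ : Γ)
    (x : M.obj (ActCat.of w γ)) :
    mapLinear f (incl M γ x) = incl N γ ((f.app (ActCat.of w γ)).hom x) :=
  desc_incl ..

theorem mapLinear_monomialAct {M N : ActCat w ⥤ ModuleCat.{u} k} (f : M ⟶ N) (m : σ →₀ ℕ) :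
    mapLinear f ∘ₗ monomialAct M m = monomialAct N m ∘ₗ mapLinear f := by
  refine hom_ext M fun γ x => ?_
  let g : ActCat.of w γ ⟶ ActCat.of w (Finsupp.weight w m + γ) := ActCat.homMk m rfl
  rw [LinearMap.comp_apply, LinearMap.comp_apply, monomialAct_incl M m g rfl, mapLinear_incl,
    mapLinear_incl, monomialAct_incl N m g rfl]
  exact congrArg (incl N _) (congrArg (fun h => h.hom x) (f.naturality g))

theorem map_smul_of_monomial {M : ActCat w ⥤ ModuleCat.{u} k} {V : Type*} [AddCommGroup V]
    [Module (MvPolynomial σ k) V] [Module k V] [IsScalarTower k (MvPolynomial σ k) V]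
    (φ : TotalSum M →ₗ[k] V)
    (h : ∀ m x, φ (monomialAct M m x) = MvPolynomial.monomial m (1 : k) • φ x)
    (p : MvPolynomial σ k) (x : TotalSum M) : φ (p • x) = p • φ x := by
  induction p using MvPolynomial.induction_on' with
  | monomial m a =>
    rw [monomial_smul, map_smul, h, ← smul_assoc, MvPolynomial.smul_monomial, smul_eq_mul, mul_one]
  | add p q hp hq => rw [add_smul, add_smul, map_add, hp, hq]

instance (M : ActCat w ⥤ ModuleCat.{u} k) : IsScalarTower k (MvPolynomial σ k) (TotalSum M) where
  smul_assoc a p x := by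
    change polyAct M (a • p) x = a • polyAct M p x
    rw [map_smul]; rfl

noncomputable def map {M N : ActCat w ⥤ ModuleCat.{u} k} (f : M ⟶ N) :
    TotalSum M →ₗ[MvPolynomial σ k] TotalSum N where
  toFun := mapLinear f
  map_add' := map_add _
  map_smul' := map_smul_of_monomial (mapLinear f) fun m x => by
    rw [monomial_smul, one_smul]
    exact LinearMap.congr_fun (mapLinear_monomialAct f m) x

/-- The component of degree `γ` of the total module. -/
noncomputable def piece (M : ActCat w ⥤ ModuleCat.{u} k) (γ : Γ) : AddSubgroup (TotalSum M) :=
  (LinearMap.range (incl M γ)).toAddSubgroup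

end TotalSum

/-- The functor `M ↦ ⨁_γ M(γ)` from modules over the action category to modules over the polynomial
ring; its values are graded by `TotalSum.piece`. -/
noncomputable def totalFunctor (k : Type u) [CommRing k] (w : σ → Γ) :
    (ActCat w ⥤ ModuleCat.{u} k) ⥤ ModuleCat.{u} (MvPolynomial σ k) where
  obj M := ModuleCat.of (MvPolynomial σ k) (TotalSum M)
  map f := ModuleCat.ofHom (TotalSum.map f)
  map_id M := by
    ext x
    refine LinearMap.congr_fun (f := TotalSum.mapLinear (𝟙 M)) (g := LinearMap.id) ?_ x
    exact TotalSum.hom_ext M fun γ x => by rw [TotalSum.mapLinear_incl]; rfl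
  map_comp {L M N} f g := by
    ext x
    refine LinearMap.congr_fun (f := TotalSum.mapLinear (f ≫ g))
      (g := TotalSum.mapLinear g ∘ₗ TotalSum.mapLinear f) ?_ x
    exact TotalSum.hom_ext L fun γ x => by
      rw [LinearMap.comp_apply, TotalSum.mapLinear_incl, TotalSum.mapLinear_incl,
        TotalSum.mapLinear_incl]
      rfl

instance : (totalFunctor k w).Additive where
  map_add {M N f g} := by
    ext x
    refine LinearMap.congr_fun (f := TotalSum.mapLinear (f + g))
      (g := TotalSum.mapLinear f + TotalSum.mapLinear g) ?_ x
    exact TotalSum.hom_ext M fun γ x => by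
      rw [LinearMap.add_apply, TotalSum.mapLinear_incl, TotalSum.mapLinear_incl,
        TotalSum.mapLinear_incl, ← map_add]
      rfl

end Total

section SemigroupRing
variable {σ Γ Q : Type} [AddCommGroup Γ] [AddCommMonoid Q]

/-- The semigroup ring `k[Q]`; the generators `a` determine its structure of a module over the
polynomial ring. -/
def SemigroupRing (k : Type u) [CommRing k] (_ : σ → Q) : Type u := AddMonoidAlgebra k Q

noncomputable instance (k : Type u) [CommRing k] (a : σ → Q) : CommRing (SemigroupRing k a) :=
  inferInstanceAs (CommRing (AddMonoidAlgebra k Q))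

noncomputable instance (k : Type u) [CommRing k] (a : σ → Q) : Algebra k (SemigroupRing k a) :=
  inferInstanceAs (Algebra k (AddMonoidAlgebra k Q))

namespace SemigroupRing

/-- The monomial `t^q` of `k[Q]`. -/
noncomputable def monom (k : Type u) [CommRing k] (a : σ → Q) (q : Q) : SemigroupRing k a :=
  AddMonoidAlgebra.single q (1 : k)

theorem monom_zero (k : Type u) [CommRing k] (a : σ → Q) : monom k a 0 = 1 := rfl

theorem monom_add (k : Type u) [CommRing k] (a : σ → Q) (p q : Q) :
    monom k a (p + q) = monom k a p * monom k a q :=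
  (AddMonoidAlgebra.single_mul_single ..).symm.symm.trans (by rw [one_mul]; rfl) |>.symm

/-- The algebra homomorphism `k[x] → k[Q]` with `xᵢ ↦ t^(a i)`. -/
noncomputable def ofPolynomial (k : Type u) [CommRing k] (a : σ → Q) :
    MvPolynomial σ k →ₐ[k] SemigroupRing k a :=
  MvPolynomial.aeval fun i => monom k a (a i)

noncomputable instance (k : Type u) [CommRing k] (a : σ → Q) :
    Module (MvPolynomial σ k) (SemigroupRing k a) :=
  Module.compHom (SemigroupRing k a) (ofPolynomial k a).toRingHom

theorem smul_def (k : Type u) [CommRing k] (a : σ → Q) (p : MvPolynomial σ k)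
    (x : SemigroupRing k a) : p • x = ofPolynomial k a p * x := rfl

instance (k : Type u) [CommRing k] (a : σ → Q) :
    IsScalarTower k (MvPolynomial σ k) (SemigroupRing k a) where
  smul_assoc c p x := by
    rw [smul_def, smul_def, map_smul, smul_mul_assoc]

theorem ofPolynomial_monomial (k : Type u) [CommRing k] (a : σ → Q) (m : σ →₀ ℕ) :
    ofPolynomial k a (MvPolynomial.monomial m 1) = monom k a (Finsupp.weight a m) := by
  have hpow : ∀ (q : Q) (j : ℕ), monom k a q ^ j = monom k a (j • q) := by
    intro q j
    induction j with
    | zero => rw [pow_zero, zero_smul, monom_zero]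
    | succ j ih => rw [pow_succ, ih, succ_nsmul, monom_add]
  rw [ofPolynomial, MvPolynomial.aeval_monomial, map_one, one_mul, Finsupp.weight_apply,
    Finsupp.sum, Finsupp.prod]
  simp only [hpow]
  induction m.support using Finset.cons_induction with
  | empty => rfl
  | cons i s hi ih => rw [Finset.prod_cons, Finset.sum_cons, ih, monom_add]

/-- The component of degree `γ` of `k[Q]`, spanned by the `t^q` with `deg q = γ`. -/
def piece (k : Type u) [CommRing k] (deg : Q →+ Γ) (a : σ → Q) (γ : Γ) :
    Submodule k (SemigroupRing k a) :=
  AddMonoidAlgebra.gradeBy k deg γ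

theorem monom_mem_piece (k : Type u) [CommRing k] (deg : Q →+ Γ) (a : σ → Q) {q : Q} {γ : Γ}
    (h : deg q = γ) : monom k a q ∈ piece k deg a γ := by
  subst h
  exact AddMonoidAlgebra.single_mem_gradeBy (R := k) deg q 1

theorem map_weight (deg : Q →+ Γ) (a : σ → Q) (m : σ →₀ ℕ) :
    deg (Finsupp.weight a m) = Finsupp.weight (fun i => deg (a i)) m := by
  simp [Finsupp.weight_apply, Finsupp.sum, map_sum]

theorem monomial_smul_mem (k : Type u) [CommRing k] (deg : Q →+ Γ) (a : σ → Q) (m : σ →₀ ℕ)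
    {γ δ : Γ} (h : Finsupp.weight (fun i => deg (a i)) m + γ = δ) {x : SemigroupRing k a}
    (hx : x ∈ piece k deg a γ) : MvPolynomial.monomial m (1 : k) • x ∈ piece k deg a δ := by
  classical
  rw [smul_def, ofPolynomial_monomial, ← h]
  exact SetLike.mul_mem_graded (A := AddMonoidAlgebra.gradeBy k deg)
    (monom_mem_piece k deg a (map_weight deg a m)) hx

/-- The graded module `k[Q]` as a module over the action category: `γ` is sent to the component of
degree `γ`, and a morphism `m` to multiplication by `x^m`. -/
noncomputable def toFunctor (k : Type u) [CommRing k] (deg : Q →+ Γ) (a : σ → Q) :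
    ActCat (fun i => deg (a i)) ⥤ ModuleCat.{u} k where
  obj c := ModuleCat.of k (piece k deg a c.deg)
  map f := ModuleCat.ofHom
    { toFun := fun x => ⟨MvPolynomial.monomial (ActCat.expo f) (1 : k) • x.1,
        monomial_smul_mem k deg a _ (ActCat.weight_expo f) x.2⟩
      map_add' := fun x y => Subtype.ext (smul_add _ _ _)
      map_smul' := fun b x => Subtype.ext (mul_smul_comm b _ (x.1 : SemigroupRing k a)) }
  map_id c := by
    ext x
    exact one_smul (MvPolynomial σ k) (x.1 : SemigroupRing k a)
  map_comp f g := by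
    ext x
    change MvPolynomial.monomial (ActCat.expo g + ActCat.expo f) (1 : k) • x.1 =
      MvPolynomial.monomial (ActCat.expo g) (1 : k) •
        MvPolynomial.monomial (ActCat.expo f) (1 : k) • x.1
    rw [smul_smul, MvPolynomial.monomial_mul, one_mul]

variable [DecidableEq Γ]

/-- The map `⨁_γ k[Q]_γ → k[Q]` that is the inclusion on each component. -/
noncomputable def assembleLinear (k : Type u) [CommRing k] (deg : Q →+ Γ) (a : σ → Q) :
    TotalSum (toFunctor k deg a) →ₗ[k] SemigroupRing k a :=
  TotalSum.desc (toFunctor k deg a) fun γ => (piece k deg a γ).subtype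

theorem assembleLinear_incl (k : Type u) [CommRing k] (deg : Q →+ Γ) (a : σ → Q) (γ : Γ)
    (x : piece k deg a γ) :
    assembleLinear k deg a (TotalSum.incl (toFunctor k deg a) γ x) = x.1 :=
  TotalSum.desc_incl ..

theorem assembleLinear_monomialAct (k : Type u) [CommRing k] (deg : Q →+ Γ) (a : σ → Q)
    (m : σ →₀ ℕ) (x : TotalSum (toFunctor k deg a)) :
    assembleLinear k deg a (TotalSum.monomialAct _ m x) =
      MvPolynomial.monomial m (1 : k) • assembleLinear k deg a x := by
  let L : SemigroupRing k a →ₗ[k] SemigroupRing k a :=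
    LinearMap.mulLeft k (ofPolynomial k a (MvPolynomial.monomial m 1))
  refine LinearMap.congr_fun (f := assembleLinear k deg a ∘ₗ TotalSum.monomialAct _ m)
    (g := L ∘ₗ assembleLinear k deg a) ?_ x
  refine TotalSum.hom_ext _ fun γ y => ?_
  let g : ActCat.of (fun i => deg (a i)) γ ⟶
    ActCat.of (fun i => deg (a i)) (Finsupp.weight (fun i => deg (a i)) m + γ) :=
    ActCat.homMk m rfl
  rw [LinearMap.comp_apply, LinearMap.comp_apply, TotalSum.monomialAct_incl _ m g rfl]
  exact (assembleLinear_incl k deg a _ _).trans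
    (congrArg L (assembleLinear_incl k deg a γ y).symm)

/-- The canonical map `⨁_γ k[Q]_γ → k[Q]` as a homomorphism of modules over the polynomial ring. -/
noncomputable def assemble (k : Type u) [CommRing k] (deg : Q →+ Γ) (a : σ → Q) :
    (totalFunctor k (fun i => deg (a i))).obj (toFunctor k deg a) ⟶
      ModuleCat.of (MvPolynomial σ k) (SemigroupRing k a) :=
  ModuleCat.ofHom
    { toFun := assembleLinear k deg a
      map_add' := map_add _
      map_smul' := TotalSum.map_smul_of_monomial (assembleLinear k deg a)
        (assembleLinear_monomialAct k deg a) }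

end SemigroupRing
end SemigroupRing

section Graded
variable {σ Γ : Type} [AddCommGroup Γ] [DecidableEq Γ] {k : Type u} [CommRing k]

/-- `N` is the direct sum of the pieces, compatibly with the grading of the polynomial ring in which
`xᵢ` has degree `w i`. -/
structure IsGradedModule (w : σ → Γ) (N : ModuleCat.{u} (MvPolynomial σ k))
    (piece : Γ → AddSubgroup N) : Prop where
  isInternal : DirectSum.IsInternal piece
  smul_mem : ∀ ⦃γ δ : Γ⦄ ⦃p : MvPolynomial σ k⦄ ⦃x : N⦄,
    p ∈ MvPolynomial.weightedHomogeneousSubmodule k w γ → x ∈ piece δ → p • x ∈ piece (γ + δ)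

/-- A graded resolution of finite length by graded modules that are free with a finite basis of
homogeneous elements, with differentials and augmentation that preserve degrees. -/
structure IsFiniteFreeGradedResolution (w : σ → Γ)
    (F : ChainComplex (ModuleCat.{u} (MvPolynomial σ k)) ℕ) (pieceF : ∀ m, Γ → AddSubgroup (F.X m))
    {N : ModuleCat.{u} (MvPolynomial σ k)} (pieceN : Γ → AddSubgroup N) (ε : F.X 0 ⟶ N) :
    Prop where
  graded : ∀ m, IsGradedModule w (F.X m) (pieceF m)
  graded_target : IsGradedModule w N pieceN
  map_d : ∀ i j γ x, x ∈ pieceF i γ → (F.d i j).hom x ∈ pieceF j γ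
  map_aug : ∀ γ x, x ∈ pieceF 0 γ → ε.hom x ∈ pieceN γ
  finite_free : ∀ m, ∃ (s : ℕ) (b : Module.Basis (Fin s) (MvPolynomial σ k) (F.X m)),
    ∀ i, ∃ γ, b i ∈ pieceF m γ
  finite_length : ∃ l : ℕ, ∀ m, l < m → Subsingleton (F.X m)
  surjective : Function.Surjective ε.hom
  exact_zero : Function.Exact (F.d 1 0).hom ε.hom
  exact_succ : ∀ m, Function.Exact (F.d (m + 2) (m + 1)).hom (F.d (m + 1) m).hom

end Graded

section Main

/-- The family `a` generates `Q`, and no member lies in the submonoid generated by the others. -/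
structure IsMinimalGenerators {Q : Type*} [AddCommMonoid Q] {ι : Type*} (a : ι → Q) : Prop where
  closure_eq_top : AddSubmonoid.closure (Set.range a) = ⊤
  minimal : ∀ i, a i ∉ AddSubmonoid.closure (a '' {j | j ≠ i})

/-- The embedding of `Q ⊆ ℕ^r` into `ℤ^r`. -/
def latticeDegree {r : ℕ} (Q : AddSubmonoid (Fin r → ℕ)) : Q →+ (Fin r → ℤ) where
  toFun q j := (q.1 j : ℤ)
  map_zero' := by ext; simp
  map_add' p q := by ext; simp

/-- The constant module `k` over `C`. -/
noncomputable def constModule (k : Type u) [CommRing k] (C : Type) [SmallCategory C] :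
    C ⥤ ModuleCat.{u} k :=
  (Functor.const C).obj (ModuleCat.of k k)

variable {σ Γ : Type} [AddCommGroup Γ] [DecidableEq Γ] {k : Type u} [CommRing k] 

/-- The complex of modules over the polynomial ring obtained by taking total modules. -/
noncomputable def totalComplex (w : σ → Γ) (P : ChainComplex (ActCat w ⥤ ModuleCat.{u} k) ℕ) :
    ChainComplex (ModuleCat.{u} (MvPolynomial σ k)) ℕ :=
  ((totalFunctor k w).mapHomologicalComplex _).obj P

end Main
end Toric

open Toric

namespace Toric

/-! ### Free modules over a category, described by generators -/

section FreeBasis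
universe v
variable {k : Type u} [CommRing k] {C : Type} [SmallCategory C]

/-! Write T for `k[Q]` as a module over the action category and ρ for the inclusion of its Betti
category. The proof compares the bar resolution with a minimal free resolution P of T. Such a P
exists by a graded Nakayama argument: the coordinate sum is strictly increased by every non-identity
morphism, and T vanishes where it is negative (`minimalResolution_isMinimal`). The generators of P
live, by definition, at Betti objects (`bettiObjects_of_splIndex`). Since ρ is fully faithful, the
restriction of each term of P along ρ is again free, and the term is recovered from its restriction
by induction (`FreeBasis.restrict`, `FreeBasis.isIso_counit`).

Restriction is exact, so the restriction of P is a projective resolution of the restriction of T.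
That restriction is the constant module, because Betti objects lie in Q, where T is one-dimensional
with monomials going to monomials (`exists_constModule_iso`). The normalized bar resolution is
another projective resolution of the constant module: it is free on nondegenerate simplices
(`normalizedFreeBasis`) and exact by the homotopy that appends a final vertex
(`normalizedBar_isResolution`). The two are therefore homotopy equivalent. Induction need not be
exact, but as an additive functor it preserves homotopy equivalences, so the induced bar complex is
homotopy equivalent to P and hence resolves T (`inducedComplex_isResolution`).

Finiteness needs finitely many Betti objects. The splitting functor on P is the homology of P modulo
all variables, and the variables can be killed one at a time as a regular sequence. If some x_i acts
bijectively on T in all the degrees that occur, the homology vanishes. This happens when i is a cone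
point of the complex of those τ for which γ minus the sum of the generators in τ lies in Q
(`bettiObjects_le`). By Dickson's lemma and the pigeonhole principle, all but finitely many γ in Q
have a cone point (`finite_setOf_not_isConeVertex`). Nondegenerate simplices of the Betti category
have strictly increasing coordinate sum, so their dimension is bounded; as the morphism sets are
finite, there are finitely many of them. Generators over the action category become a homogeneous
basis over the polynomial ring (`FreeBasis.totalBasis`). -/

theorem map_id_hom_apply (F : C ⥤ ModuleCat.{u} k) {c : C} (x : F.obj c) :
    (F.map (𝟙 c)).hom x = x := by
  rw [F.map_id]; rfl

theorem map_comp_hom_apply (F : C ⥤ ModuleCat.{u} k) {c d e : C} (f : c ⟶ d) (g : d ⟶ e)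
    (x : F.obj c) : (F.map (f ≫ g)).hom x = (F.map g).hom ((F.map f).hom x) := by
  rw [F.map_comp]; rfl

theorem naturality_hom_apply {F G : C ⥤ ModuleCat.{u} k} (φ : F ⟶ G) {c d : C} (f : c ⟶ d)
    (x : F.obj c) :
    (φ.app d).hom ((F.map f).hom x) = (G.map f).hom ((φ.app c).hom x) :=
  congrArg (fun g => g.hom x) (φ.naturality f)

theorem congr_hom_apply {F G : C ⥤ ModuleCat.{u} k} {φ ψ : F ⟶ G} (h : φ = ψ) {c : C}
    (x : F.obj c) : (φ.app c).hom x = (ψ.app c).hom x := by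
  rw [h]

/-- A family of generators of a module `F` over a category, indexed by `ι`, such that the
translates of the generators along all morphisms form bases of the values of `F`. -/
structure FreeBasis (ι : Type v) (F : C ⥤ ModuleCat.{u} k) where
  /-- The object at which a generator lives. -/
  obj : ι → C
  /-- The basis of translates of the generators. -/
  basis : ∀ c, Module.Basis (Σ i, obj i ⟶ c) k (F.obj c)
  map_basis : ∀ {c d : C} (f : c ⟶ d) (i : ι) (v : obj i ⟶ c),
    (F.map f).hom (basis c ⟨i, v⟩) = basis d ⟨i, v ≫ f⟩

namespace FreeBasis
variable {ι : Type v} {F : C ⥤ ModuleCat.{u} k} (β : FreeBasis ι F)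

/-- The generator with index `i`. -/
noncomputable def gen (i : ι) : F.obj (β.obj i) := β.basis _ ⟨i, 𝟙 _⟩

theorem map_gen {c : C} (i : ι) (v : β.obj i ⟶ c) :
    (F.map v).hom (β.gen i) = β.basis c ⟨i, v⟩ := by
  rw [gen, map_basis, Category.id_comp]

/-- The homomorphism with prescribed values on the generators. -/
noncomputable def desc {G : C ⥤ ModuleCat.{u} k} (y : ∀ i, G.obj (β.obj i)) : F ⟶ G where
  app c := ModuleCat.ofHom ((β.basis c).constr k fun p => (G.map p.2).hom (y p.1))
  naturality c d f := by
    ext : 1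
    refine (β.basis c).ext fun ⟨i, v⟩ => ?_
    simp only [ModuleCat.hom_comp, ModuleCat.hom_ofHom, LinearMap.comp_apply, β.map_basis,
      Module.Basis.constr_basis]
    exact map_comp_hom_apply G v f (y i)

theorem desc_basis {G : C ⥤ ModuleCat.{u} k} (y : ∀ i, G.obj (β.obj i)) {c : C} (i : ι)
    (v : β.obj i ⟶ c) : ((β.desc y).app c).hom (β.basis c ⟨i, v⟩) = (G.map v).hom (y i) :=
  (β.basis c).constr_basis k _ _

theorem desc_gen {G : C ⥤ ModuleCat.{u} k} (y : ∀ i, G.obj (β.obj i)) (i : ι) :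
    ((β.desc y).app _).hom (β.gen i) = y i := by
  rw [gen, desc_basis, map_id_hom_apply]

include β in
theorem hom_ext {G : C ⥤ ModuleCat.{u} k} {f g : F ⟶ G}
    (h : ∀ i, (f.app _).hom (β.gen i) = (g.app _).hom (β.gen i)) : f = g := by
  ext c : 3
  refine (β.basis c).ext fun ⟨i, v⟩ => ?_
  rw [← β.map_gen]
  exact (naturality_hom_apply f v _).trans
    ((congrArg (G.map v).hom (h i)).trans (naturality_hom_apply g v _).symm)

theorem surjective_of_epi {F G : C ⥤ ModuleCat.{u} k} (f : F ⟶ G) [Epi f] (c : C) :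
    Function.Surjective (f.app c).hom :=
  (ModuleCat.epi_iff_surjective _).1 inferInstance

theorem epi_of_surjective {F G : C ⥤ ModuleCat.{u} k} (f : F ⟶ G)
    (h : ∀ c, Function.Surjective (f.app c).hom) : Epi f := by
  rw [NatTrans.epi_iff_epi_app]
  exact fun c => (ModuleCat.epi_iff_surjective _).2 (h c)

include β in
-- Preimages of the images of the generators can be chosen objectwise, since epimorphisms of
-- functors are objectwise surjective; freeness extends the choice to a lift.
theorem projective : Projective F where
  factors {X Y} f e he := by
    choose y hy using fun i => surjective_of_epi e (β.obj i) ((f.app _).hom (β.gen i))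
    refine ⟨β.desc y, β.hom_ext fun i => ?_⟩
    exact (congrArg (e.app _).hom (β.desc_gen y i)).trans (hy i)

/-- The canonical basis of the value of a free module at an object. -/
noncomputable def freeModuleBasis (B : C → Type u) (d : C) :
    Module.Basis (Σ p : Σ c, B c, p.1 ⟶ d) k ((Σ c : C, B c × (c ⟶ d)) →₀ k) :=
  (Finsupp.basisSingleOne (R := k) (ι := Σ c : C, B c × (c ⟶ d))).reindex
    { toFun := fun p => ⟨⟨p.1, p.2.1⟩, p.2.2⟩
      invFun := fun p => ⟨p.1.1, p.1.2, p.2⟩ }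

theorem freeModuleBasis_apply (B : C → Type u) (d : C) (p : Σ c, B c) (v : p.1 ⟶ d) :
    freeModuleBasis (k := k) B d ⟨p, v⟩ = Finsupp.single ⟨p.1, p.2, v⟩ 1 := by
  rw [freeModuleBasis, Module.Basis.reindex_apply, Finsupp.coe_basisSingleOne]
  rfl

/-- The canonical generators of a free module. -/
noncomputable def ofFreeModule (B : C → Type u) : FreeBasis (Σ c, B c) (freeModule k B) where
  obj p := p.1
  basis d := freeModuleBasis B d
  map_basis {c d} f i v := by
    exact (congrArg ((freeModule k B).map f).hom (freeModuleBasis_apply B _ i v)).trans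
      (Finsupp.mapDomain_single.trans (freeModuleBasis_apply B _ i (v ≫ f)).symm)

/-- Transport of generators along an isomorphism. -/
noncomputable def ofIso {G : C ⥤ ModuleCat.{u} k} (e : F ≅ G) : FreeBasis ι G where
  obj := β.obj
  basis c := (β.basis c).map (e.app c).toLinearEquiv
  map_basis f i v :=
    (naturality_hom_apply e.hom f _).symm.trans (congrArg (e.hom.app _).hom (β.map_basis f i v))

/-- Modules with generators living at the same objects are isomorphic. -/
noncomputable def isoOfEquiv {κ : Type*} {G : C ⥤ ModuleCat.{u} k} (γ : FreeBasis κ G) (e : ι ≃ κ)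
    (h : ∀ i, γ.obj (e i) = β.obj i) : F ≅ G where
  hom := β.desc fun i => (G.map (eqToHom (h i))).hom (γ.gen (e i))
  inv := γ.desc fun j => (F.map (eqToHom ((h (e.symm j)).symm.trans (by simp)))).hom
    (β.gen (e.symm j))
  hom_inv_id := β.hom_ext fun i => by
    rw [NatTrans.comp_app, ModuleCat.hom_comp, LinearMap.comp_apply, desc_gen,
      naturality_hom_apply, desc_gen, ← map_comp_hom_apply, eqToHom_trans]
    have : ∀ j (hj : j = i) (q : β.obj j = β.obj i),
        (F.map (eqToHom q)).hom (β.gen j) = β.gen i := by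
      rintro j rfl q
      exact map_id_hom_apply _ _
    exact this _ (by simp) _
  inv_hom_id := γ.hom_ext fun j => by
    rw [NatTrans.comp_app, ModuleCat.hom_comp, LinearMap.comp_apply, desc_gen,
      naturality_hom_apply, desc_gen, ← map_comp_hom_apply, eqToHom_trans]
    have : ∀ i (hi : i = j) (q : γ.obj i = γ.obj j),
        (G.map (eqToHom q)).hom (γ.gen i) = γ.gen j := by
      rintro i rfl q
      exact map_id_hom_apply _ _
    exact this _ (by simp) _

/-- The generators are sorted by the object at which they live; the fibres are lifted to the
universe of `k` because `freeModule` is indexed by families there. -/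
theorem isFreeModule {ι : Type} (β : FreeBasis ι F) : IsFreeModule F := by
  let B : C → Type u := fun c => ULift.{u} {i : ι // β.obj i = c}
  refine ⟨B, ⟨β.isoOfEquiv (ofFreeModule B)
    { toFun := fun i => ⟨β.obj i, ⟨i, rfl⟩⟩
      invFun := fun p => p.2.down.1
      right_inv := ?_ } fun i => rfl⟩⟩
  rintro ⟨c, ⟨i, rfl⟩⟩
  rfl

/-! ### Induction and restriction of free modules -/

section Induction
variable {D : Type} [SmallCategory D] (α : C ⥤ D)

/-- The unit `F ⟶ res (ind F)` of induction. -/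
noncomputable abbrev indUnit (F : C ⥤ ModuleCat.{u} k) : F ⟶ α ⋙ α.lan.obj F := α.lanUnit.app F

theorem lan_hom_ext {F : C ⥤ ModuleCat.{u} k} {G : D ⥤ ModuleCat.{u} k} {f g : α.lan.obj F ⟶ G}
    (h : indUnit α F ≫ Functor.whiskerLeft α f = indUnit α F ≫ Functor.whiskerLeft α g) : f = g :=
  Functor.hom_ext_of_isLeftKanExtension _ (α.lanUnit.app F) _ _ h

/-- The module freely generated by generators at the objects `obj i`. -/
noncomputable abbrev freeOn {ι : Type} (k : Type u) [CommRing k] (obj : ι → C) :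
    C ⥤ ModuleCat.{u} k where
  obj d := ModuleCat.of k ((Σ i, obj i ⟶ d) →₀ k)
  map f := ModuleCat.ofHom (Finsupp.lmapDomain k k fun p => ⟨p.1, p.2 ≫ f⟩)
  map_id d := by
    ext : 1
    refine Finsupp.lhom_ext fun p x => ?_
    simp
  map_comp f g := by
    ext : 1
    refine Finsupp.lhom_ext fun p x => ?_
    simp

noncomputable def ofFreeOn {ι : Type} (obj : ι → C) : FreeBasis ι (freeOn k obj) where
  obj := obj
  basis _ := Finsupp.basisSingleOne
  map_basis {c d} f i v := by
    refine (congrArg ((freeOn k obj).map f).hom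
      (congrFun (Finsupp.coe_basisSingleOne (R := k)) _)).trans
      (Eq.trans ?_ (congrFun (Finsupp.coe_basisSingleOne (R := k)) _).symm)
    exact Finsupp.mapDomain_single

/-- Induction sends free modules to free modules. -/
noncomputable def lanIso {ι : Type} (β : FreeBasis ι F) :
    freeOn k (fun i => α.obj (β.obj i)) ≅ α.lan.obj F :=
  let γ := ofFreeOn (k := k) fun i => α.obj (β.obj i)
  let η : F ⟶ α ⋙ α.lan.obj F := indUnit α F
  -- The universal property of the Kan extension turns the map sending each generator to the
  -- corresponding generator of the restricted free module into a map out of the induced module.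
  let ψ : α.lan.obj F ⟶ freeOn k (fun i => α.obj (β.obj i)) :=
    (α.lan.obj F).descOfIsLeftKanExtension (α.lanUnit.app F) _
      (β.desc (G := α ⋙ freeOn k (fun i => α.obj (β.obj i))) fun i => γ.gen i)
  have hψ : η ≫ Functor.whiskerLeft α ψ = β.desc (G := α ⋙ freeOn k _) fun i => γ.gen i :=
    (α.lan.obj F).descOfIsLeftKanExtension_fac _ _ _
  { hom := γ.desc fun i => (η.app _).hom (β.gen i)
    inv := ψ
    hom_inv_id := γ.hom_ext fun i => by
      have h1 := (congr_hom_apply hψ (β.gen i)).trans (β.desc_gen _ i)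
      exact (congrArg (ψ.app _).hom (γ.desc_gen _ i)).trans h1
    inv_hom_id := lan_hom_ext α <| β.hom_ext fun i => by
      have h1 := (congr_hom_apply hψ (β.gen i)).trans (β.desc_gen _ i)
      have h2 := congrArg ((γ.desc (G := α.lan.obj F) fun i => (η.app _).hom (β.gen i)).app _).hom h1
      exact h2.trans (γ.desc_gen _ i) }

noncomputable def lan {ι : Type} (β : FreeBasis ι F) : FreeBasis ι (α.lan.obj F) :=
  (ofFreeOn fun i => α.obj (β.obj i)).ofIso (β.lanIso α)

variable (ρ : C ⥤ D) {G : D ⥤ ModuleCat.{u} k}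

/-- Restriction of a free module along a full and faithful functor whose image contains the objects
of all generators. -/
noncomputable def restrict (γ : FreeBasis ι G) (hρ : ρ.FullyFaithful) (obj : ι → C)
    (h : ∀ i, ρ.obj (obj i) = γ.obj i) : FreeBasis ι (ρ ⋙ G) where
  obj := obj
  basis c := (γ.basis (ρ.obj c)).reindex (Equiv.sigmaCongrRight fun i =>
    { toFun := fun v => hρ.preimage (eqToHom (h i) ≫ v)
      invFun := fun v => eqToHom (h i).symm ≫ ρ.map v
      left_inv := fun v => by simp
      right_inv := fun v => hρ.map_injective (by simp) })
  map_basis f i v := by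
    refine (congrArg ((ρ ⋙ G).map f).hom (Module.Basis.reindex_apply _ _ _)).trans
      (Eq.trans ?_ (Module.Basis.reindex_apply _ _ _).symm)
    refine (γ.map_basis (ρ.map f) _ _).trans ?_
    simp [Equiv.sigmaCongrRight]

theorem restrict_gen (γ : FreeBasis ι G) (hρ : ρ.FullyFaithful) (obj : ι → C)
    (h : ∀ i, ρ.obj (obj i) = γ.obj i) (i : ι) :
    (γ.restrict ρ hρ obj h).gen i = (G.map (eqToHom (h i).symm)).hom (γ.gen i) := by
  rw [map_gen]
  refine (Module.Basis.reindex_apply _ _ _).trans ?_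
  refine congrArg (γ.basis _) (Sigma.ext rfl (heq_of_eq ?_))
  exact (congrArg (eqToHom (h i).symm ≫ ·) (ρ.map_id _)).trans (Category.comp_id _)

/-- A free module with generators at objects in the image of `ρ` is induced from its
restriction. -/
theorem isIso_counit (γ : FreeBasis ι G) (hρ : ρ.FullyFaithful) (obj : ι → C)
    (h : ∀ i, ρ.obj (obj i) = γ.obj i) :
    IsIso ((ρ.lanAdjunction (ModuleCat.{u} k)).counit.app G) := by
  let η : ρ ⋙ G ⟶ ρ ⋙ ρ.lan.obj (ρ ⋙ G) := indUnit ρ (ρ ⋙ G)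
  let ε : ρ.lan.obj (ρ ⋙ G) ⟶ G := (ρ.lanAdjunction (ModuleCat.{u} k)).counit.app G
  have hηε : η ≫ Functor.whiskerLeft ρ ε = 𝟙 _ :=
    ρ.lanUnit_app_whiskerLeft_lanAdjunction_counit_app G
  -- Candidate inverse of the counit: each generator of `G` is moved into the image of `ρ`, sent
  -- through the unit, and moved back.
  let ψ : G ⟶ ρ.lan.obj (ρ ⋙ G) := γ.desc fun i =>
    ((ρ.lan.obj (ρ ⋙ G)).map (eqToHom (h i))).hom
      ((η.app (obj i)).hom ((G.map (eqToHom (h i).symm)).hom (γ.gen i)))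
  -- Full faithfulness enters here: the restriction of `G` is free on the same generators, so it
  -- suffices to compare the two maps on them.
  have hψ : Functor.whiskerLeft ρ ψ = η := by
    refine (γ.restrict ρ hρ obj h).hom_ext fun i => ?_
    rw [restrict_gen]
    refine (naturality_hom_apply ψ _ _).trans ?_
    rw [desc_gen]
    refine (map_comp_hom_apply (ρ.lan.obj (ρ ⋙ G)) (eqToHom (h i)) (eqToHom (h i).symm) _).symm.trans ?_
    rw [eqToHom_trans, eqToHom_refl, map_id_hom_apply]
    rfl
  refine ⟨ψ, ?_, ?_⟩
  -- One composite is the identity by the universal property of induction, the other by the triangle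
  -- identity on generators.
  · refine lan_hom_ext ρ ?_
    have h1 : η ≫ Functor.whiskerLeft ρ (ε ≫ ψ) =
      (η ≫ Functor.whiskerLeft ρ ε) ≫ Functor.whiskerLeft ρ ψ := by
      rw [Functor.whiskerLeft_comp, Category.assoc]
    refine h1.trans ?_
    rw [hηε, hψ, Category.id_comp]
    exact (Category.comp_id η).symm
  · refine γ.hom_ext fun i => ?_
    rw [NatTrans.comp_app, ModuleCat.hom_comp, LinearMap.comp_apply, desc_gen]
    refine (naturality_hom_apply ε _ _).trans ?_
    refine (congrArg (G.map _).hom (congr_hom_apply hηε _)).trans ?_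
    refine (map_comp_hom_apply G _ _ _).symm.trans ?_
    rw [eqToHom_trans, eqToHom_refl, map_id_hom_apply]
    rfl

end Induction

end FreeBasis
end FreeBasis

/-! ### The normalized bar resolution is free on nondegenerate simplices -/

section NormalizedFree
open scoped Simplicial
variable {k : Type u} [CommRing k] {C : Type} [SmallCategory C]

/-- The `i`-th degeneracy of a simplex of the nerve. -/
abbrev degenSimplex {n : ℕ} (i : Fin (n + 1)) (s : ComposableArrows C n) :
    ComposableArrows C (n + 1) :=
  pullSimplex (SimplexCategory.σ i) s

/-- The `i`-th degeneracy map of the bar resolution. -/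
noncomputable def barDegen (M : C ⥤ ModuleCat.{u} k) {n : ℕ} (i : Fin (n + 1)) (c : C) :
    BarSum M n c →ₗ[k] BarSum M (n + 1) c :=
  barPull M (SimplexCategory.σ i) c

/-- The submodule generated by the degenerate chains. -/
noncomputable def degenerateChains (M : C ⥤ ModuleCat.{u} k) (n : ℕ) (c : C) :
    Submodule k (BarSum M n c) :=
  degenerate (simplicialBar M) n c

theorem degenerateChains_succ (M : C ⥤ ModuleCat.{u} k) (n : ℕ) (c : C) :
    degenerateChains M (n + 1) c = ⨆ i : Fin (n + 1), LinearMap.range (barDegen M i c) := rfl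

/-- A simplex of the nerve is degenerate if it is in the image of a degeneracy map. -/
def IsDegenerate {n : ℕ} (s : ComposableArrows C n) : Prop :=
  match n, s with
  | 0, _ => False
  | n + 1, s => ∃ (i : Fin (n + 1)) (t : ComposableArrows C n), s = degenSimplex i t

/-- A degeneracy fixes the first and last vertices, but only up to a proved equality of indices. The
preimage is therefore obtained by moving the morphism and the coefficient along the comparison maps
inverse to `pullRight` and `pullLeft`; the composites are identities. -/
theorem barGen_mem_degenerateChains (M : C ⥤ ModuleCat.{u} k) {n : ℕ} {c : C}
    {s : ComposableArrows C n} (hs : IsDegenerate s) (v : s.right ⟶ c) (x : M.obj s.left) :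
    barGen M s v x ∈ degenerateChains M n c := by
  cases n with
  | zero => exact hs.elim
  | succ n =>
    obtain ⟨i, t, rfl⟩ := hs
    rw [degenerateChains_succ]
    have hl : Fin.last n ≤ (SimplexCategory.σ i).toOrderHom (Fin.last (n + 1)) := by
      simp [SimplexCategory.σ, SimplexCategory.mkHom]
    have h0 : (SimplexCategory.σ i).toOrderHom (0 : Fin (n + 2)) ≤ (0 : Fin (n + 1)) := by
      simp [SimplexCategory.σ, SimplexCategory.mkHom]
    refine Submodule.mem_iSup_of_mem i ⟨barGen M t (t.map (homOfLE hl) ≫ v)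
      ((M.map (t.map (homOfLE h0))).hom x), ?_⟩
    refine (barPull_gen M (SimplexCategory.σ i) t _ _).trans
      (barGen_congr M rfl (heq_of_eq ?_) (heq_of_eq ?_))
    · refine (Category.assoc _ _ _).symm.trans ?_
      refine (congrArg (· ≫ v) ?_).trans (Category.id_comp v)
      exact (t.map_comp _ _).symm.trans (t.map_id _)
    · refine (map_comp_hom_apply M _ _ x).symm.trans ?_
      refine (congrArg (fun g => (M.map g).hom x) ?_).trans (map_id_hom_apply M x)
      exact (t.map_comp _ _).symm.trans (t.map_id _)

/-- The nondegenerate simplices of dimension `n`. -/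
abbrev NondegenerateSimplex (C : Type) [SmallCategory C] (n : ℕ) : Type :=
  {s : ComposableArrows C n // ¬ IsDegenerate s}

variable (k) in
/-- The unit of `k`, as a coefficient of the constant module. -/
def constOne (c : C) : (constModule k C).obj c := (1 : k)

theorem smul_constOne (c : C) (x : (constModule k C).obj c) :
    ∃ a : k, x = a • constOne k c :=
  ⟨(show k from x), (mul_one (show k from x)).symm⟩

variable (k) in
open Classical in
/-- The coefficients of a chain at the nondegenerate simplices. -/
noncomputable def nondegenerateCoeff (n : ℕ) (c : C) :
    BarSum (constModule k C) n c →ₗ[k] ((Σ s : NondegenerateSimplex C n, s.1.right ⟶ c) →₀ k) :=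
  barDesc (constModule k C) fun s v =>
    (if h : IsDegenerate s then 0
    else Finsupp.lsingle (⟨⟨s, h⟩, v⟩ : Σ s : NondegenerateSimplex C n, s.1.right ⟶ c) :
      k →ₗ[k] _)

theorem nondegenerateCoeff_gen {n : ℕ} {c : C} (s : NondegenerateSimplex C n) (v : s.1.right ⟶ c) :
    nondegenerateCoeff k n c (barGen (constModule k C) s.1 v (constOne k _)) =
      Finsupp.single ⟨s, v⟩ 1 := by
  refine (barDesc_gen _ _ _ _ _).trans ?_
  rw [dif_neg s.2]
  rfl

theorem nondegenerateCoeff_gen_of_isDegenerate {n : ℕ} {c : C} {s : ComposableArrows C n}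
    (hs : IsDegenerate s) (v : s.right ⟶ c) (x : (constModule k C).obj s.left) :
    nondegenerateCoeff k n c (barGen (constModule k C) s v x) = 0 := by
  refine (barDesc_gen _ _ _ _ _).trans ?_
  rw [dif_pos hs]
  rfl

/-- A degeneracy operator sends a generator to a generator on a degenerate simplex, where the
coefficient map is zero. Hence discarding degenerate simplices is well defined on the quotient. -/
theorem degenerateChains_le_ker (n : ℕ) (c : C) :
    degenerateChains (constModule k C) n c ≤ LinearMap.ker (nondegenerateCoeff k n c) := by
  cases n with
  | zero => exact bot_le
  | succ n =>
    rw [degenerateChains_succ]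
    refine iSup_le fun i => ?_
    rw [LinearMap.range_le_ker_iff]
    refine barSum_ext (n := n) (constModule k C) fun s v x => ?_
    refine (congrArg (nondegenerateCoeff k (n + 1) c)
      (barPull_gen (constModule k C) (SimplexCategory.σ i) s v x)).trans ?_
    exact nondegenerateCoeff_gen_of_isDegenerate (s := degenSimplex i s) ⟨i, s, rfl⟩ _ _

variable (k) in
/-- The class of a nondegenerate simplex in the normalized bar resolution. -/
noncomputable def simplexClass {n : ℕ} {c : C}
    (p : Σ s : NondegenerateSimplex C n, s.1.right ⟶ c) :
    BarSum (constModule k C) n c ⧸ degenerateChains (constModule k C) n c :=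
  Submodule.Quotient.mk (barGen (constModule k C) p.1.1 p.2 (constOne k _))

variable (k) in
/-- The normalized chains are free on the nondegenerate simplices. -/
noncomputable def normalizedEquiv (n : ℕ) (c : C) :
    (BarSum (constModule k C) n c ⧸ degenerateChains (constModule k C) n c) ≃ₗ[k]
      ((Σ s : NondegenerateSimplex C n, s.1.right ⟶ c) →₀ k) :=
  LinearEquiv.ofLinearMap
    (Submodule.liftQ _ (nondegenerateCoeff k n c) (degenerateChains_le_ker n c))
    (Finsupp.linearCombination k (simplexClass k))
    (by
      refine Finsupp.lhom_ext' fun p => LinearMap.ext_ring ?_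
      refine (congrArg _ ((Finsupp.linearCombination_single k 1 p).trans (one_smul k _))).trans ?_
      exact nondegenerateCoeff_gen p.1 p.2)
    (by
      refine Submodule.linearMap_qext _ (barSum_ext _ fun s v x => ?_)
      obtain ⟨a, rfl⟩ := smul_constOne _ x
      simp only [map_smul]
      congr 1
      by_cases hs : IsDegenerate s
      · refine (congrArg (Finsupp.linearCombination k (simplexClass k))
          (nondegenerateCoeff_gen_of_isDegenerate hs v (constOne k _))).trans ?_
        rw [map_zero]
        exact ((Submodule.Quotient.mk_eq_zero _).2
          (barGen_mem_degenerateChains _ hs v _)).symm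
      · refine (congrArg (Finsupp.linearCombination k (simplexClass k))
          (nondegenerateCoeff_gen ⟨s, hs⟩ v)).trans ?_
        exact (Finsupp.linearCombination_single k 1 _).trans (one_smul k _))

variable (k) in
/-- The basis of the normalized chains given by the nondegenerate simplices. -/
noncomputable def normalizedBasis (n : ℕ) (c : C) :
    Module.Basis (Σ s : NondegenerateSimplex C n, s.1.right ⟶ c) k
      (BarSum (constModule k C) n c ⧸ degenerateChains (constModule k C) n c) :=
  .ofRepr (normalizedEquiv k n c)

theorem normalizedBasis_apply {n : ℕ} {c : C}
    (p : Σ s : NondegenerateSimplex C n, s.1.right ⟶ c) :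
    normalizedBasis k n c p = simplexClass k p :=
  (Finsupp.linearCombination_single k 1 p).trans (one_smul k _)

variable (k C) in
/-- The terms of the normalized bar resolution of the constant module are free on the nondegenerate
simplices. -/
noncomputable def normalizedFreeBasis (n : ℕ) :
    FreeBasis (NondegenerateSimplex C n) (normalizedObj (simplicialBar (constModule k C)) n) where
  obj s := s.1.right
  basis c := normalizedBasis k n c
  map_basis {c d} f s v := by
    refine (congrArg ((normalizedObj (simplicialBar (constModule k C)) n).map f).hom
      (normalizedBasis_apply ⟨s, v⟩)).trans (Eq.trans ?_ (normalizedBasis_apply ⟨s, v ≫ f⟩).symm)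
    exact congrArg (Submodule.mkQ (degenerateChains (constModule k C) n d))
      (barPush_gen (constModule k C) n f s.1 v (constOne k _))

end NormalizedFree

/-! ### Exactness of the normalized bar resolution -/

section BarExact
open scoped Simplicial
variable {k : Type u} [CommRing k] {C : Type} [SmallCategory C]

/-- The generator of the bar resolution given by reindexing a diagram indexed by a preorder. -/
noncomputable def diagramGen (M : C ⥤ ModuleCat.{u} k) {J : Type} [Preorder J] (F : J ⥤ C) {m : ℕ}
    (θ : Fin (m + 1) →o J) {j₀ j₁ : J} (h₀ : j₀ ≤ θ 0) (h₁ : θ (Fin.last m) ≤ j₁)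
    (x : M.obj (F.obj j₀)) : BarSum M m (F.obj j₁) :=
  barGen M (n := m) (θ.monotone.functor ⋙ F) (F.map (homOfLE h₁)) ((M.map (F.map (homOfLE h₀))).hom x)

theorem diagramGen_congr (M : C ⥤ ModuleCat.{u} k) {J : Type} [Preorder J] (F : J ⥤ C) {m : ℕ}
    {θ θ' : Fin (m + 1) →o J} (h : θ = θ') {j₀ j₁ : J} (h₀ : j₀ ≤ θ 0)
    (h₁ : θ (Fin.last m) ≤ j₁) (x : M.obj (F.obj j₀)) :
    diagramGen M F θ h₀ h₁ x = diagramGen M F θ' (h ▸ h₀) (h ▸ h₁) x := by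
  subst h; rfl

theorem diagramGen_heq (M : C ⥤ ModuleCat.{u} k) {J : Type} [Preorder J] {F F' : J ⥤ C}
    (h : F = F') {m : ℕ} (θ : Fin (m + 1) →o J) {j₀ j₁ : J} (h₀ : j₀ ≤ θ 0)
    (h₁ : θ (Fin.last m) ≤ j₁) {x : M.obj (F.obj j₀)} {x' : M.obj (F'.obj j₀)} (hx : HEq x x') :
    HEq (diagramGen M F θ h₀ h₁ x) (diagramGen M F' θ h₀ h₁ x') := by
  subst h; rw [eq_of_heq hx]

theorem diagramGen_map (M : C ⥤ ModuleCat.{u} k) {J : Type} [Preorder J] (F : J ⥤ C) {m : ℕ}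
    (θ : Fin (m + 1) →o J) {j j₀ j₁ : J} (h : j ≤ j₀) (h₀ : j₀ ≤ θ 0)
    (h₁ : θ (Fin.last m) ≤ j₁) (x : M.obj (F.obj j)) :
    diagramGen M F θ h₀ h₁ ((M.map (F.map (homOfLE h))).hom x) =
      diagramGen M F θ (h.trans h₀) h₁ x := by
  refine congrArg (barGen M (n := m) (θ.monotone.functor ⋙ F) (F.map (homOfLE h₁))) ?_
  refine (map_comp_hom_apply M _ _ x).symm.trans ?_
  exact congrArg (fun g => (M.map g).hom x) (F.map_comp _ _).symm

theorem barPull_diagramGen (M : C ⥤ ModuleCat.{u} k) {J : Type} [Preorder J] (F : J ⥤ C)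
    {m l : SimplexCategory} (η : l ⟶ m) (θ : Fin (m.len + 1) →o J) {j₀ j₁ : J} (h₀ : j₀ ≤ θ 0)
    (h₁ : θ (Fin.last m.len) ≤ j₁) (x : M.obj (F.obj j₀)) :
    barPull M η _ (diagramGen M F θ h₀ h₁ x) =
      diagramGen M F (θ.comp η.toOrderHom) (h₀.trans (θ.monotone (Fin.zero_le _)))
        ((θ.monotone (Fin.le_last _)).trans h₁) x := by
  refine (barPull_gen M η _ _ _).trans (barGen_congr M rfl (heq_of_eq ?_) (heq_of_eq ?_))
  · exact (F.map_comp _ _).symm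
  · refine (map_comp_hom_apply M _ _ x).symm.trans ?_
    exact congrArg (fun g => (M.map g).hom x) (F.map_comp _ _).symm

/-- The extension of a simplex by a terminal object. -/
def coneExt {n : ℕ} {c : C} (s : ComposableArrows C n) (v : s.right ⟶ c) :
    WithTop (Fin (n + 1)) ⥤ C where
  obj
    | none => c
    | some i => s.obj i
  map {i j} f := match i, j, f with
    | some _, some _, f => s.map (homOfLE (WithTop.coe_le_coe.1 f.le))
    | some i, none, _ => s.map (homOfLE (Fin.le_last i)) ≫ v
    | none, none, _ => 𝟙 c
    | none, some _, f => absurd (top_le_iff.1 f.le) (WithTop.coe_ne_top)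
  map_id i := match i with
    | none => rfl
    | some i => s.map_id i
  map_comp {i j l} f g := match i, j, l, f, g with
    | some _, some _, some _, _, _ => s.map_comp _ _
    | some _, some _, none, f, _ =>
        (congrArg (· ≫ v) (s.map_comp (homOfLE (WithTop.coe_le_coe.1 f.le)) _)).trans
          (Category.assoc _ _ _)
    | some _, none, none, _, _ => (Category.comp_id _).symm
    | none, none, none, _, _ => (Category.comp_id _).symm
    | none, some _, _, f, _ => absurd (top_le_iff.1 f.le) (WithTop.coe_ne_top)
    | _, none, some _, _, g => absurd (top_le_iff.1 g.le) (WithTop.coe_ne_top)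

/-- The order isomorphism adding a top element. -/
def finToWithTop (n : ℕ) : Fin (n + 2) →o WithTop (Fin (n + 1)) where
  toFun i := if h : i.val < n + 1 then ((⟨i.val, h⟩ : Fin (n + 1)) : WithTop (Fin (n + 1))) else ⊤
  monotone' i j h := by
    have h' : i.val ≤ j.val := h
    dsimp only
    split_ifs with h1 h2 h2
    · exact WithTop.coe_le_coe.2 h
    · exact le_top
    · omega
    · exact le_rfl

theorem finToWithTop_castSucc {n : ℕ} (i : Fin (n + 1)) :
    finToWithTop n i.castSucc = (i : WithTop (Fin (n + 1))) := dif_pos i.isLt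

theorem finToWithTop_last (n : ℕ) : finToWithTop n (Fin.last (n + 1)) = ⊤ :=
  dif_neg (lt_irrefl _)

theorem zero_le_finToWithTop (n : ℕ) :
    ((0 : Fin (n + 1)) : WithTop (Fin (n + 1))) ≤ finToWithTop n 0 :=
  (finToWithTop_castSucc (0 : Fin (n + 1))).ge

/-- The contracting homotopy of the bar resolution, adding the object at which it is evaluated to a
simplex. -/
noncomputable def barAppend (M : C ⥤ ModuleCat.{u} k) (n : ℕ) (c : C) :
    BarSum M n c →ₗ[k] BarSum M (n + 1) c :=
  barDesc M fun s v =>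
    barGen M (n := n + 1) ((finToWithTop n).monotone.functor ⋙ coneExt s v)
      ((coneExt s v).map (homOfLE (le_top : finToWithTop n (Fin.last (n + 1)) ≤ ⊤))) ∘ₗ
      (M.map ((coneExt s v).map (homOfLE (zero_le_finToWithTop n)))).hom

theorem barAppend_gen (M : C ⥤ ModuleCat.{u} k) {n : ℕ} {c : C} (s : ComposableArrows C n)
    (v : s.right ⟶ c) (x : M.obj s.left) :
    barAppend M n c (barGen M s v x) =
      diagramGen M (coneExt s v) (finToWithTop n) (j₁ := ⊤) (zero_le_finToWithTop n) le_top x :=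
  barDesc_gen ..

/-- Indexing the cone by `WithTop` makes the extended simplicial operator simply the map that
preserves the top, so coning commutes with reindexing. -/
theorem coneExt_pullSimplex {m n : SimplexCategory} (θ : m ⟶ n) {c : C}
    (s : ComposableArrows C n.len) (v : s.right ⟶ c) :
    coneExt (pullSimplex θ s) (pullRight θ s ≫ v) =
      (θ.toOrderHom.monotone.withTop_map).functor ⋙ coneExt s v := by
  refine Functor.hext (fun i => ?_) fun i j f => ?_
  · cases i <;> rfl
  · cases i <;> cases j
    · rfl
    · exact absurd (top_le_iff.1 f.le) (WithTop.coe_ne_top)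
    · refine heq_of_eq ?_
      refine (Category.assoc _ _ _).symm.trans ?_
      exact congrArg (· ≫ v) (s.map_comp _ _).symm
    · rfl

/-- Both composites reindex the same cone diagram `coneExt s v`, along index maps that agree because
`θ'` is `θ` extended by the last vertex. One computation thus covers all faces except the one
deleting the new vertex, and all degeneracies needed for the quotient. -/
theorem barAppend_barPull (M : C ⥤ ModuleCat.{u} k) {m n : ℕ} (θ : ⦋m⦌ ⟶ ⦋n⦌)
    (θ' : ⦋m + 1⦌ ⟶ ⦋n + 1⦌) (h₁ : ∀ i : Fin (m + 1), θ'.toOrderHom i.castSucc =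
      (θ.toOrderHom i).castSucc) (h₂ : θ'.toOrderHom (Fin.last _) = Fin.last _) (c : C) :
    barAppend M m c ∘ₗ barPull M θ c = barPull M θ' c ∘ₗ barAppend M n c := by
  refine barSum_ext M fun s v x => ?_
  have hθ : (OrderHom.mk _ θ.toOrderHom.monotone.withTop_map).comp (finToWithTop m) =
      (finToWithTop n).comp θ'.toOrderHom := by
    ext1
    funext i
    refine Fin.lastCases ?_ (fun i => ?_) i
    · change WithTop.map θ.toOrderHom (finToWithTop m (Fin.last _)) =
        finToWithTop n (θ'.toOrderHom (Fin.last _))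
      rw [h₂, finToWithTop_last, finToWithTop_last]; rfl
    · change WithTop.map θ.toOrderHom (finToWithTop m i.castSucc) =
        finToWithTop n (θ'.toOrderHom i.castSucc)
      rw [h₁, finToWithTop_castSucc, finToWithTop_castSucc]; rfl
  have e1 := (congrArg (barAppend M m c) (barPull_gen M θ s v x)).trans
    (barAppend_gen M (pullSimplex θ s) (pullRight θ s ≫ v) _)
  have e2 := eq_of_heq (diagramGen_heq M (coneExt_pullSimplex θ s v) (finToWithTop m)
    (j₁ := ⊤) (zero_le_finToWithTop m) le_top
    (HEq.refl ((M.map (pullLeft θ s)).hom x)))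
  have e3 := diagramGen_map M (coneExt s v)
    ((OrderHom.mk _ θ.toOrderHom.monotone.withTop_map).comp (finToWithTop m)) (j₁ := ⊤)
    (WithTop.coe_le_coe.2 (Fin.zero_le (θ.toOrderHom 0)))
    (θ.toOrderHom.monotone.withTop_map (zero_le_finToWithTop m)) le_top x
  have e4 := diagramGen_congr M (coneExt s v) hθ (j₁ := ⊤)
    ((WithTop.coe_le_coe.2 (Fin.zero_le (θ.toOrderHom 0))).trans
    (θ.toOrderHom.monotone.withTop_map (zero_le_finToWithTop m))) le_top x
  have e5 := (congrArg (barPull M θ' c) (barAppend_gen M s v x)).trans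
    (barPull_diagramGen M (coneExt s v) θ' (finToWithTop n) (j₁ := ⊤)
      (zero_le_finToWithTop n) le_top x)
  exact e1.trans (e2.trans (e3.trans (e4.trans e5.symm)))

/-- The `i`-th face map of the bar resolution. -/
noncomputable def barFace (M : C ⥤ ModuleCat.{u} k) {n : ℕ} (i : Fin (n + 2)) (c : C) :
    BarSum M (n + 1) c →ₗ[k] BarSum M n c :=
  barPull M (SimplexCategory.δ i) c

theorem barFace_castSucc_barAppend (M : C ⥤ ModuleCat.{u} k) {n : ℕ} (i : Fin (n + 2)) (c : C) :
    barFace M i.castSucc c ∘ₗ barAppend M (n + 1) c = barAppend M n c ∘ₗ barFace M i c := by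
  refine (barAppend_barPull M (SimplexCategory.δ i) (SimplexCategory.δ i.castSucc) ?_ ?_ c).symm
  · exact fun j => Fin.castSucc_succAbove_castSucc
  · exact Fin.succAbove_of_le_castSucc _ _ (Fin.castSucc_le_castSucc_iff.2 (Fin.le_last i))

theorem barDegen_castSucc_barAppend (M : C ⥤ ModuleCat.{u} k) {n : ℕ} (i : Fin (n + 1)) (c : C) :
    barDegen M i.castSucc c ∘ₗ barAppend M n c = barAppend M (n + 1) c ∘ₗ barDegen M i c := by
  refine (barAppend_barPull M (SimplexCategory.σ i) (SimplexCategory.σ i.castSucc) ?_ ?_ c).symm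
  · intro j
    change i.castSucc.predAbove j.castSucc = (i.predAbove j).castSucc
    simp
  · change i.castSucc.predAbove (Fin.last _) = Fin.last _
    simp

/-- Deleting the appended vertex restores the simplex, and the edge into that vertex followed by its
identity gives back `v`. -/
theorem barFace_last_barAppend (M : C ⥤ ModuleCat.{u} k) {n : ℕ} (c : C) :
    barFace M (Fin.last (n + 1)) c ∘ₗ barAppend M n c = LinearMap.id := by
  refine barSum_ext M fun s v x => ?_
  let δ := SimplexCategory.δ (Fin.last (n + 1))
  let ι : Fin (n + 1) →o WithTop (Fin (n + 1)) := ⟨fun i => i, fun _ _ h => WithTop.coe_le_coe.2 h⟩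
  have hθ : (finToWithTop n).comp δ.toOrderHom = ι := by
    ext1
    funext i
    change finToWithTop n ((Fin.last (n + 1)).succAbove i) = i
    rw [Fin.succAbove_last, finToWithTop_castSucc]
  have e1 := (congrArg (barFace M (Fin.last (n + 1)) c) (barAppend_gen M s v x)).trans
    (barPull_diagramGen M (coneExt s v) δ (finToWithTop n) (j₁ := ⊤)
      (zero_le_finToWithTop n) le_top x)
  have e2 := diagramGen_congr M (coneExt s v) hθ (j₁ := ⊤)
    ((zero_le_finToWithTop n).trans ((finToWithTop n).monotone (Fin.zero_le (δ.toOrderHom 0)))) le_top x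
  refine e1.trans (e2.trans (barGen_congr M rfl (heq_of_eq ?_) (heq_of_eq ?_)))
  · exact (congrArg (· ≫ v) (s.map_id _)).trans (Category.id_comp v)
  · exact (congrArg (fun g => (M.map g).hom x) (s.map_id _)).trans (map_id_hom_apply M x)

/-- The section of the augmentation of the bar resolution. -/
noncomputable def barSection (M : C ⥤ ModuleCat.{u} k) (c : C) : M.obj c →ₗ[k] BarSum M 0 c :=
  barGen M (n := 0) (ComposableArrows.mk₀ c) (𝟙 c)

theorem barEval_barSection (M : C ⥤ ModuleCat.{u} k) (c : C) :
    barEval M c ∘ₗ barSection M c = LinearMap.id := by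
  ext x
  have h : barEval M c (barSection M c x) = (M.map (𝟙 c)).hom x := barDesc_gen M _ _ _ _
  exact h.trans (map_id_hom_apply M x)

/-- Appending to a vertex `c₀` produces the edge `v : c₀ ⟶ c`; deleting `c₀` leaves `c` with its
identity and the coefficient transported along `v`. -/
theorem barFace_zero_barAppend (M : C ⥤ ModuleCat.{u} k) (c : C) :
    barFace M (0 : Fin 2) c ∘ₗ barAppend M 0 c = barSection M c ∘ₗ barEval M c := by
  refine barSum_ext M fun s v x => ?_
  let δ := SimplexCategory.δ (0 : Fin 2)
  let ι : Fin 1 →o WithTop (Fin 1) := ⟨fun _ => ⊤, fun _ _ _ => le_rfl⟩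
  have hθ : (finToWithTop 0).comp δ.toOrderHom = ι := by
    ext1
    funext i
    fin_cases i
    rfl
  have e1 := (congrArg (barFace M (0 : Fin 2) c) (barAppend_gen M s v x)).trans
    (barPull_diagramGen M (coneExt s v) δ (finToWithTop 0) (j₁ := ⊤)
      (zero_le_finToWithTop 0) le_top x)
  have e2 := diagramGen_congr M (coneExt s v) hθ (j₁ := ⊤)
    ((zero_le_finToWithTop 0).trans ((finToWithTop 0).monotone (Fin.zero_le (δ.toOrderHom 0)))) le_top x
  have e3 : barSection M c (barEval M c (barGen M s v x)) =
      barSection M c ((M.map v).hom x) := congrArg _ (barDesc_gen M _ _ _ _)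
  refine e1.trans (e2.trans (Eq.trans ?_ e3.symm))
  have hs : (s.map (homOfLE (Fin.le_last 0)) : s.left ⟶ s.right) ≫ v = v :=
    (congrArg (· ≫ v) (s.map_id _)).trans (Category.id_comp v)
  refine barGen_congr M ?_ (HEq.refl _) (heq_of_eq ?_)
  · refine Functor.hext (fun _ => rfl) fun _ _ _ => HEq.refl _
  · exact congrArg (fun g => (M.map g).hom x) hs

/-- The differential of the bar resolution. -/
noncomputable def barD (M : C ⥤ ModuleCat.{u} k) (n : ℕ) (c : C) :
    BarSum M (n + 1) c →ₗ[k] BarSum M n c :=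
  ∑ i : Fin (n + 2), (-1 : ℤ) ^ (i : ℕ) • barFace M i c

theorem objD_simplicialBar (M : C ⥤ ModuleCat.{u} k) (n : ℕ) (c : C)
    (x : BarSum M (n + 1) c) :
    ((AlgebraicTopology.AlternatingFaceMapComplex.objD (simplicialBar M) n).app c).hom x =
      barD M n c x := by
  have h : ((AlgebraicTopology.AlternatingFaceMapComplex.objD (simplicialBar M) n).app c).hom =
      ∑ i : Fin (n + 2), (-1 : ℤ) ^ (i : ℕ) • (((simplicialBar M).δ i).app c).hom := by
    simp [AlgebraicTopology.AlternatingFaceMapComplex.objD]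
  exact congrArg (fun g => g x) h

/-- All faces but the last commute with appending and give the first term. The last face has index
`n + 2` and undoes the appending, so its sign is `(-1) ^ n`. -/
theorem barD_succ_barAppend (M : C ⥤ ModuleCat.{u} k) (n : ℕ) (c : C) (x : BarSum M (n + 1) c) :
    barD M (n + 1) c (barAppend M (n + 1) c x) =
      barAppend M n c (barD M n c x) + (-1 : ℤ) ^ n • x := by
  have h1 : ∀ i : Fin (n + 2), barFace M i.castSucc c (barAppend M (n + 1) c x) =
      barAppend M n c (barFace M i c x) := fun i =>
    LinearMap.congr_fun (barFace_castSucc_barAppend M i c) x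
  have h2 : barFace M (Fin.last (n + 2)) c (barAppend M (n + 1) c x) = x :=
    LinearMap.congr_fun (barFace_last_barAppend M c) x
  rw [barD, barD, LinearMap.sum_apply, LinearMap.sum_apply, Fin.sum_univ_castSucc, map_sum]
  simp only [LinearMap.smul_apply, h1, h2, Fin.val_castSucc, Fin.val_last, map_zsmul]
  rw [pow_add, neg_one_sq, mul_one]

theorem barD_zero_barAppend (M : C ⥤ ModuleCat.{u} k) (c : C) (x : BarSum M 0 c) :
    barD M 0 c (barAppend M 0 c x) = barSection M c (barEval M c x) - x := by
  have h1 : barFace M (0 : Fin 2) c (barAppend M 0 c x) = barSection M c (barEval M c x) :=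
    LinearMap.congr_fun (barFace_zero_barAppend M c) x
  have h2 : barFace M (1 : Fin 2) c (barAppend M 0 c x) = x :=
    LinearMap.congr_fun (barFace_last_barAppend (n := 0) M c) x
  rw [barD, LinearMap.sum_apply, Fin.sum_univ_two]
  simp only [LinearMap.smul_apply, h1, h2]
  simp [sub_eq_add_neg]

/-- Appending commutes with degeneracies, so the contracting homotopy descends to normalized chains.
-/
theorem barAppend_mem_degenerateChains (M : C ⥤ ModuleCat.{u} k) (n : ℕ) (c : C) {x : BarSum M n c}
    (hx : x ∈ degenerateChains M n c) : barAppend M n c x ∈ degenerateChains M (n + 1) c := by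
  suffices h : degenerateChains M n c ≤
      (degenerateChains M (n + 1) c).comap (barAppend M n c) from h hx
  cases n with
  | zero => exact bot_le
  | succ n =>
    rw [degenerateChains_succ, degenerateChains_succ]
    refine iSup_le fun i => ?_
    rintro _ ⟨y, rfl⟩
    exact Submodule.mem_iSup_of_mem i.castSucc ⟨barAppend M n c y,
      LinearMap.congr_fun (barDegen_castSucc_barAppend M i c) y⟩

/-- Both faces of an edge evaluate to the action of its composite with `v`, and they carry opposite
signs. -/
theorem barEval_barD (M : C ⥤ ModuleCat.{u} k) (c : C) (x : BarSum M 1 c) :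
    barEval M c (barD M 0 c x) = 0 := by
  have h : ∀ i : Fin 2, ∀ (s : ComposableArrows C 1) (v : s.right ⟶ c) (y : M.obj s.left),
      barEval M c (barFace M i c (barGen M s v y)) = (M.map (s.hom ≫ v)).hom y := by
    intro i s v y
    refine (congrArg (barEval M c) (barPull_gen M (SimplexCategory.δ i) s v y)).trans ?_
    refine (barDesc_gen M _ _ _ _).trans ?_
    refine (map_comp_hom_apply M _ _ y).symm.trans ?_
    refine congrArg (fun g => (M.map g).hom y) ?_
    refine (Category.assoc _ _ _).symm.trans (congrArg (· ≫ v) ?_)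
    exact (s.map_comp _ _).symm
  have h' : barEval M c ∘ₗ barFace M (0 : Fin 2) c = barEval M c ∘ₗ barFace M (1 : Fin 2) c :=
    barSum_ext M fun s v y => (h 0 s v y).trans (h 1 s v y).symm
  have h'' := LinearMap.congr_fun h' x
  rw [LinearMap.comp_apply, LinearMap.comp_apply] at h''
  rw [barD, LinearMap.sum_apply, Fin.sum_univ_two, map_add]
  simp only [LinearMap.smul_apply, map_zsmul, h'']
  simp

theorem normalizedBar_d (M : C ⥤ ModuleCat.{u} k) (n : ℕ) :
    (normalizedBar M).d (n + 1) n = normalizedD (simplicialBar M) n :=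
  normalizedComplex_d (simplicialBar M) n

/-- The normalized bar resolution is a resolution. -/
theorem normalizedBar_isResolution (M : C ⥤ ModuleCat.{u} k) :
    IsResolution (normalizedBar M) (normalizedBarAug M) where
  surjective c y := ⟨Submodule.Quotient.mk (barSection M c y),
    LinearMap.congr_fun (barEval_barSection M c) y⟩
  exact_zero c := by
    rw [normalizedBar_d]
    intro y
    obtain ⟨x, rfl⟩ := Submodule.Quotient.mk_surjective (degenerateChains M 0 c) y
    constructor
    · intro hx
      -- On the kernel of the augmentation the homotopy identity in degree zero reads `d h x = -x`,
      -- whence the sign.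
      refine ⟨Submodule.Quotient.mk (p := degenerateChains M 1 c) (-barAppend M 0 c x), ?_⟩
      refine congrArg (Submodule.Quotient.mk (p := degenerateChains M 0 c)) ?_
      refine (objD_simplicialBar M 0 c _).trans ?_
      rw [map_neg, barD_zero_barAppend]
      have hx' : barEval M c x = 0 := hx
      rw [hx', map_zero, zero_sub, neg_neg]
    · rintro ⟨z, hz⟩
      obtain ⟨z, rfl⟩ := Submodule.Quotient.mk_surjective (degenerateChains M 1 c) z
      refine (congrArg ((normalizedBarAug M).app c).hom hz).symm.trans ?_
      exact (congrArg (barEval M c) (objD_simplicialBar M 0 c z)).trans (barEval_barD M c z)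
  exact_succ n c := by
    have hd := (normalizedBar M).d_comp_d (n + 2) (n + 1) n
    rw [normalizedBar_d, normalizedBar_d] at hd ⊢
    intro y
    constructor
    · obtain ⟨x, rfl⟩ := Submodule.Quotient.mk_surjective (degenerateChains M (n + 1) c) y
      intro hx
      have hx' : Submodule.Quotient.mk (p := degenerateChains M n c) (barD M n c x) = 0 :=
        (congrArg (Submodule.Quotient.mk (p := degenerateChains M n c))
          (objD_simplicialBar M n c x).symm).trans hx
      rw [Submodule.Quotient.mk_eq_zero] at hx'
      -- The sign cancels the one in the homotopy identity. The remaining term is `h (d x)` up to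
      -- sign, which is degenerate because `d x` is.
      refine ⟨Submodule.Quotient.mk (p := degenerateChains M (n + 2) c)
        ((-1 : ℤ) ^ n • barAppend M (n + 1) c x), ?_⟩
      refine (congrArg (Submodule.Quotient.mk (p := degenerateChains M (n + 1) c))
        (objD_simplicialBar M (n + 1) c _)).trans ?_
      refine (Submodule.Quotient.eq (degenerateChains M (n + 1) c)).2 ?_
      rw [map_zsmul, barD_succ_barAppend, smul_add, smul_smul, ← mul_pow, neg_one_mul, neg_neg,
        one_pow, one_smul, add_sub_cancel_right]
      exact (degenerateChains M (n + 1) c).toAddSubgroup.zsmul_mem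
        (barAppend_mem_degenerateChains M n c hx') _
    · rintro ⟨z, rfl⟩
      exact congr_hom_apply hd z

end BarExact

/-! ### Comparison of projective resolutions and transfer through induction -/

section Comparison
open Limits
variable {k : Type u} [CommRing k] {C : Type} [SmallCategory C]

/-- Evaluation functors commute with homology, and a functor is zero as soon as all its values are;
this links categorical and elementwise exactness. -/
theorem shortComplex_exact_iff (S : ShortComplex (C ⥤ ModuleCat.{u} k)) :
    S.Exact ↔ ∀ c, Function.Exact (S.f.app c).hom (S.g.app c).hom := by
  have h : S.Exact ↔ ∀ c, (S.map ((evaluation C (ModuleCat.{u} k)).obj c)).Exact := by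
    refine ⟨fun h c => h.map _, fun h => ?_⟩
    rw [S.exact_iff_isZero_homology]
    refine Functor.isZero _ fun c => ?_
    exact (((S.map _).exact_iff_isZero_homology).1 (h c)).of_iso
      (S.mapHomologyIso ((evaluation C (ModuleCat.{u} k)).obj c)).symm
  rw [h]
  exact forall_congr' fun c => ShortComplex.ShortExact.moduleCat_exact_iff_function_exact _

variable {P : ChainComplex (C ⥤ ModuleCat.{u} k) ℕ} {M : C ⥤ ModuleCat.{u} k} {ε : P.X 0 ⟶ M}

theorem IsResolution.d_comp (h : IsResolution P ε) : P.d 1 0 ≫ ε = 0 := by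
  ext c x
  exact (h.exact_zero c _).2 ⟨x, rfl⟩

/-- The augmentation of a resolution, as a chain map to a complex concentrated in degree zero. -/
noncomputable def IsResolution.toSingle (h : IsResolution P ε) :
    P ⟶ (ChainComplex.single₀ (C ⥤ ModuleCat.{u} k)).obj M :=
  (ChainComplex.toSingle₀Equiv P M).symm ⟨ε, h.d_comp⟩

theorem IsResolution.toSingle_f_zero (h : IsResolution P ε) : h.toSingle.f 0 = ε :=
  ChainComplex.toSingle₀Equiv_symm_apply_f_zero ε h.d_comp

/-- In degree zero this is exactness at `P₀` together with surjectivity of the augmentation; in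
positive degrees the target vanishes and only exactness is left. This form gives access to the
comparison theorem for projective resolutions. -/
theorem IsResolution.quasiIso (h : IsResolution P ε) : QuasiIso h.toSingle where
  quasiIsoAt n := by
    cases n with
    | zero =>
      rw [ChainComplex.quasiIsoAt₀_iff, ShortComplex.quasiIso_iff_of_zeros']
      · have : Epi ε := FreeBasis.epi_of_surjective ε h.surjective
        refine (ShortComplex.exact_and_epi_g_iff_of_iso ?_).2
          ⟨(shortComplex_exact_iff (ShortComplex.mk (P.d 1 0) ε h.d_comp)).2 h.exact_zero, this⟩
        exact ShortComplex.isoMk (Iso.refl _) (Iso.refl _) (Iso.refl _)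
          ((Category.id_comp _).trans (Category.comp_id _).symm)
          ((Category.id_comp _).trans
            (h.toSingle_f_zero.symm.trans (Category.comp_id (h.toSingle.f 0)).symm))
      · exact P.shape _ _ (by simp)
      · rfl
      · rfl
    | succ n =>
      rw [quasiIsoAt_iff_exactAt']
      · rw [HomologicalComplex.exactAt_iff' _ (n + 2) (n + 1) n (by simp only [ChainComplex.prev]; rfl) (by simp)]
        exact (shortComplex_exact_iff _).2 (h.exact_succ n)
      · exact ChainComplex.exactAt_succ_single_obj _ _

/-- A resolution by projective modules. -/
noncomputable def IsResolution.projectiveResolution (h : IsResolution P ε)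
    (hP : ∀ n, Projective (P.X n)) : ProjectiveResolution M where
  complex := P
  projective := hP
  π := h.toSingle
  quasiIso := h.quasiIso

theorem isResolution_of_projectiveResolution (R : ProjectiveResolution M) :
    IsResolution R.complex (R.π.f 0) where
  surjective := FreeBasis.surjective_of_epi (R.π.f 0)
  exact_zero := (shortComplex_exact_iff _).1 R.exact₀
  exact_succ n := (shortComplex_exact_iff _).1 (R.exact_succ n)

variable {D : Type} [SmallCategory D] (ρ : C ⥤ D)

/-- The induced complex of a projective resolution `P` of the restriction of `N` is a resolution of
`N`, if `N` has a resolution `Q` that restricts to a projective resolution and whose terms are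
induced from their restrictions. -/
theorem inducedComplex_isResolution (hP : IsResolution P ε) (hP' : ∀ n, Projective (P.X n))
    (hind : ∀ n, Projective ((inducedComplex ρ P).X n))
    {Q : ChainComplex (D ⥤ ModuleCat.{u} k) ℕ} {N : D ⥤ ModuleCat.{u} k} {η : Q.X 0 ⟶ N}
    (hQ : IsResolution Q η) (hQ' : ∀ n, Projective (ρ ⋙ Q.X n))
    (hc : ∀ n, IsIso ((ρ.lanAdjunction (ModuleCat.{u} k)).counit.app (Q.X n)))
    (e : M ≅ ρ ⋙ N) : IsResolution (inducedComplex ρ P) (inducedAug ρ P ε e) := by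
  let res := (Functor.whiskeringLeft C D (ModuleCat.{u} k)).obj ρ
  let adj := ρ.lanAdjunction (ModuleCat.{u} k)
  let resQ := (res.mapHomologicalComplex (ComplexShape.down ℕ)).obj Q
  let εQ : resQ.X 0 ⟶ M := Functor.whiskerLeft ρ η ≫ e.inv
  have hresQ : IsResolution resQ εQ :=
    { surjective := fun c => by
        have he : Function.Surjective (e.inv.app c).hom := FreeBasis.surjective_of_epi e.inv c
        exact he.comp (hQ.surjective (ρ.obj c))
      exact_zero := fun c x => by
        have he : Function.Injective (e.inv.app c).hom :=
          Function.LeftInverse.injective (g := (e.hom.app c).hom)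
            fun x => congr_hom_apply e.inv_hom_id x
        refine Iff.trans ?_ (hQ.exact_zero (ρ.obj c) x)
        exact ⟨fun h => he (h.trans (map_zero _).symm), fun h => (congrArg (e.inv.app c).hom h).trans (map_zero (e.inv.app c).hom)⟩
      exact_succ := fun n c => hQ.exact_succ n (ρ.obj c) }
  let RP := hP.projectiveResolution hP'
  let RQ := hresQ.projectiveResolution hQ'
  -- Two projective resolutions of the same module are homotopy equivalent, compatibly with their
  -- augmentations.
  let h : HomotopyEquiv P resQ := ProjectiveResolution.homotopyEquiv RP RQ
  have hh : h.hom.f 0 ≫ εQ = ε := by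
    have h1 : h.hom ≫ hresQ.toSingle = hP.toSingle :=
      ProjectiveResolution.homotopyEquiv_hom_π RP RQ
    have h2 := HomologicalComplex.congr_hom h1 0
    rw [HomologicalComplex.comp_f, hresQ.toSingle_f_zero, hP.toSingle_f_zero] at h2
    exact h2
  -- Induction may fail to preserve quasi-isomorphisms, but every additive functor preserves
  -- homotopy equivalences.
  let H := (indFunctor k ρ).mapHomotopyEquiv h
  -- The counits assemble to an isomorphism from the induced restriction of `Q` back to `Q`.
  let γ : ((indFunctor k ρ).mapHomologicalComplex (ComplexShape.down ℕ)).obj resQ ⟶ Q :=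
    { f := fun n => adj.counit.app (Q.X n)
      comm' := fun i j _ => (adj.counit.naturality (Q.d i j)).symm }
  have hγ : ∀ n, IsIso (γ.f n) := hc
  have hγ' : IsIso γ := HomologicalComplex.Hom.isIso_of_components γ
  have hq1 : QuasiIso hQ.toSingle := hQ.quasiIso
  have hq2 : QuasiIso γ := inferInstance
  have hq3 : QuasiIso H.hom := inferInstance
  have hq : QuasiIso (H.hom ≫ γ ≫ hQ.toSingle) := by
    have := quasiIso_comp γ hQ.toSingle
    exact quasiIso_comp H.hom (γ ≫ hQ.toSingle)
  let R : ProjectiveResolution N :=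
    { complex := inducedComplex ρ P
      projective := hind
      π := H.hom ≫ γ ≫ hQ.toSingle
      quasiIso := hq }
  have hR := isResolution_of_projectiveResolution R
  -- The augmentation obtained through `Q` agrees with the adjoint one by naturality of the counit
  -- at `η`.
  have haug : R.π.f 0 = inducedAug ρ P ε e := by
    have h1 : R.π.f 0 = (indFunctor k ρ).map (h.hom.f 0) ≫ adj.counit.app (Q.X 0) ≫ η :=
      congrArg (fun g => (indFunctor k ρ).map (h.hom.f 0) ≫ adj.counit.app (Q.X 0) ≫ g)
        hQ.toSingle_f_zero
    have h2 : ε ≫ e.hom = h.hom.f 0 ≫ res.map η := by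
      rw [← hh, Category.assoc]
      refine congrArg (h.hom.f 0 ≫ ·) ?_
      exact (Category.assoc _ _ _).trans
        ((congrArg (Functor.whiskerLeft ρ η ≫ ·) e.inv_hom_id).trans (Category.comp_id _))
    have h3 : inducedAug ρ P ε e = ρ.lan.map (h.hom.f 0 ≫ res.map η) ≫ adj.counit.app N := by
      rw [inducedAug, h2]
      exact adj.homEquiv_counit _ _ _
    refine h1.trans (Eq.trans ?_ h3.symm)
    refine Eq.trans ?_ ((congrArg (· ≫ adj.counit.app N)
      (ρ.lan.map_comp (h.hom.f 0) (res.map η))).trans (Category.assoc _ _ _)).symm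
    exact congrArg (fun g => (indFunctor k ρ).map (h.hom.f 0) ≫ g) (adj.counit.naturality η).symm
  rw [← haug]
  exact hR

end Comparison

/-! ### Submodules of functors and the radical -/

section Subfunctor
variable {k : Type u} [CommRing k] {C : Type} [SmallCategory C]

/-- The submodule of a module over a category given by a compatible family of submodules. -/
noncomputable def subFunctor (M : C ⥤ ModuleCat.{u} k) (S : ∀ c, Submodule k (M.obj c))
    (h : ∀ ⦃c d : C⦄ (f : c ⟶ d), S c ≤ (S d).comap (M.map f).hom) : C ⥤ ModuleCat.{u} k where
  obj c := ModuleCat.of k (S c)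
  map f := ModuleCat.ofHom ((M.map f).hom.restrict (h f))
  map_id c := by
    ext x
    exact map_id_hom_apply M x.1
  map_comp f g := by
    ext x
    exact map_comp_hom_apply M f g x.1

/-- The inclusion of a submodule. -/
noncomputable def subFunctorι (M : C ⥤ ModuleCat.{u} k) (S : ∀ c, Submodule k (M.obj c))
    (h : ∀ ⦃c d : C⦄ (f : c ⟶ d), S c ≤ (S d).comap (M.map f).hom) : subFunctor M S h ⟶ M where
  app c := ModuleCat.ofHom (S c).subtype

instance (M : C ⥤ ModuleCat.{u} k) (S : ∀ c, Submodule k (M.obj c))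
    (h : ∀ ⦃c d : C⦄ (f : c ⟶ d), S c ≤ (S d).comap (M.map f).hom) : Mono (subFunctorι M S h) := by
  rw [NatTrans.mono_iff_mono_app]
  exact fun c => (ModuleCat.mono_iff_injective _).2 Subtype.val_injective

theorem map_mem_jrad (M : C ⥤ ModuleCat.{u} k) {b c : C} (f : b ⟶ c) (hf : ¬ IsIso f)
    (x : M.obj b) : (M.map f).hom x ∈ jrad M c :=
  Submodule.mem_iSup_of_mem b (Submodule.mem_iSup_of_mem f (Submodule.mem_iSup_of_mem hf ⟨x, rfl⟩))

theorem jrad_le {M : C ⥤ ModuleCat.{u} k} {c : C} {S : Submodule k (M.obj c)}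
    (h : ∀ (b : C) (f : b ⟶ c), ¬ IsIso f → ∀ x, (M.map f).hom x ∈ S) : jrad M c ≤ S := by
  refine iSup_le fun b => iSup_le fun f => iSup_le fun hf => ?_
  rintro _ ⟨x, rfl⟩
  exact h b f hf x

theorem app_mem_jrad {M N : C ⥤ ModuleCat.{u} k} (φ : M ⟶ N) {c : C} {x : M.obj c}
    (hx : x ∈ jrad M c) : (φ.app c).hom x ∈ jrad N c := by
  suffices h : jrad M c ≤ (jrad N c).comap (φ.app c).hom from h hx
  refine jrad_le fun b f hf y => ?_
  rw [Submodule.mem_comap, naturality_hom_apply]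
  exact map_mem_jrad N f hf _

end Subfunctor

/-! ### Kernels of projective covers lie in the radical -/

section Minimal
variable {k : Type u} [Field k] {C : Type} [SmallCategory C]

/-- The kernel of a projective cover consists of sums of images of non-isomorphisms. -/
theorem IsProjectiveCover.ker_le_jrad {P M : C ⥤ ModuleCat.{u} k} {f : P ⟶ M}
    (hf : IsProjectiveCover f) (c : C)
    (hc : ∀ (b : C) (u v : b ⟶ c), IsIso u → IsIso v → u = v) :
    LinearMap.ker (f.app c).hom ≤ jrad P c := by
  intro z hz
  by_contra hzr
  -- A kernel element outside the radical is detected by a linear functional vanishing on the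
  -- radical.
  obtain ⟨φ, hφ⟩ : ∃ φ : Module.Dual k (spl P c), φ (Submodule.Quotient.mk z) ≠ 0 := by
    by_contra! h
    exact hzr ((Submodule.Quotient.mk_eq_zero _).1 ((Module.forall_dual_apply_eq_zero_iff k _).1 h))
  let ψ : P.obj c →ₗ[k] k := φ ∘ₗ (jrad P c).mkQ
  have hψz : ψ z ≠ 0 := hφ
  have hψ : ∀ {x}, x ∈ jrad P c → ψ x = 0 := fun {x} hx => by
    refine (congrArg φ ?_).trans (map_zero φ)
    exact (Submodule.Quotient.mk_eq_zero _).2 hx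
  -- The largest subfunctor on which the functional vanishes. It does not contain `z`, yet it will
  -- be shown to surject onto `M`, contradicting superfluity.
  let S : ∀ b, Submodule k (P.obj b) := fun b => ⨅ u : b ⟶ c, LinearMap.ker (ψ ∘ₗ (P.map u).hom)
  have hS : ∀ {b} {x : P.obj b}, x ∈ S b ↔ ∀ u : b ⟶ c, ψ ((P.map u).hom x) = 0 := by
    intro b x
    simp only [S, Submodule.mem_iInf, LinearMap.mem_ker, LinearMap.comp_apply]
  have hSc : ∀ ⦃b d : C⦄ (g : b ⟶ d), S b ≤ (S d).comap (P.map g).hom := by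
    intro b d g x hx
    rw [Submodule.mem_comap, hS]
    intro u
    rw [← map_comp_hom_apply]
    exact hS.1 hx _
  let g := subFunctorι P S hSc
  have hgf : Epi (g ≫ f) := by
    refine FreeBasis.epi_of_surjective _ fun b m => ?_
    have := hf.epi
    obtain ⟨x, rfl⟩ := FreeBasis.surjective_of_epi f b m
    by_cases hb : ∃ u : b ⟶ c, IsIso u
    · obtain ⟨u, hu⟩ := hb
      -- At an object isomorphic to `c`, subtracting this multiple of a kernel element makes the
      -- functional vanish without changing the image in `M`. Uniqueness of the isomorphism to `c`
      -- makes a single correction suffice.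
      let y := x - (ψ ((P.map u).hom x) / ψ z) • (P.map (inv u)).hom z
      have hz' : (f.app b).hom ((P.map (inv u)).hom z) = 0 := by
        rw [naturality_hom_apply, LinearMap.mem_ker.1 hz, map_zero]
      have hy : y ∈ S b := hS.2 fun v => by
        by_cases hv : IsIso v
        · rw [hc b v u hv hu]
          have h1 : (P.map u).hom ((P.map (inv u)).hom z) = z := by
            rw [← map_comp_hom_apply, IsIso.inv_hom_id, map_id_hom_apply]
          rw [map_sub, map_sub, map_smul, map_smul, h1, smul_eq_mul, div_mul_cancel₀ _ hψz, sub_self]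
        · exact hψ (map_mem_jrad P v hv _)
      refine ⟨⟨y, hy⟩, ?_⟩
      change (f.app b).hom y = _
      rw [map_sub, map_smul, hz', smul_zero, sub_zero]
    -- Otherwise every morphism to `c` lands in the radical, so the subfunctor is everything at `b`.
    · push Not at hb
      exact ⟨⟨x, hS.2 fun v => hψ (map_mem_jrad P v (hb v) _)⟩, rfl⟩
  have hg : Epi g := (hf.superfluous g).2 hgf
  obtain ⟨x, hx⟩ := FreeBasis.surjective_of_epi g c z
  have h1 := hS.1 x.2 (𝟙 c)
  rw [map_id_hom_apply] at h1
  exact hψz ((congrArg ψ hx).symm.trans h1)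

end Minimal

/-! ### The action category and submodules generated by variables -/

section ActCat
variable {σ Γ : Type} [AddCommGroup Γ] {w : σ → Γ}

namespace ActCat

theorem of_deg (c : ActCat w) : of w c.deg = c := rfl

theorem weight_single (w : σ → Γ) (i : σ) : Finsupp.weight w (Finsupp.single i 1) = w i := by
  simp [Finsupp.weight_single]

/-- Multiplication by the variable `xᵢ`. -/
noncomputable def varHom (i : σ) (γ : Γ) : of w (γ - w i) ⟶ of w γ :=
  homMk (Finsupp.single i 1) (by rw [weight_single, deg_of, deg_of, add_sub_cancel])

theorem expo_varHom (i : σ) (γ : Γ) : expo (varHom (w := w) i γ) = Finsupp.single i 1 := rfl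

theorem exists_eq_comp_varHom {b : ActCat w} {γ : Γ} (f : b ⟶ of w γ) {i : σ} (h : expo f i ≠ 0) :
    ∃ g : b ⟶ of w (γ - w i), f = g ≫ varHom i γ := by
  have hle : Finsupp.single i 1 ≤ expo f := by
    rw [Finsupp.single_le_iff]
    exact Nat.one_le_iff_ne_zero.2 h
  have hw := weight_expo f
  rw [← add_tsub_cancel_of_le hle, map_add, weight_single, deg_of] at hw
  refine ⟨homMk (expo f - Finsupp.single i 1) ?_, hom_ext ?_⟩
  · rw [deg_of, eq_sub_iff_add_eq', ← add_assoc, hw]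
  · rw [expo_comp, expo_varHom, expo_homMk, add_tsub_cancel_of_le hle]

/-- Exponents add under composition and lie in `ℕ`, so an invertible morphism has exponent zero; a
morphism of exponent zero joins objects of equal degree. -/
theorem isIso_iff {b c : ActCat w} (f : b ⟶ c) : IsIso f ↔ expo f = 0 := by
  constructor
  · intro h
    have h1 : expo (inv f) + expo f = 0 := by
      rw [← expo_comp, IsIso.hom_inv_id, expo_id]
    exact (add_eq_zero.1 h1).2
  · intro h
    have hw := weight_expo f
    rw [h, map_zero, zero_add] at hw
    refine ⟨homMk 0 (by rw [map_zero, zero_add, hw]), hom_ext ?_, hom_ext ?_⟩ <;>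
      rw [expo_comp, expo_homMk, h, expo_id, add_zero]

theorem eq_of_isIso {b c : ActCat w} (f g : b ⟶ c) (hf : IsIso f) (hg : IsIso g) : f = g :=
  hom_ext (((isIso_iff f).1 hf).trans ((isIso_iff g).1 hg).symm)

end ActCat

variable {k : Type u} [CommRing k]

/-- The submodule of `M(c)` generated by the multiples of the variables in `W`. -/
noncomputable def varSub (W : Finset σ) (M : ActCat w ⥤ ModuleCat.{u} k) (c : ActCat w) :
    Submodule k (M.obj c) :=
  ⨆ (b : ActCat w) (f : b ⟶ c) (_ : ∃ i ∈ W, ActCat.expo f i ≠ 0), LinearMap.range (M.map f).hom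

variable {W : Finset σ} {M N : ActCat w ⥤ ModuleCat.{u} k}

theorem map_mem_varSub {b c : ActCat w} (f : b ⟶ c) (hf : ∃ i ∈ W, ActCat.expo f i ≠ 0)
    (x : M.obj b) : (M.map f).hom x ∈ varSub W M c :=
  Submodule.mem_iSup_of_mem b (Submodule.mem_iSup_of_mem f (Submodule.mem_iSup_of_mem hf ⟨x, rfl⟩))

theorem varSub_le {c : ActCat w} {S : Submodule k (M.obj c)}
    (h : ∀ (b : ActCat w) (f : b ⟶ c), (∃ i ∈ W, ActCat.expo f i ≠ 0) →
      ∀ x, (M.map f).hom x ∈ S) : varSub W M c ≤ S := by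
  refine iSup_le fun b => iSup_le fun f => iSup_le fun hf => ?_
  rintro _ ⟨x, rfl⟩
  exact h b f hf x

theorem varSub_mono {W' : Finset σ} (h : W ⊆ W') (c : ActCat w) : varSub W M c ≤ varSub W' M c :=
  varSub_le fun _ f ⟨i, hi, hf⟩ x => map_mem_varSub f ⟨i, h hi, hf⟩ x

theorem varSub_empty (c : ActCat w) : varSub ∅ M c = ⊥ :=
  le_bot_iff.1 (varSub_le fun _ _ ⟨_, hi, _⟩ _ => absurd hi (Finset.notMem_empty _))

theorem app_mem_varSub (φ : M ⟶ N) {c : ActCat w} {x : M.obj c} (hx : x ∈ varSub W M c) :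
    (φ.app c).hom x ∈ varSub W N c := by
  suffices h : varSub W M c ≤ (varSub W N c).comap (φ.app c).hom from h hx
  refine varSub_le fun b f hf y => ?_
  rw [Submodule.mem_comap, naturality_hom_apply]
  exact map_mem_varSub f hf _

theorem map_varSub_mem {b c : ActCat w} (f : b ⟶ c) {x : M.obj b} (hx : x ∈ varSub W M b) :
    (M.map f).hom x ∈ varSub W M c := by
  suffices h : varSub W M b ≤ (varSub W M c).comap (M.map f).hom from h hx
  refine varSub_le fun a g ⟨i, hi, hg⟩ y => ?_
  rw [Submodule.mem_comap, ← map_comp_hom_apply]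
  refine map_mem_varSub _ ⟨i, hi, ?_⟩ _
  rw [ActCat.expo_comp, Finsupp.add_apply]
  omega

/-- A morphism whose exponent involves `xᵢ` factors through multiplication by `xᵢ`, so the new
variable contributes the image of a single map. -/
theorem mem_varSub_insert [DecidableEq σ] {i : σ} {γ : Γ} {x : M.obj (ActCat.of w γ)}
    (hx : x ∈ varSub (insert i W) M (ActCat.of w γ)) :
    ∃ y, ∃ s ∈ varSub W M (ActCat.of w γ), x = (M.map (ActCat.varHom i γ)).hom y + s := by
  have h : varSub (insert i W) M (ActCat.of w γ) ≤
      LinearMap.range (M.map (ActCat.varHom i γ)).hom ⊔ varSub W M (ActCat.of w γ) := by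
    refine varSub_le fun b f ⟨j, hj, hf⟩ x => ?_
    rcases Finset.mem_insert.1 hj with rfl | hj
    · obtain ⟨g, rfl⟩ := ActCat.exists_eq_comp_varHom f hf
      rw [map_comp_hom_apply]
      exact Submodule.mem_sup_left ⟨_, rfl⟩
    · exact Submodule.mem_sup_right (map_mem_varSub f ⟨j, hj, hf⟩ x)
  obtain ⟨_, ⟨y, rfl⟩, s, hs, rfl⟩ := Submodule.mem_sup.1 (h hx)
  exact ⟨y, s, hs, rfl⟩

/-- Being a non-isomorphism means having a nonzero exponent, so the radical is the part generated by
all variables. -/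
theorem varSub_univ [Fintype σ] (M : ActCat w ⥤ ModuleCat.{u} k) (c : ActCat w) :
    varSub Finset.univ M c = jrad M c := by
  refine le_antisymm (varSub_le fun b f ⟨i, _, hf⟩ x => map_mem_jrad M f ?_ x)
    (jrad_le fun b f hf x => map_mem_varSub f ?_ x)
  · rw [ActCat.isIso_iff]
    intro h
    exact hf (by rw [h]; rfl)
  · rw [ActCat.isIso_iff] at hf
    obtain ⟨i, hi⟩ := Finsupp.ne_iff.1 hf
    exact ⟨i, Finset.mem_univ i, hi⟩

end ActCat

/-! ### Variables form a regular sequence on projective modules -/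

section Regular
universe v
variable {σ Γ : Type} [AddCommGroup Γ] {w : σ → Γ} {k : Type u} [CommRing k] {W : Finset σ}

/-- An element of a free module is a combination of multiples of the variables in `W` if and only if
each basis element with nonzero coefficient is such a multiple. -/
theorem FreeBasis.mem_varSub_iff {ι : Type v} {F : ActCat w ⥤ ModuleCat.{u} k}
    (β : FreeBasis ι F) {c : ActCat w} (x : F.obj c) :
    x ∈ varSub W F c ↔
      ∀ p ∈ ((β.basis c).repr x).support, ∃ i ∈ W, ActCat.expo p.2 i ≠ 0 := by
  let s : Set (Σ i, β.obj i ⟶ c) := {p | ∃ i ∈ W, ActCat.expo p.2 i ≠ 0}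
  constructor
  · suffices h : varSub W F c ≤ (Finsupp.supported k k s).comap (β.basis c).repr.toLinearMap from
      fun hx p hp => (Finsupp.mem_supported k _).1 (h hx) hp
    refine varSub_le fun b f ⟨j, hj, hf⟩ y => ?_
    suffices h : (⊤ : Submodule k (F.obj b)) ≤ ((Finsupp.supported k k s).comap
        (β.basis c).repr.toLinearMap).comap (F.map f).hom from h Submodule.mem_top
    rw [← (β.basis b).span_eq, Submodule.span_le]
    rintro _ ⟨⟨i, v⟩, rfl⟩
    rw [SetLike.mem_coe, Submodule.mem_comap, Submodule.mem_comap, β.map_basis]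
    change (β.basis c).repr (β.basis c ⟨i, v ≫ f⟩) ∈ _
    rw [Module.Basis.repr_self]
    refine Finsupp.single_mem_supported k 1 (show (⟨i, v ≫ f⟩ : Σ i, β.obj i ⟶ c) ∈ s from
      ⟨j, hj, ?_⟩)
    rw [ActCat.expo_comp, Finsupp.add_apply]
    omega
  · intro h
    rw [← (β.basis c).linearCombination_repr x, Finsupp.linearCombination_apply]
    refine Submodule.sum_mem _ fun p hp => Submodule.smul_mem _ _ ?_
    rw [← β.map_gen]
    exact map_mem_varSub p.2 (h p hp) _

/-- Multiplication by `xᵢ` is injective on basis elements and leaves the exponents of all other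
variables alone. Since `i ∉ W`, it cannot affect divisibility by a variable in `W`. -/
theorem FreeBasis.mem_varSub_of_map_mem {ι : Type v} {F : ActCat w ⥤ ModuleCat.{u} k}
    (β : FreeBasis ι F) {i : σ} (hi : i ∉ W) {b c : ActCat w} (f : b ⟶ c)
    (hf : ActCat.expo f = Finsupp.single i 1) {y : F.obj b} (hy : (F.map f).hom y ∈ varSub W F c) :
    y ∈ varSub W F b := by
  classical
  rw [β.mem_varSub_iff] at hy ⊢
  let τ : (Σ j, β.obj j ⟶ b) → (Σ j, β.obj j ⟶ c) := fun p => ⟨p.1, p.2 ≫ f⟩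
  have hτ : Function.Injective τ := by
    rintro ⟨j, u⟩ ⟨j', u'⟩ h
    obtain rfl : j = j' := congrArg Sigma.fst h
    have h' : u ≫ f = u' ≫ f := eq_of_heq (Sigma.ext_iff.1 h).2
    have h'' := congrArg ActCat.expo h'
    rw [ActCat.expo_comp, ActCat.expo_comp] at h''
    rw [ActCat.hom_ext (add_left_cancel h'')]
  have hmap : (β.basis c).repr ((F.map f).hom y) = Finsupp.mapDomain τ ((β.basis b).repr y) := by
    have h : (β.basis c).repr.toLinearMap ∘ₗ (F.map f).hom =
        Finsupp.lmapDomain k k τ ∘ₗ (β.basis b).repr.toLinearMap := by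
      refine (β.basis b).ext fun ⟨j, u⟩ => ?_
      change (β.basis c).repr ((F.map f).hom (β.basis b ⟨j, u⟩)) =
        Finsupp.mapDomain τ ((β.basis b).repr (β.basis b ⟨j, u⟩))
      rw [β.map_basis, Module.Basis.repr_self, Module.Basis.repr_self, Finsupp.mapDomain_single]
    exact LinearMap.congr_fun h y
  intro p hp
  obtain ⟨j, hj, hne⟩ := hy (τ p) (by
    rw [hmap, Finsupp.mapDomain_support_of_injective hτ]
    exact Finset.mem_image_of_mem τ hp)
  refine ⟨j, hj, ?_⟩
  have hij : i ≠ j := fun h => hi (h ▸ hj)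
  change ActCat.expo (p.2 ≫ f) j ≠ 0 at hne
  rwa [ActCat.expo_comp, hf, Finsupp.add_apply, Finsupp.single_eq_of_ne' hij, zero_add] at hne

/-- The variables outside `W` are nonzerodivisors on a projective module modulo those in `W`. -/
theorem mem_varSub_of_map_mem {P : ActCat w ⥤ ModuleCat.{u} k} (hP : Projective P) {i : σ}
    (hi : i ∉ W) {b c : ActCat w} (f : b ⟶ c) (hf : ActCat.expo f = Finsupp.single i 1)
    {y : P.obj b} (hy : (P.map f).hom y ∈ varSub W P c) : y ∈ varSub W P b := by
  let β := FreeBasis.ofFreeModule (k := k) fun c : ActCat w => (P.obj c : Type u)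
  let π : freeModule k (fun c => (P.obj c : Type u)) ⟶ P := β.desc fun i => i.2
  have hπ : Epi π := FreeBasis.epi_of_surjective π fun c x => ⟨β.basis c ⟨⟨c, x⟩, 𝟙 c⟩, by
    refine (β.desc_basis _ _ _).trans (map_id_hom_apply P x)⟩
  -- A projective module is a retract of a free one, and `varSub` is functorial, so the free case
  -- suffices.
  let s := Projective.factorThru (𝟙 P) π
  have hs : s ≫ π = 𝟙 P := Projective.factorThru_comp _ _
  have h1 : (s.app b).hom y ∈ varSub W _ b := by
    refine β.mem_varSub_of_map_mem hi f hf ?_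
    rw [← naturality_hom_apply]
    exact app_mem_varSub s hy
  have h2 := app_mem_varSub π h1
  have h3 : (π.app b).hom ((s.app b).hom y) = y := congr_hom_apply hs y
  rwa [h3] at h2

end Regular

/-! ### Vanishing of the splitting functor by killing variables one at a time -/

section Vanishing
variable {σ Γ : Type} [AddCommGroup Γ] {w : σ → Γ} {k : Type u}

section
variable [CommRing k]

/-- Exactness at `c` of a complex modulo the variables in `W`. -/
def ExactModVars (P : ChainComplex (ActCat w ⥤ ModuleCat.{u} k) ℕ) (W : Finset σ) (c : ActCat w) :
    Prop :=
  ∀ j (z : (P.X j).obj c), ((P.d j (j - 1)).app c).hom z ∈ varSub W (P.X (j - 1)) c →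
    ∃ v : (P.X (j + 1)).obj c, z - ((P.d (j + 1) j).app c).hom v ∈ varSub W (P.X j) c

variable {P : ChainComplex (ActCat w ⥤ ModuleCat.{u} k) ℕ} {M : ActCat w ⥤ ModuleCat.{u} k}
  {ε : P.X 0 ⟶ M}

theorem d_d_apply (P : ChainComplex (ActCat w ⥤ ModuleCat.{u} k) ℕ) (i j l : ℕ) {c : ActCat w}
    (x : (P.X i).obj c) : ((P.d j l).app c).hom (((P.d i j).app c).hom x) = 0 :=
  congr_hom_apply (P.d_comp_d i j l) x

/-- For `j = 0` the truncated index `0 - 1` is `0` and `d 0 0` is zero. The cycle condition in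
`ExactModVars` is then vacuous, so its content at `j = 0` is that boundaries together with multiples
of the variables fill `P₀`. -/
theorem d_zero_apply (P : ChainComplex (ActCat w ⥤ ModuleCat.{u} k) ℕ) {c : ActCat w}
    (x : (P.X 0).obj c) : ((P.d 0 (0 - 1)).app c).hom x = 0 :=
  congr_hom_apply (P.shape 0 0 (by simp)) x

/-- Since `xᵢ` is a nonzerodivisor on each `P_j` modulo `W`, the quotient by `xᵢ` sits in a short
exact sequence whose other two terms are `P` modulo `W` in degrees `γ - w i` and `γ`. Acyclicity of
these two gives that of the third; the proof is the corresponding diagram chase. -/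
theorem ExactModVars.insert_var [DecidableEq σ] (hP : ∀ j, Projective (P.X j)) {W : Finset σ} {i : σ}
    (hi : i ∉ W) {γ : Γ} (h : ExactModVars P W (ActCat.of w γ))
    (h' : ExactModVars P W (ActCat.of w (γ - w i))) :
    ExactModVars P (insert i W) (ActCat.of w γ) := by
  have hmono : ∀ {j} {x : (P.X j).obj (ActCat.of w γ)}, x ∈ varSub W (P.X j) _ →
      x ∈ varSub (insert i W) (P.X j) _ := fun {j x} hx =>
    varSub_mono (Finset.subset_insert i W) _ hx
  intro j z hz
  cases j with
  | zero =>
    obtain ⟨v, hv⟩ := h 0 z (by rw [d_zero_apply]; exact zero_mem _)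
    exact ⟨v, hmono hv⟩
  | succ j =>
    have hz' : ((P.d (j + 1) j).app _).hom z ∈ varSub (insert i W) (P.X j) (ActCat.of w γ) := hz
    obtain ⟨y, s, hs, hys⟩ := mem_varSub_insert hz'
    -- Applying `d` to `d z = xᵢ y + s` gives `xᵢ (d y) = -d s`, which lies in the part generated by
    -- `W`; regularity cancels `xᵢ`.
    have hy : ((P.d j (j - 1)).app _).hom y ∈ varSub W (P.X (j - 1)) _ := by
      refine mem_varSub_of_map_mem (hP _) hi (ActCat.varHom i γ) (ActCat.expo_varHom i γ) ?_
      rw [← naturality_hom_apply, ← sub_eq_of_eq_add hys, map_sub, d_d_apply, zero_sub]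
      exact neg_mem (app_mem_varSub _ hs)
    obtain ⟨v, hv⟩ := h' j y hy
    -- Replacing `z` by `z - xᵢ v` makes it a cycle modulo `W` alone.
    have hz'' : ((P.d (j + 1) j).app _).hom
        (z - ((P.X (j + 1)).map (ActCat.varHom i γ)).hom v) ∈ varSub W (P.X j) _ := by
      rw [map_sub, hys, naturality_hom_apply, add_sub_right_comm, ← map_sub]
      exact add_mem (map_varSub_mem _ hv) hs
    obtain ⟨u, hu⟩ := h (j + 1) _ hz''
    refine ⟨u, ?_⟩
    rw [sub_right_comm] at hu
    have h1 := add_mem (hmono hu) (map_mem_varSub (M := P.X (j + 1)) (ActCat.varHom i γ)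
      ⟨i, Finset.mem_insert_self i W, by rw [ActCat.expo_varHom]; simp⟩ v)
    rwa [sub_add_cancel] at h1

theorem exactModVars_empty (h : IsResolution P ε) {c : ActCat w} [Subsingleton (M.obj c)] :
    ExactModVars P ∅ c := by
  intro j z hz
  simp only [varSub_empty, Submodule.mem_bot] at hz ⊢
  cases j with
  | zero =>
    obtain ⟨v, hv⟩ := (h.exact_zero c z).1 (Subsingleton.elim _ _)
    exact ⟨v, sub_eq_zero.2 hv.symm⟩
  | succ j =>
    obtain ⟨v, hv⟩ := (h.exact_succ j c z).1 hz
    exact ⟨v, sub_eq_zero.2 hv.symm⟩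

/-- The homology of `P` modulo `xᵢ` at `γ` is built from the kernel and cokernel of `xᵢ` on `M`:
surjectivity settles degree zero, injectivity settles degree one, and in higher degrees regularity
of `xᵢ` on `P` is enough. -/
theorem exactModVars_singleton [DecidableEq σ] (h : IsResolution P ε)
    (hP : ∀ j, Projective (P.X j)) {i : σ} {γ : Γ}
    (hM : Function.Bijective (M.map (ActCat.varHom (w := w) i γ)).hom) :
    ExactModVars P {i} (ActCat.of w γ) := by
  have hinj : ∀ {j} {y : (P.X j).obj (ActCat.of w (γ - w i))},
      ((P.X j).map (ActCat.varHom i γ)).hom y = 0 → y = 0 := by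
    intro j y hy
    have := mem_varSub_of_map_mem (W := ∅) (hP j) (Finset.notMem_empty i) (ActCat.varHom i γ)
      (ActCat.expo_varHom i γ) (y := y) (by rw [hy]; exact zero_mem _)
    simpa only [varSub_empty, Submodule.mem_bot] using this
  have hmem : ∀ {j} {v : (P.X j).obj (ActCat.of w (γ - w i))},
      ((P.X j).map (ActCat.varHom i γ)).hom v ∈ varSub {i} (P.X j) _ := fun {j v} =>
    map_mem_varSub (ActCat.varHom i γ)
      ⟨i, Finset.mem_singleton_self i, by rw [ActCat.expo_varHom]; simp⟩ v
  intro j z hz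
  cases j with
  | zero =>
    obtain ⟨m, hm⟩ := hM.2 ((ε.app _).hom z)
    obtain ⟨y, rfl⟩ := h.surjective _ m
    obtain ⟨v, hv⟩ := (h.exact_zero _ (z - ((P.X 0).map (ActCat.varHom i γ)).hom y)).1 (by
      rw [map_sub, naturality_hom_apply, hm, sub_self])
    refine ⟨v, ?_⟩
    rw [hv, sub_sub_cancel]
    exact hmem
  | succ j =>
    obtain ⟨y, s, hs, hys⟩ := mem_varSub_insert (W := ∅) hz
    rw [varSub_empty, Submodule.mem_bot] at hs
    rw [hs, add_zero] at hys
    have hys' : ((P.d (j + 1) j).app _).hom z = ((P.X j).map (ActCat.varHom i γ)).hom y := hys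
    obtain ⟨v, hv⟩ : ∃ v, ((P.d (j + 1) j).app _).hom v = y := by
      cases j with
      | zero =>
        refine (h.exact_zero _ y).1 (hM.1 ?_)
        rw [← naturality_hom_apply, ← hys', map_zero]
        exact (h.exact_zero _ _).2 ⟨z, rfl⟩
      | succ j =>
        refine (h.exact_succ j _ y).1 (hinj ?_)
        rw [← naturality_hom_apply, ← hys']
        exact d_d_apply P _ _ _ z
    obtain ⟨u, hu⟩ := (h.exact_succ j _ (z - ((P.X (j + 1)).map (ActCat.varHom i γ)).hom v)).1 (by
      rw [map_sub, naturality_hom_apply, hv, hys', sub_self])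
    refine ⟨u, ?_⟩
    rw [hu, sub_sub_cancel]
    exact hmem

/-- Adding a variable `xᵢ` to the quotient requires exactness both at the given degree and at the
degree lowered by `w i`. Unwinding the recursion, the degrees involved are `γ` minus sums over sets
of variables not yet killed, so the induction carries an arbitrary such set `τ`. -/
theorem exactModVars_univ [Fintype σ] [DecidableEq σ] (hP : ∀ j, Projective (P.X j))
    (W₀ : Finset σ) (γ : Γ)
    (h : ∀ τ : Finset σ, Disjoint τ W₀ → ExactModVars P W₀ (ActCat.of w (γ - ∑ i ∈ τ, w i))) :
    ExactModVars P Finset.univ (ActCat.of w γ) := by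
  suffices H : ∀ s τ : Finset σ, Disjoint τ (s ∪ W₀) →
      ExactModVars P (s ∪ W₀) (ActCat.of w (γ - ∑ i ∈ τ, w i)) by
    have := H Finset.univ ∅ (Finset.disjoint_empty_left _)
    rwa [Finset.sum_empty, sub_zero, Finset.union_eq_left.2 (Finset.subset_univ W₀)] at this
  intro s
  induction s using Finset.induction_on with
  | empty => simpa only [Finset.empty_union] using h
  | insert i s _ ih =>
    intro τ hτ
    by_cases hi : i ∈ s ∪ W₀
    · rw [Finset.insert_union, Finset.insert_eq_of_mem hi] at hτ ⊢
      exact ih τ hτ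
    · rw [Finset.insert_union] at hτ ⊢
      rw [Finset.disjoint_insert_right] at hτ
      refine ExactModVars.insert_var hP hi (ih τ hτ.2) ?_
      have := ih (insert i τ) (Finset.disjoint_insert_left.2 ⟨hi, hτ.2⟩)
      rwa [Finset.sum_insert hτ.1, add_comm, ← sub_sub] at this

end

variable [Field k] {P : ChainComplex (ActCat w ⥤ ModuleCat.{u} k) ℕ}
  {M : ActCat w ⥤ ModuleCat.{u} k} {ε : P.X 0 ⟶ M}

theorem IsMinimalProjectiveResolution.projective (h : IsMinimalProjectiveResolution P ε) (j : ℕ) :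
    Projective (P.X j) := by
  cases j with
  | zero => exact h.cover_zero.projective
  | succ j => exact (h.cover_succ j).projective

/-- Boundaries lie in the kernel of the next projective cover, hence in the radical. This makes the
splitting functor of the resolution the homology modulo all variables. -/
theorem IsMinimalProjectiveResolution.d_mem_jrad (h : IsMinimalProjectiveResolution P ε) (j : ℕ)
    {c : ActCat w} (v : (P.X (j + 1)).obj c) :
    ((P.d (j + 1) j).app c).hom v ∈ jrad (P.X j) c := by
  have hc : ∀ (b : ActCat w) (u v : b ⟶ c), IsIso u → IsIso v → u = v :=
    fun b u v => ActCat.eq_of_isIso u v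
  cases j with
  | zero =>
    refine h.cover_zero.ker_le_jrad c hc ?_
    exact (h.exact_zero c _).2 ⟨v, rfl⟩
  | succ j =>
    refine (h.cover_succ j).ker_le_jrad c hc ?_
    have h1 : P.d (j + 2) (j + 1) ≫ Limits.factorThruImage (P.d (j + 1) j) = 0 := by
      rw [← cancel_mono (Limits.image.ι (P.d (j + 1) j)), Category.assoc, Limits.image.fac,
        P.d_comp_d, Limits.zero_comp]
    exact congr_hom_apply h1 v

/-- The splitting functor vanishes on a minimal resolution that is exact modulo all variables. -/
theorem IsMinimalProjectiveResolution.subsingleton_spl [Fintype σ]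
    (h : IsMinimalProjectiveResolution P ε) {c : ActCat w}
    (hc : ExactModVars P Finset.univ c) (j : ℕ) : Subsingleton (spl (P.X j) c) := by
  rw [Submodule.Quotient.subsingleton_iff, eq_top_iff]
  intro z _
  -- Minimality makes every element a cycle modulo the variables; exactness then writes it as a
  -- boundary plus a radical element, and boundaries are again radical.
  obtain ⟨v, hv⟩ := hc j z (by
    rw [varSub_univ]
    cases j with
    | zero => rw [d_zero_apply]; exact zero_mem _
    | succ j => exact h.d_mem_jrad j z)
  rw [varSub_univ] at hv
  have := add_mem hv (h.d_mem_jrad j v)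
  rwa [sub_add_cancel] at this

end Vanishing

/-! ### Graded pieces of the semigroup ring -/

namespace SemigroupRing
variable {σ Γ Q : Type} [AddCommGroup Γ] [AddCommMonoid Q] {k : Type u} [Field k]
  {deg : Q →+ Γ} {a : σ → Q}

/-- The monomial `t^q` as an element of the module `k[Q]` over the action category. -/
noncomputable def monomAt (k : Type u) [Field k] (deg : Q →+ Γ) (a : σ → Q) {q : Q}
    {c : ActCat fun i => deg (a i)} (h : deg q = c.deg) : (toFunctor k deg a).obj c :=
  (⟨monom k a q, monom_mem_piece k deg a h⟩ : piece k deg a c.deg)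

theorem map_monomAt {q : Q} {c d : ActCat fun i => deg (a i)} (f : c ⟶ d) (h : deg q = c.deg) :
    ((toFunctor k deg a).map f).hom (monomAt k deg a h) =
      monomAt k deg a (q := Finsupp.weight a (ActCat.expo f) + q)
        (by rw [map_add, map_weight, h, ActCat.weight_expo]) := by
  refine Subtype.ext (p := (· ∈ piece k deg a d.deg)) ?_
  change MvPolynomial.monomial (ActCat.expo f) (1 : k) • monom k a q = _
  rw [smul_def, ofPolynomial_monomial, ← monom_add]
  rfl

theorem deg_eq_of_mem_piece {γ : Γ} {x : AddMonoidAlgebra k Q} (hx : x ∈ piece k deg a γ) {q : Q}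
    (hq : AddMonoidAlgebra.coeff x q ≠ 0) : deg q = γ :=
  (AddMonoidAlgebra.mem_gradeBy_iff k deg γ x).1 hx (Finsupp.mem_support_iff.2 hq)

theorem eq_zero_of_mem_piece {γ : Γ} (h : γ ∉ AddMonoidHom.mrange deg) {x : AddMonoidAlgebra k Q}
    (hx : x ∈ piece k deg a γ) : x = 0 := by
  refine AddMonoidAlgebra.coeff_injective (Finsupp.ext fun q => ?_)
  by_contra hq
  exact h ⟨q, deg_eq_of_mem_piece hx hq⟩

theorem eq_single_of_mem_piece (hdeg : Function.Injective deg) {q : Q} {x : AddMonoidAlgebra k Q}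
    (hx : x ∈ piece k deg a (deg q)) :
    x = AddMonoidAlgebra.single q (AddMonoidAlgebra.coeff x q) := by
  classical
  refine AddMonoidAlgebra.coeff_injective (Finsupp.ext fun p => ?_)
  rw [AddMonoidAlgebra.coeff_single, Finsupp.single_apply]
  split_ifs with h
  · rw [h]
  · by_contra hp
    exact h (hdeg (deg_eq_of_mem_piece hx hp)).symm

theorem subsingleton_obj {c : ActCat fun i => deg (a i)} (h : c.deg ∉ AddMonoidHom.mrange deg) :
    Subsingleton ((toFunctor k deg a).obj c) :=
  subsingleton_of_forall_eq 0 fun x =>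
    Subtype.ext (p := (· ∈ piece k deg a c.deg)) (eq_zero_of_mem_piece h x.2)

theorem smul_monom (x : k) (q : Q) :
    x • monom k a q = (AddMonoidAlgebra.single q x : AddMonoidAlgebra k Q) :=
  (AddMonoidAlgebra.smul_single x q (1 : k)).trans (by rw [smul_eq_mul, mul_one])

theorem bijective_smul_monomAt (hdeg : Function.Injective deg) {q : Q}
    {c : ActCat fun i => deg (a i)} (h : deg q = c.deg) :
    Function.Bijective fun x : k => x • monomAt k deg a h := by
  have hval : ∀ x : k, (x • monomAt k deg a h : (toFunctor k deg a).obj c).1 =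
      (AddMonoidAlgebra.single q x : AddMonoidAlgebra k Q) := fun x => smul_monom x q
  constructor
  · intro x y hxy
    have h1 := (hval x).symm.trans ((congrArg Subtype.val hxy).trans (hval y))
    exact Finsupp.single_injective q (congrArg AddMonoidAlgebra.coeff h1)
  · intro y
    have hy : (y.1 : AddMonoidAlgebra k Q) ∈ piece k deg a (deg q) := by rw [h]; exact y.2
    exact ⟨AddMonoidAlgebra.coeff (y.1 : AddMonoidAlgebra k Q) q,
      Subtype.ext (p := (· ∈ piece k deg a c.deg))
        ((hval _).trans (eq_single_of_mem_piece hdeg hy).symm)⟩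

/-- If the source degree lies in `Q`, so does the target degree; both pieces are then lines spanned
by monomials, and a monomial is sent to a monomial. -/
theorem bijective_map (hdeg : Function.Injective deg) {c d : ActCat fun i => deg (a i)} (f : c ⟶ d)
    (h : c.deg ∈ AddMonoidHom.mrange deg) :
    Function.Bijective ((toFunctor k deg a).map f).hom := by
  obtain ⟨q, hq⟩ := h
  have h1 := bijective_smul_monomAt (k := k) hdeg hq
  have h2 := bijective_smul_monomAt (k := k) (c := d) (q := Finsupp.weight a (ActCat.expo f) + q)
    hdeg (by rw [map_add, map_weight, hq, ActCat.weight_expo])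
  refine (Function.Bijective.of_comp_iff _ h1).1 ?_
  convert h2 using 1
  funext x
  rw [Function.comp_apply, map_smul, map_monomAt]

end SemigroupRing

/-! ### Finiteness of the Betti category -/

section BettiFinite
variable {σ Γ Q : Type} [AddCommGroup Γ] [AddCommMonoid Q] {k : Type u} [Field k]
  {deg : Q →+ Γ} {a : σ → Q}

/-- Whenever a product of variables different from `xᵢ` divides the element of degree `γ` in
`k[Q]`, so does its product with `xᵢ`. -/
def IsConeVertex (deg : Q →+ Γ) (a : σ → Q) (γ : Γ) (i : σ) : Prop :=
  ∀ τ : Finset σ, i ∉ τ → γ - ∑ j ∈ τ, deg (a j) ∈ AddMonoidHom.mrange deg →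
    γ - ∑ j ∈ τ, deg (a j) - deg (a i) ∈ AddMonoidHom.mrange deg

/-- The objects of the Betti category lie in `Q`, and their complexes of divisors are not cones. -/
theorem bettiObjects_le [Fintype σ] (hdeg : Function.Injective deg)
    {c : ActCat fun i => deg (a i)} (hc : bettiObjects (SemigroupRing.toFunctor k deg a) c) :
    c.deg ∈ AddMonoidHom.mrange deg ∧ ∀ i, ¬ IsConeVertex deg a c.deg i := by
  classical
  obtain ⟨P, ε, hP, j, hj⟩ := hc
  have key : ¬ ExactModVars P Finset.univ c := fun h =>
    not_subsingleton_iff_nontrivial.2 hj (hP.subsingleton_spl h j)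
  have hmem : ∀ {γ : Γ} {i : σ}, γ - deg (a i) ∈ AddMonoidHom.mrange deg →
      γ ∈ AddMonoidHom.mrange deg := fun {γ i} h => by
    have := add_mem h (⟨a i, rfl⟩ : deg (a i) ∈ AddMonoidHom.mrange deg)
    rwa [sub_add_cancel] at this
  constructor
  -- If `c.deg` is outside `Q`, then so is every degree obtained by subtracting generators. The
  -- module vanishes in all of them, and no variable has to be killed beforehand.
  · by_contra h
    refine key (exactModVars_univ hP.projective ∅ c.deg fun τ _ => ?_)
    have := SemigroupRing.subsingleton_obj (k := k) (a := a) (deg := deg)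
      (c := ActCat.of _ (c.deg - ∑ i ∈ τ, deg (a i))) (by
        intro h'
        rw [ActCat.deg_of] at h'
        have := add_mem h' (sum_mem (t := τ) fun i _ =>
          (⟨a i, rfl⟩ : deg (a i) ∈ AddMonoidHom.mrange deg))
        rw [sub_add_cancel] at this
        exact h this)
    exact exactModVars_empty hP.toIsResolution
  · intro i hi
    -- The variable of the cone vertex is killed first. In each remaining degree multiplication by
    -- it is either an isomorphism of lines or, by the cone condition, a map between zero modules.
    refine key (exactModVars_univ hP.projective {i} c.deg fun τ hτ => ?_)
    refine exactModVars_singleton hP.toIsResolution hP.projective ?_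
    by_cases h : c.deg - ∑ j ∈ τ, deg (a j) - deg (a i) ∈ AddMonoidHom.mrange deg
    · exact SemigroupRing.bijective_map hdeg _ h
    · have h1 := SemigroupRing.subsingleton_obj (k := k) (a := a) (deg := deg)
        (c := ActCat.of _ (c.deg - ∑ j ∈ τ, deg (a j) - deg (a i))) h
      have h2 := SemigroupRing.subsingleton_obj (k := k) (a := a) (deg := deg)
        (c := ActCat.of _ (c.deg - ∑ j ∈ τ, deg (a j)))
        fun h' => h (hi τ (Finset.disjoint_singleton_right.1 hτ) h')
      exact ⟨fun x y _ => Subsingleton.elim x y, fun y => ⟨0, Subsingleton.elim _ _⟩⟩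

/-- Among infinitely many degrees, Dickson's lemma yields a sequence with increasing exponent
vectors, and two of its members have the same complex of divisors because there are only finitely
many sets of subsets of `σ`. A variable whose exponent grows strictly between these two is a cone
vertex for the larger: any `τ` dividing it also divides the smaller, leaving room for the extra
variable. -/
theorem finite_setOf_not_isConeVertex [Finite σ] (ha : AddSubmonoid.closure (Set.range a) = ⊤) :
    {γ | γ ∈ AddMonoidHom.mrange deg ∧ ∀ i, ¬ IsConeVertex deg a γ i}.Finite := by
  classical
  by_contra hinf
  let f := Set.Infinite.natEmbedding _ hinf
  have hw : ∀ γ ∈ AddMonoidHom.mrange deg,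
      ∃ m : σ →₀ ℕ, Finsupp.weight (fun i => deg (a i)) m = γ := by
    rintro _ ⟨q, rfl⟩
    obtain ⟨m, hm⟩ := AddSubmonoid.exists_finsupp_of_mem_closure_range a q
      (ha ▸ AddSubmonoid.mem_top q)
    exact ⟨m, by rw [hm, ← SemigroupRing.map_weight, Finsupp.weight_apply]⟩
  choose m hm using fun t => hw (f t).1 (f t).2.1
  obtain ⟨g, hg⟩ := (wellQuasiOrdered_le (α := σ →₀ ℕ)).exists_monotone_subseq m
  let D : ℕ → Set (Finset σ) := fun t =>
    {τ | (f (g t)).1 - ∑ j ∈ τ, deg (a j) ∈ AddMonoidHom.mrange deg}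
  obtain ⟨s, t, hst, hD⟩ : ∃ s t, s < t ∧ D s = D t := by
    obtain ⟨s, t, hne, h⟩ := Finite.exists_ne_map_eq_of_infinite D
    rcases lt_or_gt_of_ne hne with h' | h'
    exacts [⟨s, t, h', h⟩, ⟨t, s, h', h.symm⟩]
  have hle : m (g s) ≤ m (g t) := hg s t hst.le
  have hne : m (g s) ≠ m (g t) := by
    intro h
    have h1 : (f (g s)).1 = (f (g t)).1 := by rw [← hm, ← hm, h]
    exact hst.ne (g.injective (f.injective (Subtype.ext h1)))
  obtain ⟨i, hi⟩ : ∃ i, m (g s) i < m (g t) i := by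
    by_contra! h
    exact hne (le_antisymm hle h)
  refine (f (g t)).2.2 i fun τ _ hτ => ?_
  have hτ' : τ ∈ D s := by rw [hD]; exact hτ
  -- The surplus left after one copy of the growing variable `i` has been set aside.
  let r := m (g t) - m (g s) - Finsupp.single i 1
  have hr : m (g t) = m (g s) + Finsupp.single i 1 + r := by
    ext j
    have hj := hle j
    simp only [r, Finsupp.add_apply, Finsupp.tsub_apply, Finsupp.single_apply]
    split_ifs with hij
    · subst hij; omega
    · omega
  have hft : (f (g t)).1 = (f (g s)).1 + deg (a i) + deg (Finsupp.weight a r) := by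
    rw [← hm, ← hm, hr, map_add, map_add, ActCat.weight_single, SemigroupRing.map_weight]
  have h1 := add_mem (show (f (g s)).1 - ∑ j ∈ τ, deg (a j) ∈ AddMonoidHom.mrange deg from hτ')
    (⟨Finsupp.weight a r, rfl⟩ : deg (Finsupp.weight a r) ∈ AddMonoidHom.mrange deg)
  rw [hft]
  convert h1 using 1
  abel

/-- The Betti category of a semigroup ring has finitely many objects. -/
theorem finite_bettiCategory [Fintype σ] (hdeg : Function.Injective deg)
    (ha : AddSubmonoid.closure (Set.range a) = ⊤) :
    Finite (BettiCategory (SemigroupRing.toFunctor k deg a)) := by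
  have := (finite_setOf_not_isConeVertex (deg := deg) ha).to_subtype
  refine Finite.of_injective (β := {γ | γ ∈ AddMonoidHom.mrange deg ∧
    ∀ i, ¬ IsConeVertex deg a γ i}) (fun c => ⟨c.obj.deg, bettiObjects_le hdeg c.property⟩) ?_
  intro c d h
  refine ObjectProperty.FullSubcategory.ext ?_
  have h' : c.obj.deg = d.obj.deg := congrArg Subtype.val h
  rw [← ActCat.of_deg c.obj, ← ActCat.of_deg d.obj, h']

end BettiFinite

/-! ### Projective covers from bases of the splitting functor -/

section Cover
variable {k : Type u} [Field k] {C : Type} [SmallCategory C]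

/-- The kernel of a homomorphism of modules over a category. -/
noncomputable def kernelFunctor {M N : C ⥤ ModuleCat.{u} k} (f : M ⟶ N) : C ⥤ ModuleCat.{u} k :=
  subFunctor M (fun c => LinearMap.ker (f.app c).hom) fun c d g x hx => by
    rw [Submodule.mem_comap, LinearMap.mem_ker, naturality_hom_apply, LinearMap.mem_ker.1 hx,
      map_zero]

/-- The inclusion of the kernel. -/
noncomputable def kernelFunctorι {M N : C ⥤ ModuleCat.{u} k} (f : M ⟶ N) : kernelFunctor f ⟶ M :=
  subFunctorι M _ _

instance {M N : C ⥤ ModuleCat.{u} k} (f : M ⟶ N) : Mono (kernelFunctorι f) :=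
  inferInstanceAs (Mono (subFunctorι M _ _))

theorem kernelFunctorι_comp {M N : C ⥤ ModuleCat.{u} k} (f : M ⟶ N) : kernelFunctorι f ≫ f = 0 := by
  ext c x
  exact x.2

theorem exact_kernelFunctorι {M N : C ⥤ ModuleCat.{u} k} (f : M ⟶ N) (c : C) :
    Function.Exact ((kernelFunctorι f).app c).hom (f.app c).hom := fun x =>
  ⟨fun hx => ⟨⟨x, hx⟩, rfl⟩, by rintro ⟨y, rfl⟩; exact y.2⟩

/-- The index type of a basis of the value of the splitting functor. -/
abbrev SplIndex (M : C ⥤ ModuleCat.{u} k) (c : C) : Type u :=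
  Module.Basis.ofVectorSpaceIndex k (spl M c)

/-- A basis of the value of the splitting functor. -/
noncomputable abbrev splBasis (M : C ⥤ ModuleCat.{u} k) (c : C) :
    Module.Basis (SplIndex M c) k (spl M c) :=
  Module.Basis.ofVectorSpace k (spl M c)

/-- A lift of a basis element of the splitting functor. -/
noncomputable def splLift (M : C ⥤ ModuleCat.{u} k) (c : C) (i : SplIndex M c) : M.obj c :=
  Quotient.out (splBasis M c i)

theorem mk_splLift (M : C ⥤ ModuleCat.{u} k) (c : C) (i : SplIndex M c) :
    Submodule.Quotient.mk (p := jrad M c) (splLift M c i) = splBasis M c i :=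
  Quotient.out_eq _

/-- The free module on bases of the values of the splitting functor. -/
noncomputable abbrev coverObj (M : C ⥤ ModuleCat.{u} k) : C ⥤ ModuleCat.{u} k :=
  freeModule k (SplIndex M)

/-- The canonical generators of the source of the cover. -/
noncomputable abbrev coverBasis (M : C ⥤ ModuleCat.{u} k) :
    FreeBasis (Σ c, SplIndex M c) (coverObj M) :=
  FreeBasis.ofFreeModule (SplIndex M)

/-- The homomorphism from a free module given by lifting bases of the values of the splitting
functor. -/
noncomputable def coverMap (M : C ⥤ ModuleCat.{u} k) : coverObj M ⟶ M :=
  (coverBasis M).desc fun p => splLift M p.1 p.2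

theorem coverMap_gen (M : C ⥤ ModuleCat.{u} k) (p : Σ c, SplIndex M c) :
    ((coverMap M).app p.1).hom ((coverBasis M).gen p) = splLift M p.1 p.2 :=
  (coverBasis M).desc_gen _ p

/-- Homomorphisms preserve the radical, and this generator maps to a lift of a nonzero basis vector
of `spl M`. Hence each generator witnesses that the splitting functor is nonzero at its object. -/
theorem gen_coverBasis_notMem_jrad (M : C ⥤ ModuleCat.{u} k) (p : Σ c, SplIndex M c) :
    (coverBasis M).gen p ∉ jrad (coverObj M) p.1 := by
  intro h
  have h1 := app_mem_jrad (coverMap M) h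
  rw [coverMap_gen, ← Submodule.Quotient.mk_eq_zero, mk_splLift] at h1
  exact (splBasis M p.1).ne_zero p.2 h1

theorem nontrivial_spl_coverObj (M : C ⥤ ModuleCat.{u} k) (p : Σ c, SplIndex M c) :
    Nontrivial (spl (coverObj M) p.1) :=
  ⟨Submodule.Quotient.mk ((coverBasis M).gen p), 0, fun h =>
    gen_coverBasis_notMem_jrad M p ((Submodule.Quotient.mk_eq_zero _).1 h)⟩

theorem exists_sub_coverMap_mem_jrad (M : C ⥤ ModuleCat.{u} k) {c : C} (x : M.obj c) :
    ∃ y, x - ((coverMap M).app c).hom y ∈ jrad M c := by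
  suffices h : (⊤ : Submodule k (spl M c)) ≤
      LinearMap.range ((jrad M c).mkQ ∘ₗ ((coverMap M).app c).hom) by
    obtain ⟨y, hy⟩ := h (Submodule.mem_top (x := Submodule.Quotient.mk x))
    exact ⟨y, (Submodule.Quotient.eq _).1 hy.symm⟩
  rw [← (splBasis M c).span_eq, Submodule.span_le]
  rintro _ ⟨i, rfl⟩
  refine ⟨(coverBasis M).gen ⟨c, i⟩, ?_⟩
  exact (congrArg (jrad M c).mkQ (coverMap_gen M ⟨c, i⟩)).trans (mk_splLift M c i)

/-- The map induced on splitting functors has a left inverse, sending each chosen basis vector to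
the class of its generator, so a kernel element has zero class. The condition on isomorphisms into
`c` rules out translates of generators from other objects isomorphic to `c`, which would be counted
twice. -/
theorem ker_coverMap_le_jrad (M : C ⥤ ModuleCat.{u} k) (c : C)
    (hc : ∀ (b : C) (u : b ⟶ c), IsIso u → ∃ h : b = c, u = eqToHom h) :
    LinearMap.ker ((coverMap M).app c).hom ≤ jrad (coverObj M) c := by
  let l : spl M c →ₗ[k] spl (coverObj M) c :=
    (splBasis M c).constr k fun i => Submodule.Quotient.mk ((coverBasis M).gen ⟨c, i⟩)
  have h : l ∘ₗ (jrad M c).mkQ ∘ₗ ((coverMap M).app c).hom = (jrad (coverObj M) c).mkQ := by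
    refine ((coverBasis M).basis c).ext fun ⟨p, u⟩ => ?_
    rw [← (coverBasis M).map_gen]
    by_cases hu : IsIso u
    · obtain ⟨h, rfl⟩ := hc _ u hu
      obtain ⟨b, i⟩ := p
      obtain rfl : b = c := h
      have h1 : ((coverObj M).map (𝟙 b)).hom ((coverBasis M).gen ⟨b, i⟩) =
        (coverBasis M).gen ⟨b, i⟩ := map_id_hom_apply _ _
      refine (congrArg (l ∘ₗ (jrad M b).mkQ ∘ₗ ((coverMap M).app b).hom) h1).trans
        (Eq.trans ?_ (congrArg (jrad (coverObj M) b).mkQ h1).symm)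
      refine (congrArg l ((congrArg (jrad M b).mkQ (coverMap_gen M ⟨b, i⟩)).trans
        (mk_splLift M b i))).trans ?_
      exact (splBasis M b).constr_basis k _ i
    · refine Eq.trans ?_ ((Submodule.Quotient.mk_eq_zero _).2 (map_mem_jrad _ u hu _)).symm
      refine (congrArg l ((Submodule.Quotient.mk_eq_zero _).2 ?_)).trans (map_zero l)
      exact app_mem_jrad (coverMap M) (map_mem_jrad _ u hu _)
  intro x hx
  refine (Submodule.Quotient.mk_eq_zero _).1 ((LinearMap.congr_fun h x).symm.trans ?_)
  refine (congrArg (fun y => l (Submodule.Quotient.mk y)) (LinearMap.mem_ker.1 hx)).trans ?_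
  exact (congrArg l (Submodule.Quotient.mk_zero _)).trans (map_zero l)

/-- An epimorphism followed by a monomorphism has the middle object as image, so the corestriction
is the given cover up to isomorphism. -/
theorem IsProjectiveCover.factorThruImage {P N L : C ⥤ ModuleCat.{u} k} {p : P ⟶ N}
    (hp : IsProjectiveCover p) (i : N ⟶ L) [Mono i] :
    IsProjectiveCover (Limits.factorThruImage (p ≫ i)) := by
  have := hp.epi
  have : StrongEpi p := strongEpi_of_epi p
  let e := Limits.image.isoStrongEpiMono p i rfl
  have he : p ≫ e.hom = Limits.factorThruImage (p ≫ i) := by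
    rw [← cancel_mono (Limits.image.ι (p ≫ i)), Category.assoc,
      Limits.image.isoStrongEpiMono_hom_comp_ι, Limits.image.fac]
  rw [← he]
  refine ⟨hp.projective, inferInstance, fun K g => ?_⟩
  rw [hp.superfluous g, ← Category.assoc]
  exact ⟨fun _ => inferInstance, fun h => by
    have : (g ≫ p) = ((g ≫ p) ≫ e.hom) ≫ e.inv := by simp
    rw [this]
    infer_instance⟩

end Cover

/-! ### Graded Nakayama lemma and existence of minimal resolutions -/

section Nakayama
variable {σ Γ : Type} [AddCommGroup Γ] {w : σ → Γ} (s : Γ →+ ℤ) (hs : ∀ i, 0 < s (w i))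
  {k : Type u} [Field k]

include hs in
-- A non-isomorphism has nonzero exponent, and each variable in it adds a positive amount. This
-- makes induction on degree possible.
theorem size_lt_of_not_isIso {b c : ActCat w} (f : b ⟶ c) (hf : ¬ IsIso f) :
    s b.deg < s c.deg := by
  rw [ActCat.isIso_iff] at hf
  rw [← ActCat.weight_expo f, map_add, lt_add_iff_pos_left, Finsupp.weight_apply, Finsupp.sum,
    map_sum]
  refine Finset.sum_pos (fun i hi => ?_) (Finsupp.support_nonempty_iff.2 hf)
  rw [map_nsmul]
  exact nsmul_pos (hs i) (Finsupp.mem_support_iff.1 hi)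

include hs in
theorem size_le {b c : ActCat w} (f : b ⟶ c) : s b.deg ≤ s c.deg := by
  by_cases hf : IsIso f
  · have h := ActCat.weight_expo f
    rw [(ActCat.isIso_iff f).1 hf, map_zero, zero_add] at h
    rw [h]
  · exact (size_lt_of_not_isIso s hs f hf).le

/-- The module `M` vanishes in negative degrees. -/
def IsBoundedBelow (M : ActCat w ⥤ ModuleCat.{u} k) : Prop :=
  ∀ c : ActCat w, s c.deg < 0 → Subsingleton (M.obj c)

variable {s}

include hs in
/-- Nakayama's lemma. -/
theorem surjective_of_sub_mem_jrad {L M : ActCat w ⥤ ModuleCat.{u} k} (hM : IsBoundedBelow s M)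
    (f : L ⟶ M) (hf : ∀ c (x : M.obj c), ∃ y, x - (f.app c).hom y ∈ jrad M c) (c : ActCat w) :
    Function.Surjective (f.app c).hom := by
  -- Induction on an upper bound for the size; bound zero means negative size, where `M` vanishes.
  suffices h : ∀ (n : ℕ) (c : ActCat w), s c.deg < n → Function.Surjective (f.app c).hom by
    refine h ((s c.deg).toNat + 1) c ?_
    push_cast
    have := Int.self_le_toNat (s c.deg)
    omega
  intro n
  induction n with
  | zero =>
    intro c hc x
    have := hM c hc
    exact ⟨0, Subsingleton.elim _ _⟩
  | succ n ih =>
    intro c hc x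
    obtain ⟨y, hy⟩ := hf c x
    -- Radical elements come from objects of strictly smaller size, where surjectivity is already
    -- known.
    have hle : jrad M c ≤ LinearMap.range (f.app c).hom := by
      refine jrad_le fun b u hu m => ?_
      have hlt := size_lt_of_not_isIso s hs u hu
      obtain ⟨z, rfl⟩ := ih b (by push_cast at hc; omega) m
      exact ⟨(L.map u).hom z, naturality_hom_apply f u z⟩
    obtain ⟨z, hz⟩ := hle hy
    exact ⟨z + y, by rw [map_add, hz, sub_add_cancel]⟩

theorem ActCat.exists_eq_eqToHom {b c : ActCat w} (u : b ⟶ c) (hu : IsIso u) :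
    ∃ h : b = c, u = eqToHom h := by
  have h0 := (ActCat.isIso_iff u).1 hu
  have h := ActCat.weight_expo u
  rw [h0, map_zero, zero_add] at h
  obtain rfl : b = c := by rw [← ActCat.of_deg b, ← ActCat.of_deg c, h]
  exact ⟨rfl, ActCat.hom_ext h0⟩

include hs in
theorem coverMap_surjective {M : ActCat w ⥤ ModuleCat.{u} k} (hM : IsBoundedBelow s M)
    (c : ActCat w) : Function.Surjective ((coverMap M).app c).hom :=
  surjective_of_sub_mem_jrad hs hM _ (fun _ x => exists_sub_coverMap_mem_jrad M x) c

include hs in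
-- A generator contributing at `c` lives at an object of no larger size, so there are none when that
-- size is negative.
theorem coverObj_isBoundedBelow {M : ActCat w ⥤ ModuleCat.{u} k} (hM : IsBoundedBelow s M) :
    IsBoundedBelow s (coverObj M) := by
  intro c hc
  have : IsEmpty (Σ p, (coverBasis M).obj p ⟶ c) := by
    refine ⟨fun ⟨⟨b, i⟩, u⟩ => ?_⟩
    have := hM b ((size_le s hs (show b ⟶ c from u)).trans_lt hc)
    exact (splBasis M b).ne_zero i (Subsingleton.elim _ _)
  have h : Subsingleton ((Σ p, (coverBasis M).obj p ⟶ c) →₀ k) := inferInstance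
  exact ((coverBasis M).basis c).repr.toEquiv.injective.subsingleton

include hs in
/-- A module that vanishes in negative degrees has a projective cover. -/
theorem coverMap_isProjectiveCover {M : ActCat w ⥤ ModuleCat.{u} k} (hM : IsBoundedBelow s M) :
    IsProjectiveCover (coverMap M) where
  projective := (coverBasis M).projective
  epi := FreeBasis.epi_of_surjective _ (coverMap_surjective hs hM)
  superfluous K g := by
    have hepi : Epi (coverMap M) := FreeBasis.epi_of_surjective _ (coverMap_surjective hs hM)
    refine ⟨fun _ => epi_comp _ _, fun hg => ?_⟩
    refine FreeBasis.epi_of_surjective _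
      (surjective_of_sub_mem_jrad hs (coverObj_isBoundedBelow hs hM) g fun c x => ?_)
    -- If `g` followed by the cover is onto, then `g` is onto up to the kernel of the cover, hence
    -- up to the radical, and Nakayama's lemma applies to `g`.
    obtain ⟨y, hy⟩ := FreeBasis.surjective_of_epi (g ≫ coverMap M) c (((coverMap M).app c).hom x)
    have hy' : ((coverMap M).app c).hom ((g.app c).hom y) = ((coverMap M).app c).hom x := hy
    refine ⟨y, ker_coverMap_le_jrad M c (fun b u hu => ActCat.exists_eq_eqToHom u hu) ?_⟩
    rw [LinearMap.mem_ker, map_sub, hy', sub_self]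

/-- The iterated kernels of projective covers. -/
noncomputable def syzygy (M : ActCat w ⥤ ModuleCat.{u} k) : ℕ → (ActCat w ⥤ ModuleCat.{u} k)
  | 0 => M
  | n + 1 => kernelFunctor (coverMap (syzygy M n))

include hs in
theorem syzygy_isBoundedBelow {M : ActCat w ⥤ ModuleCat.{u} k} (hM : IsBoundedBelow s M) (n : ℕ) :
    IsBoundedBelow s (syzygy M n) := by
  induction n with
  | zero => exact hM
  | succ n ih =>
    intro c hc
    have := coverObj_isBoundedBelow hs ih c hc
    exact (Subtype.val_injective : Function.Injective
      fun x : LinearMap.ker ((coverMap (syzygy M n)).app c).hom => x.1).subsingleton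

/-- The inclusion of a syzygy module. -/
noncomputable def syzygyι (M : ActCat w ⥤ ModuleCat.{u} k) (n : ℕ) :
    syzygy M (n + 1) ⟶ coverObj (syzygy M n) :=
  kernelFunctorι (coverMap (syzygy M n))

instance (M : ActCat w ⥤ ModuleCat.{u} k) (n : ℕ) : Mono (syzygyι M n) :=
  inferInstanceAs (Mono (kernelFunctorι (coverMap (syzygy M n))))

theorem syzygyι_comp (M : ActCat w ⥤ ModuleCat.{u} k) (n : ℕ) :
    syzygyι M n ≫ coverMap (syzygy M n) = 0 :=
  kernelFunctorι_comp _

theorem syzygyι_injective (M : ActCat w ⥤ ModuleCat.{u} k) (n : ℕ) (c : ActCat w) :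
    Function.Injective ((syzygyι M n).app c).hom :=
  fun _ _ h => Subtype.ext h

theorem exact_syzygyι (M : ActCat w ⥤ ModuleCat.{u} k) (n : ℕ) (c : ActCat w) :
    Function.Exact ((syzygyι M n).app c).hom ((coverMap (syzygy M n)).app c).hom :=
  exact_kernelFunctorι _ c

/-- The differential of the minimal free resolution. -/
noncomputable def minimalD (M : ActCat w ⥤ ModuleCat.{u} k) (n : ℕ) :
    coverObj (syzygy M (n + 1)) ⟶ coverObj (syzygy M n) :=
  coverMap (syzygy M (n + 1)) ≫ syzygyι M n

theorem minimalD_comp (M : ActCat w ⥤ ModuleCat.{u} k) (n : ℕ) :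
    minimalD M (n + 1) ≫ minimalD M n = 0 := by
  rw [minimalD, minimalD, Category.assoc, ← Category.assoc (syzygyι M (n + 1)), syzygyι_comp,
    Limits.zero_comp, Limits.comp_zero]

/-- The minimal free resolution. -/
noncomputable def minimalResolution (M : ActCat w ⥤ ModuleCat.{u} k) :
    ChainComplex (ActCat w ⥤ ModuleCat.{u} k) ℕ :=
  ChainComplex.of (fun n => coverObj (syzygy M n)) (minimalD M) (minimalD_comp M)

theorem minimalResolution_d (M : ActCat w ⥤ ModuleCat.{u} k) (n : ℕ) :
    (minimalResolution M).d (n + 1) n = minimalD M n :=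
  ChainComplex.of_d (fun n => coverObj (syzygy M n)) (minimalD M) n

theorem exact_surjective_comp {M N L K : ActCat w ⥤ ModuleCat.{u} k} {p : K ⟶ M} {f : M ⟶ N}
    {g : N ⟶ L} {c : ActCat w} (hp : Function.Surjective (p.app c).hom)
    (h : Function.Exact (f.app c).hom (g.app c).hom) :
    Function.Exact ((p ≫ f).app c).hom (g.app c).hom := fun x => by
  rw [h x]
  constructor
  · rintro ⟨y, rfl⟩
    obtain ⟨z, rfl⟩ := hp y
    exact ⟨z, rfl⟩
  · rintro ⟨z, rfl⟩
    exact ⟨_, rfl⟩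

include hs in
/-- Modules that vanish in negative degrees have minimal projective resolutions. -/
theorem minimalResolution_isMinimal {M : ActCat w ⥤ ModuleCat.{u} k} (hM : IsBoundedBelow s M) :
    IsMinimalProjectiveResolution (minimalResolution M) (M := M) (coverMap M) where
  surjective := coverMap_surjective hs hM
  exact_zero c := by
    rw [minimalResolution_d]
    exact exact_surjective_comp (coverMap_surjective hs (syzygy_isBoundedBelow hs hM 1) c)
      (exact_syzygyι M 0 c)
  exact_succ n c := by
    rw [minimalResolution_d, minimalResolution_d]
    have h := exact_surjective_comp (coverMap_surjective hs (syzygy_isBoundedBelow hs hM (n + 2)) c)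
      (exact_syzygyι M (n + 1) c)
    exact fun x => Iff.trans (map_eq_zero_iff _ (syzygyι_injective M n c)) (h x)
  cover_zero := coverMap_isProjectiveCover hs hM
  cover_succ n := by
    rw [minimalResolution_d]
    exact (coverMap_isProjectiveCover hs (syzygy_isBoundedBelow hs hM (n + 1))).factorThruImage
      (syzygyι M n)

include hs in
-- Each generator of the constructed minimal resolution gives a nonzero class in the splitting
-- functor, so its object is a Betti object by definition. This is why the resolution is induced
-- from the Betti category.
theorem bettiObjects_of_splIndex {M : ActCat w ⥤ ModuleCat.{u} k} (hM : IsBoundedBelow s M) (n : ℕ)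
    (p : Σ c, SplIndex (syzygy M n) c) : bettiObjects M p.1 :=
  ⟨minimalResolution M, coverMap M, minimalResolution_isMinimal hs hM, n,
    nontrivial_spl_coverObj (syzygy M n) p⟩

end Nakayama

/-! ### From modules over the action category to graded modules -/

theorem exact_lmap {R ι : Type*} [Ring R] {L M N : ι → Type*}
    [∀ i, AddCommGroup (L i)] [∀ i, Module R (L i)] [∀ i, AddCommGroup (M i)]
    [∀ i, Module R (M i)] [∀ i, AddCommGroup (N i)] [∀ i, Module R (N i)]
    (f : ∀ i, L i →ₗ[R] M i) (g : ∀ i, M i →ₗ[R] N i)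
    (h : ∀ i, Function.Exact (f i) (g i)) :
    Function.Exact (DirectSum.lmap f) (DirectSum.lmap g) := by
  rw [LinearMap.exact_iff, DirectSum.lmap, DirectSum.lmap, DFinsupp.ker_mapRangeLinearMap,
    DFinsupp.range_mapRangeLinearMap]
  simp only [fun i => LinearMap.exact_iff.1 (h i)]

section Total
open scoped DirectSum
variable {σ Γ : Type} [AddCommGroup Γ] [DecidableEq Γ] {k : Type u} [CommRing k] {w : σ → Γ}

namespace TotalSum

theorem incl_injective (M : ActCat w ⥤ ModuleCat.{u} k) (γ : Γ) :
    Function.Injective (incl M γ) :=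
  DirectSum.of_injective (β := fun γ => M.obj (ActCat.of w γ)) γ

/-- The component of degree `γ` of a functor is the component of degree `γ` of its total module. -/
noncomputable def pieceEquiv (M : ActCat w ⥤ ModuleCat.{u} k) (γ : Γ) :
    M.obj (ActCat.of w γ) ≃+ piece M γ :=
  (LinearEquiv.ofInjective (incl M γ) (incl_injective M γ)).toAddEquiv

theorem isInternal_piece (M : ActCat w ⥤ ModuleCat.{u} k) :
    DirectSum.IsInternal (piece M) := by
  let φ : (⨁ γ, M.obj (ActCat.of w γ)) ≃+ ⨁ γ, piece M γ :=
    DFinsupp.mapRange.addEquiv fun γ => pieceEquiv M γ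
  have h : (DirectSum.coeAddMonoidHom (piece M)).comp φ.toAddMonoidHom =
      AddMonoidHom.id (⨁ γ, M.obj (ActCat.of w γ)) := by
    refine DirectSum.addHom_ext fun γ x => ?_
    have h1 : φ (DirectSum.of (fun γ => M.obj (ActCat.of w γ)) γ x) =
        DirectSum.of (fun γ => piece M γ) γ (pieceEquiv M γ x) :=
      DFinsupp.mapRange_single (hf := fun γ => map_zero (pieceEquiv M γ))
    refine (congrArg (DirectSum.coeAddMonoidHom (piece M)) h1).trans ?_
    exact DirectSum.coeAddMonoidHom_of (piece M) γ _
  refine ⟨fun x y hxy => ?_, fun y => ⟨φ y, DFunLike.congr_fun h y⟩⟩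
  obtain ⟨x, rfl⟩ := φ.surjective x
  obtain ⟨y, rfl⟩ := φ.surjective y
  exact congrArg φ ((DFunLike.congr_fun h x).symm.trans (hxy.trans (DFunLike.congr_fun h y)))

theorem smul_incl_mem_piece (M : ActCat w ⥤ ModuleCat.{u} k) {γ δ : Γ} {p : MvPolynomial σ k}
    (hp : p ∈ MvPolynomial.weightedHomogeneousSubmodule k w γ) {x : TotalSum M}
    (hx : x ∈ piece M δ) : p • x ∈ piece M (γ + δ) := by
  obtain ⟨y, rfl⟩ := hx
  rw [p.as_sum, Finset.sum_smul]
  refine sum_mem fun m hm => ?_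
  obtain rfl : Finsupp.weight w m = γ := hp (MvPolynomial.mem_support_iff.1 hm)
  rw [monomial_smul, monomialAct_incl M m (ActCat.homMk (d := ActCat.of w (Finsupp.weight w m + δ))
    m rfl) rfl, ← map_smul]
  exact ⟨_, rfl⟩

theorem isGradedModule (M : ActCat w ⥤ ModuleCat.{u} k) :
    IsGradedModule w ((totalFunctor k w).obj M) (piece M) where
  isInternal := isInternal_piece M
  smul_mem _ _ _ _ hp hx := smul_incl_mem_piece M hp hx

theorem map_mem_piece {M N : ActCat w ⥤ ModuleCat.{u} k} (f : M ⟶ N) {γ : Γ} {x : TotalSum M}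
    (hx : x ∈ piece M γ) : map f x ∈ piece N γ := by
  obtain ⟨y, rfl⟩ := hx
  exact ⟨(f.app _).hom y, (mapLinear_incl f γ y).symm⟩

theorem mapLinear_eq_lmap {M N : ActCat w ⥤ ModuleCat.{u} k} (f : M ⟶ N) :
    mapLinear f = DirectSum.lmap (M := fun γ => M.obj (ActCat.of w γ))
      (N := fun γ => N.obj (ActCat.of w γ)) fun γ => (f.app (ActCat.of w γ)).hom :=
  hom_ext M fun γ x => (mapLinear_incl f γ x).trans
    (DirectSum.lmap_lof (M := fun γ => M.obj (ActCat.of w γ)) (N := fun γ => N.obj (ActCat.of w γ))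
      (fun γ => (f.app (ActCat.of w γ)).hom) γ x).symm

theorem map_surjective {M N : ActCat w ⥤ ModuleCat.{u} k} (f : M ⟶ N)
    (h : ∀ c, Function.Surjective (f.app c).hom) : Function.Surjective (map f) := by
  have h1 := (DirectSum.lmap_surjective (M := fun γ => M.obj (ActCat.of w γ))
    (N := fun γ => N.obj (ActCat.of w γ)) fun γ => (f.app (ActCat.of w γ)).hom).2 fun γ => h _
  intro y
  obtain ⟨x, hx⟩ := h1 y
  exact ⟨x, (LinearMap.congr_fun (mapLinear_eq_lmap f) x).trans hx⟩

theorem map_exact {L M N : ActCat w ⥤ ModuleCat.{u} k} (f : L ⟶ M) (g : M ⟶ N)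
    (h : ∀ c, Function.Exact (f.app c).hom (g.app c).hom) : Function.Exact (map f) (map g) := by
  have h1 := exact_lmap (L := fun γ => L.obj (ActCat.of w γ))
    (M := fun γ => M.obj (ActCat.of w γ)) (N := fun γ => N.obj (ActCat.of w γ))
    (fun γ => (f.app (ActCat.of w γ)).hom) (fun γ => (g.app (ActCat.of w γ)).hom) fun γ => h _
  intro x
  refine Iff.trans (b := DirectSum.lmap (M := fun γ => M.obj (ActCat.of w γ))
      (N := fun γ => N.obj (ActCat.of w γ)) (fun γ => (g.app (ActCat.of w γ)).hom) x = 0) ?_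
    ((h1 x).trans ?_)
  · exact iff_of_eq (congrArg (· = 0) (LinearMap.congr_fun (mapLinear_eq_lmap g) x))
  · exact exists_congr fun y =>
      iff_of_eq (congrArg (· = x) (LinearMap.congr_fun (mapLinear_eq_lmap f) y).symm)

end TotalSum

namespace FreeBasis
universe v
variable {ι : Type v} {F : ActCat w ⥤ ModuleCat.{u} k} (β : FreeBasis ι F)

/-- A generator as a homogeneous element of the total module. -/
noncomputable def totalGen (i : ι) : TotalSum F := TotalSum.incl F (β.obj i).deg (β.gen i)

theorem totalGen_mem_piece (i : ι) : β.totalGen i ∈ TotalSum.piece F (β.obj i).deg :=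
  ⟨_, rfl⟩

theorem monomial_smul_totalGen (m : σ →₀ ℕ) (i : ι) {γ : Γ} (v : β.obj i ⟶ ActCat.of w γ)
    (hv : ActCat.expo v = m) : MvPolynomial.monomial m (1 : k) • β.totalGen i =
      TotalSum.incl F γ (β.basis _ ⟨i, v⟩) := by
  rw [TotalSum.monomial_smul, one_smul, ← β.map_gen]
  exact TotalSum.monomialAct_incl F m (γ := (β.obj i).deg) v hv (β.gen i)

/-- The coefficients of an element of the total module with respect to the generators. -/
noncomputable def totalRepr : TotalSum F →ₗ[k] (ι →₀ MvPolynomial σ k) :=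
  TotalSum.desc F fun γ => (β.basis (ActCat.of w γ)).constr k fun p =>
    Finsupp.single p.1 (MvPolynomial.monomial (ActCat.expo p.2) 1)

theorem totalRepr_incl (γ : Γ) (i : ι) (v : β.obj i ⟶ ActCat.of w γ) :
    β.totalRepr (TotalSum.incl F γ (β.basis _ ⟨i, v⟩)) =
      Finsupp.single i (MvPolynomial.monomial (ActCat.expo v) 1) :=
  (TotalSum.desc_incl F _ γ _).trans ((β.basis _).constr_basis k _ _)

/-- The generators form a basis of the total module over the polynomial ring. -/
noncomputable def totalBasis : Module.Basis ι (MvPolynomial σ k) (TotalSum F) := by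
  -- A morphism out of a fixed object is determined by its exponent, and every exponent occurs with
  -- exactly one target. Monomial multiples of generators therefore match the `k`-bases of
  -- translates, and `totalRepr` is the inverse of `Φ`.
  let Φ : (ι →₀ MvPolynomial σ k) →ₗ[MvPolynomial σ k] TotalSum F :=
    Finsupp.linearCombination (MvPolynomial σ k) β.totalGen
  have hΦ : ∀ i p, Φ (Finsupp.single i p) = p • β.totalGen i := fun i p =>
    Finsupp.linearCombination_single _ _ _
  have h1 : Φ.restrictScalars k ∘ₗ β.totalRepr = LinearMap.id := by
    refine TotalSum.hom_ext F fun γ x => ?_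
    refine LinearMap.congr_fun (f := (Φ.restrictScalars k ∘ₗ β.totalRepr) ∘ₗ TotalSum.incl F γ)
      (g := TotalSum.incl F γ) ((β.basis _).ext fun ⟨i, v⟩ => ?_) x
    refine (congrArg Φ (β.totalRepr_incl γ i v)).trans ((hΦ _ _).trans ?_)
    exact β.monomial_smul_totalGen _ i v rfl
  have h2 : β.totalRepr ∘ₗ Φ.restrictScalars k = LinearMap.id := by
    refine Finsupp.lhom_ext fun i p => ?_
    induction p using MvPolynomial.induction_on' with
    | add p q hp hq => rw [Finsupp.single_add, map_add, map_add, hp, hq]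
    | monomial m a =>
      let v : β.obj i ⟶ ActCat.of w (Finsupp.weight w m + (β.obj i).deg) := ActCat.homMk m rfl
      have h3 : Φ (Finsupp.single i (MvPolynomial.monomial m a)) =
          a • TotalSum.incl F _ (β.basis _ ⟨i, v⟩) := by
        rw [hΦ, ← β.monomial_smul_totalGen m i v rfl, ← smul_assoc, MvPolynomial.smul_monomial,
          smul_eq_mul, mul_one]
      refine (congrArg β.totalRepr h3).trans ?_
      rw [map_smul, totalRepr_incl, Finsupp.smul_single, MvPolynomial.smul_monomial, smul_eq_mul,
        mul_one]
      rfl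
  exact .ofRepr (LinearEquiv.symm
    { Φ with
      invFun := β.totalRepr
      left_inv := fun x => LinearMap.congr_fun h2 x
      right_inv := fun x => LinearMap.congr_fun h1 x })

theorem totalBasis_apply (i : ι) : β.totalBasis i = β.totalGen i :=
  (Finsupp.linearCombination_single _ _ _).trans (one_smul _ _)

include β in
theorem exists_basis_of_finite [Finite ι] :
    ∃ (s : ℕ) (b : Module.Basis (Fin s) (MvPolynomial σ k) (TotalSum F)),
      ∀ i, ∃ γ, b i ∈ TotalSum.piece F γ := by
  obtain ⟨s, ⟨f⟩⟩ := Finite.exists_equiv_fin ι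
  refine ⟨s, β.totalBasis.reindex f, fun i => ⟨(β.obj (f.symm i)).deg, ?_⟩⟩
  rw [Module.Basis.reindex_apply, totalBasis_apply]
  exact β.totalGen_mem_piece _

include β in
theorem subsingleton_totalSum [IsEmpty ι] : Subsingleton (TotalSum F) :=
  β.totalBasis.repr.toEquiv.injective.subsingleton

end FreeBasis
end Total

/-! ### The graded resolution of the semigroup ring -/

section TotalResolution
variable {σ Γ Q : Type} [AddCommGroup Γ] [DecidableEq Γ] [AddCommMonoid Q] {k : Type u}
  [CommRing k] {deg : Q →+ Γ} {a : σ → Q}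

namespace SemigroupRing

theorem isInternal_piece : DirectSum.IsInternal (piece k deg a) :=
  AddMonoidAlgebra.gradeBy.isInternal (R := k) deg

theorem isGradedModule :
    IsGradedModule (fun i => deg (a i)) (ModuleCat.of (MvPolynomial σ k) (SemigroupRing k a))
      fun γ => (piece k deg a γ).toAddSubgroup where
  isInternal := isInternal_piece (k := k) (deg := deg) (a := a)
  smul_mem γ δ p x hp hx := by
    suffices h : p • (x : SemigroupRing k a) ∈ piece k deg a (γ + δ) from h
    rw [p.as_sum, Finset.sum_smul]
    refine sum_mem fun m hm => ?_
    have hw : Finsupp.weight (fun i => deg (a i)) m = γ := hp (MvPolynomial.mem_support_iff.1 hm)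
    have h1 : MvPolynomial.monomial m (MvPolynomial.coeff m p) =
        MvPolynomial.coeff m p • MvPolynomial.monomial m (1 : k) := by
      rw [MvPolynomial.smul_monomial, smul_eq_mul, mul_one]
    rw [h1, smul_assoc]
    exact Submodule.smul_mem _ _ (monomial_smul_mem k deg a m (by rw [hw]) hx)

/-- The total module is by construction the direct sum of the graded pieces, so this is the internal
direct sum decomposition. -/
theorem assembleLinear_bijective : Function.Bijective (assembleLinear k deg a) :=
  isInternal_piece (k := k) (deg := deg) (a := a)

theorem assembleLinear_mem_piece {γ : Γ} {x : TotalSum (toFunctor k deg a)}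
    (hx : x ∈ TotalSum.piece (toFunctor k deg a) γ) : assembleLinear k deg a x ∈ piece k deg a γ := by
  obtain ⟨y, rfl⟩ := hx
  have h := assembleLinear_incl k deg a γ y
  rw [h]
  exact y.2

end SemigroupRing

/-- The total complex of a resolution of `k[Q]` by modules with finitely many free generators is a
finite free graded resolution. -/
theorem IsResolution.isFiniteFreeGradedResolution
    {P : ChainComplex (ActCat (fun i => deg (a i)) ⥤ ModuleCat.{u} k) ℕ}
    {ε : P.X 0 ⟶ SemigroupRing.toFunctor k deg a} (hP : IsResolution P ε) {ι : ℕ → Type}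
    (hι : ∀ n, Finite (ι n)) (β : ∀ n, FreeBasis (ι n) (P.X n)) {l : ℕ}
    (hl : ∀ n, l < n → IsEmpty (ι n)) :
    IsFiniteFreeGradedResolution (fun i => deg (a i)) (totalComplex (fun i => deg (a i)) P)
      (fun n => TotalSum.piece (P.X n)) (fun γ => (SemigroupRing.piece k deg a γ).toAddSubgroup)
      ((totalFunctor k fun i => deg (a i)).map ε ≫ SemigroupRing.assemble k deg a) where
  graded n := TotalSum.isGradedModule (P.X n)
  graded_target := SemigroupRing.isGradedModule
  map_d i j γ x hx := TotalSum.map_mem_piece (P.d i j) hx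
  map_aug γ x hx := SemigroupRing.assembleLinear_mem_piece (TotalSum.map_mem_piece ε hx)
  finite_free n := (β n).exists_basis_of_finite
  finite_length := ⟨l, fun n hn => by
    have := hl n hn
    exact (β n).subsingleton_totalSum⟩
  surjective := SemigroupRing.assembleLinear_bijective.surjective.comp
    (TotalSum.map_surjective ε hP.surjective)
  exact_zero x := Iff.trans
    (map_eq_zero_iff (SemigroupRing.assembleLinear k deg a)
      SemigroupRing.assembleLinear_bijective.injective)
    (TotalSum.map_exact (P.d 1 0) ε hP.exact_zero x)
  exact_succ n := TotalSum.map_exact (P.d (n + 2) (n + 1)) (P.d (n + 1) n) (hP.exact_succ n)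

end TotalResolution

/-! ### Finiteness and boundedness of nondegenerate simplices -/

section Simplices
variable {C : Type} [SmallCategory C]

/-- A functor out of a finite chain is determined by its arrows, one for each pair of comparable
vertices. -/
theorem finite_composableArrows [Finite C] (hC : ∀ b c : C, Finite (b ⟶ c)) (n : ℕ) :
    Finite (ComposableArrows C n) := by
  refine Finite.of_injective
    (fun (s : ComposableArrows C n) (p : {p : Fin (n + 1) × Fin (n + 1) // p.1 ≤ p.2}) =>
      (⟨s.obj p.1.1, s.obj p.1.2, s.map (homOfLE p.2)⟩ : Σ b c : C, (b ⟶ c))) ?_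
  intro s t h
  have h' : ∀ {i j : Fin (n + 1)} (f : i ⟶ j), (⟨s.obj i, s.obj j, s.map f⟩ : Σ b c : C, (b ⟶ c)) =
      ⟨t.obj i, t.obj j, t.map f⟩ := fun {i j} f => congrFun h ⟨(i, j), leOfHom f⟩
  refine Functor.hext (fun i => congrArg Sigma.fst (h' (𝟙 i))) fun i j f => ?_
  have := h' f
  generalize s.map f = x at this ⊢
  generalize t.map f = y at this ⊢
  generalize s.obj i = b, s.obj j = c at *
  generalize t.obj i = b', t.obj j = c' at *
  cases this
  rfl

/-- A simplex of the nerve is degenerate if one of its edges is an identity. -/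
theorem isDegenerate_of_map_eq {n : ℕ} (s : ComposableArrows C (n + 1)) (i : Fin (n + 1))
    (h : s.obj i.castSucc = s.obj i.succ)
    (hs : s.map (homOfLE (Fin.castSucc_lt_succ (i := i)).le) = eqToHom h) : IsDegenerate s := by
  -- The composite of the degeneracy `σ i` with the face `δ (i + 1)`: it moves vertex `i + 1` to `i`
  -- and fixes the rest. As the edge between these vertices is an identity, reindexing along `θ`
  -- returns `s`, which exhibits `s` as the `i`-th degeneracy of its face.
  let θ : Fin (n + 2) → Fin (n + 2) := fun j => i.succ.succAbove (i.predAbove j)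
  have hθ : ∀ j, (θ j = j) ∨ (j = i.succ ∧ θ j = i.castSucc) := by
    intro j
    rcases eq_or_ne j i.succ with rfl | hj
    · right
      simp [θ]
    · left
      exact Fin.succ_succAbove_predAbove hj
  have hle : ∀ j, θ j ≤ j := fun j => by
    rcases hθ j with h | ⟨rfl, h⟩
    · exact h.le
    · rw [h]; exact Fin.castSucc_lt_succ.le
  have hmap : ∀ j, ∃ h : s.obj (θ j) = s.obj j, s.map (homOfLE (hle j)) = eqToHom h := by
    intro j
    have key : ∀ (l : Fin (n + 2)) (hl : l ≤ j), (l = j ∨ (j = i.succ ∧ l = i.castSucc)) →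
        ∃ h : s.obj l = s.obj j, s.map (homOfLE hl) = eqToHom h := by
      rintro l hl (rfl | ⟨rfl, rfl⟩)
      · exact ⟨rfl, s.map_id _⟩
      · exact ⟨h, hs⟩
    exact key _ _ (hθ j)
  choose hobj hmap using hmap
  have hmono : Monotone θ := fun j l hjl =>
    (Fin.succAbove_le_succAbove_iff).2 (Fin.predAbove_right_monotone i hjl)
  refine ⟨i, pullSimplex (SimplexCategory.δ i.succ) s, ?_⟩
  refine CategoryTheory.Functor.ext (fun j => (hobj j).symm) fun j l f => ?_
  have h1 : s.map (homOfLE (hle j)) ≫ s.map f =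
      s.map (homOfLE (hmono (leOfHom f))) ≫ s.map (homOfLE (hle l)) := by
    rw [← s.map_comp, ← s.map_comp]
    rfl
  rw [hmap, hmap] at h1
  have h2 : s.map f = eqToHom (hobj j).symm ≫ s.map (homOfLE (hmono (leOfHom f))) ≫
      eqToHom (hobj l) := by
    rw [← h1, ← Category.assoc, eqToHom_trans, eqToHom_refl, Category.id_comp]
  exact h2

/-- If every morphism that is not an identity increases the size, then there are no nondegenerate
simplices of dimension larger than the number of objects. -/
theorem isEmpty_nondegenerateSimplex [Finite C] (z : C → ℤ)
    (hz : ∀ {b c : C} (f : b ⟶ c), z b < z c ∨ ∃ h : b = c, f = eqToHom h) {n : ℕ}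
    (hn : Nat.card C < n) : IsEmpty (NondegenerateSimplex C n) := by
  refine ⟨fun ⟨s, hs⟩ => ?_⟩
  obtain _ | n := n
  · omega
  have hmono : ∀ {i j : Fin (n + 2)}, i ≤ j → z (s.obj i) ≤ z (s.obj j) := fun {i j} hij => by
    rcases hz (s.map (homOfLE hij)) with h | ⟨h, -⟩
    exacts [h.le, h ▸ le_rfl]
  -- Every edge of a nondegenerate simplex increases the size, so its `n + 2` vertices are distinct
  -- objects.
  have hstrict : StrictMono fun i : Fin (n + 2) => z (s.obj i) := by
    rw [Fin.strictMono_iff_lt_succ]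
    intro i
    rcases hz (s.map (homOfLE (Fin.castSucc_lt_succ (i := i)).le)) with h | ⟨h, hf⟩
    · exact h
    · exact (hs (isDegenerate_of_map_eq s i h hf)).elim
  have hinj : Function.Injective s.obj := fun i j h => hstrict.injective (congrArg z h)
  have := Nat.card_le_card_of_injective _ hinj
  rw [Nat.card_eq_fintype_card, Fintype.card_fin] at this
  omega

end Simplices

/-! ### Simplices in full subcategories of the action category -/

section ActionCategory
variable {σ Γ : Type} [AddCommGroup Γ] {w : σ → Γ} {s : Γ →+ ℤ} (hs : ∀ i, 0 < s (w i))

include hs in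
-- Every variable has size at least one, so each exponent is at most the difference of the sizes of
-- target and source.
theorem ActCat.finite_hom [Finite σ] (b c : ActCat w) : Finite (b ⟶ c) := by
  classical
  have := Fintype.ofFinite σ
  let N : σ →₀ ℕ := Finsupp.equivFunOnFinite.symm fun _ => (s c.deg - s b.deg).toNat
  refine Finite.of_injective (β := Set.Icc 0 N) (fun f => ⟨ActCat.expo f, zero_le, fun i => ?_⟩)
    fun f g h => ActCat.hom_ext (congrArg (fun x : Set.Icc 0 N => x.1) h)
  have h1 : s (Finsupp.weight w (ActCat.expo f)) = s c.deg - s b.deg := by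
    rw [eq_sub_iff_add_eq, ← map_add, ActCat.weight_expo]
  rw [Finsupp.weight_apply, Finsupp.sum_fintype _ _ fun i => zero_smul ℕ (w i), map_sum] at h1
  have h2 : ∀ j, (ActCat.expo f j : ℤ) ≤ s (ActCat.expo f j • w j) := fun j => by
    rw [map_nsmul, nsmul_eq_mul]
    exact le_mul_of_one_le_right (Int.natCast_nonneg _) (hs j)
  have h3 : (ActCat.expo f i : ℤ) ≤ s c.deg - s b.deg := by
    rw [← h1]
    exact (h2 i).trans (Finset.single_le_sum (f := fun j => s (ActCat.expo f j • w j))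
      (fun j _ => (Int.natCast_nonneg _).trans (h2 j)) (Finset.mem_univ i))
  change ActCat.expo f i ≤ (s c.deg - s b.deg).toNat
  omega

variable (P : ObjectProperty (ActCat w))

include hs in
theorem finite_nondegenerateSimplex_fullSubcategory [Finite σ] [Finite P.FullSubcategory] (n : ℕ) :
    Finite (NondegenerateSimplex P.FullSubcategory n) := by
  have := finite_composableArrows (C := P.FullSubcategory) (fun b c => by
    have := ActCat.finite_hom hs b.obj c.obj
    exact Finite.of_injective (fun f => f.hom) fun f g h => ObjectProperty.hom_ext _ h) n
  infer_instance

include hs in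
theorem isEmpty_nondegenerateSimplex_fullSubcategory [Finite P.FullSubcategory] {n : ℕ}
    (hn : Nat.card P.FullSubcategory < n) : IsEmpty (NondegenerateSimplex P.FullSubcategory n) := by
  refine isEmpty_nondegenerateSimplex (fun c => s c.obj.deg) (fun {b c} f => ?_) hn
  by_cases hf : IsIso f.hom
  · right
    obtain ⟨h, hf⟩ := ActCat.exists_eq_eqToHom f.hom hf
    obtain rfl : b = c := ObjectProperty.FullSubcategory.ext h
    exact ⟨rfl, ObjectProperty.hom_ext _ hf⟩
  · exact Or.inl (size_lt_of_not_isIso s hs f.hom hf)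

end ActionCategory

/-! ### The semigroup ring restricted to degrees in the semigroup -/

section ConstIso
variable {σ Γ Q : Type} [AddCommGroup Γ] [AddCommMonoid Q] {k : Type u} [Field k]
  {deg : Q →+ Γ} {a : σ → Q}

/-- On objects in `Q`, the module `k[Q]` is constant. -/
theorem exists_constModule_iso (hdeg : Function.Injective deg)
    (P : ObjectProperty (ActCat fun i => deg (a i)))
    (hP : ∀ c, P c → c.deg ∈ AddMonoidHom.mrange deg) :
    ∃ e : constModule k P.FullSubcategory ≅ P.ι ⋙ SemigroupRing.toFunctor k deg a,
      ∀ (c : P.FullSubcategory) (q : Q) (h : deg q = c.obj.deg),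
        (e.hom.app c).hom (1 : k) = SemigroupRing.monomAt k deg a h := by
  choose q hq using fun c : P.FullSubcategory => hP c.obj c.property
  have huniq : ∀ {c : P.FullSubcategory} {p : Q} (h : deg p = c.obj.deg),
      SemigroupRing.monomAt k deg a (hq c) = SemigroupRing.monomAt k deg a h := by
    intro c p h
    obtain rfl : q c = p := hdeg ((hq c).trans h.symm)
    rfl
  let l : ∀ c : P.FullSubcategory, k ≃ₗ[k] (SemigroupRing.toFunctor k deg a).obj c.obj := fun c =>
    LinearEquiv.ofBijective (LinearMap.toSpanSingleton k _ (SemigroupRing.monomAt k deg a (hq c)))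
      (SemigroupRing.bijective_smul_monomAt hdeg (hq c))
  have hl : ∀ c, l c 1 = SemigroupRing.monomAt k deg a (hq c) := fun c => one_smul k _
  refine ⟨NatIso.ofComponents (fun c => (l c).toModuleIso) fun {c d} f => ?_,
    fun c p h => (hl c).trans (huniq h)⟩
  ext : 1
  refine LinearMap.ext_ring (M₃ := (SemigroupRing.toFunctor k deg a).obj d.obj) ?_
  refine (hl d).trans (Eq.trans ?_ (congrArg ((SemigroupRing.toFunctor k deg a).map f.hom).hom
    (hl c)).symm)
  -- Naturality: the image of the monomial at `c` is a monomial of the degree of `d`, and only one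
  -- exists because `deg` is injective.
  rw [SemigroupRing.map_monomAt]
  exact huniq _

end ConstIso

/-! ### Assembly of the main theorem -/

section Main
variable {σ Γ : Type} [AddCommGroup Γ] {w : σ → Γ} {s : Γ →+ ℤ} (hs : ∀ i, 0 < s (w i))
  {k : Type u} [Field k]

/-- The generators of the induced bar resolution of the constant module. -/
noncomputable def inducedBarFreeBasis {C D : Type} [SmallCategory C] [SmallCategory D] (k : Type u)
    [Field k] (ρ : C ⥤ D) (n : ℕ) : FreeBasis (NondegenerateSimplex C n)
      ((inducedComplex ρ (normalizedBar (constModule k C))).X n) :=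
  (normalizedFreeBasis k C n).lan ρ

include hs in
/-- The bar resolution over the Betti category induces a free resolution. -/
theorem inducedBar_isFreeResolution {M : ActCat w ⥤ ModuleCat.{u} k} (hM : IsBoundedBelow s M)
    (e : constModule k (BettiCategory M) ≅ bettiInclusion M ⋙ M) :
    IsFreeResolution (inducedComplex (bettiInclusion M) (normalizedBar (constModule k _)))
      (inducedAug (bettiInclusion M) _ (normalizedBarAug _) e) where
  toIsResolution :=
    inducedComplex_isResolution (Q := minimalResolution M) (η := coverMap M) _
      (normalizedBar_isResolution _) (fun n => (normalizedFreeBasis k _ n).projective)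
      (fun n => (inducedBarFreeBasis k _ n).projective)
      (minimalResolution_isMinimal hs hM).toIsResolution
      (fun n => ((coverBasis (syzygy M n)).restrict _ (bettiObjects M).fullyFaithfulι
        (fun p => ⟨p.1, bettiObjects_of_splIndex hs hM n p⟩) fun _ => rfl).projective)
      (fun n => (coverBasis (syzygy M n)).isIso_counit _ (bettiObjects M).fullyFaithfulι
        (fun p => ⟨p.1, bettiObjects_of_splIndex hs hM n p⟩) fun _ => rfl) e
  free n := (inducedBarFreeBasis k _ n).isFreeModule

/-- The sum of the coordinates. -/
def coordinateSum (r : ℕ) : (Fin r → ℤ) →+ ℤ where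
  toFun v := ∑ j, v j
  map_zero' := by simp
  map_add' v v' := by simp [Finset.sum_add_distrib]

theorem latticeDegree_injective {r : ℕ} (Q : AddSubmonoid (Fin r → ℕ)) :
    Function.Injective (latticeDegree Q) := fun _ _ h =>
  Subtype.ext (funext fun j => Int.ofNat.inj (congrFun h j))

theorem coordinateSum_latticeDegree {r : ℕ} {Q : AddSubmonoid (Fin r → ℕ)} (q : Q) :
    coordinateSum r (latticeDegree Q q) = ∑ j, (q.1 j : ℤ) := rfl

theorem coordinateSum_latticeDegree_nonneg {r : ℕ} {Q : AddSubmonoid (Fin r → ℕ)} (q : Q) :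
    0 ≤ coordinateSum r (latticeDegree Q q) := by
  rw [coordinateSum_latticeDegree]
  exact Finset.sum_nonneg fun _ _ => Int.natCast_nonneg _

theorem coordinateSum_latticeDegree_pos {r : ℕ} {Q : AddSubmonoid (Fin r → ℕ)} {q : Q}
    (hq : q ≠ 0) : 0 < coordinateSum r (latticeDegree Q q) := by
  refine (coordinateSum_latticeDegree_nonneg q).lt_of_ne fun h => hq ?_
  rw [coordinateSum_latticeDegree, eq_comm,
    Finset.sum_eq_zero_iff_of_nonneg fun i _ => Int.natCast_nonneg (q.1 i)] at h
  exact Subtype.ext (funext fun j => Int.natCast_eq_zero.1 (h j (Finset.mem_univ j)))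

theorem IsMinimalGenerators.ne_zero {Q ι : Type*} [AddCommMonoid Q] {a : ι → Q}
    (ha : IsMinimalGenerators a) (i : ι) : a i ≠ 0 := fun h =>
  ha.minimal i (h ▸ zero_mem _)

theorem toFunctor_latticeDegree_isBoundedBelow {r : ℕ} (Q : AddSubmonoid (Fin r → ℕ)) (a : σ → Q) :
    IsBoundedBelow (coordinateSum r) (SemigroupRing.toFunctor k (latticeDegree Q) a) := fun c hc =>
  SemigroupRing.subsingleton_obj fun ⟨q, hq⟩ => by
    rw [← hq] at hc
    exact hc.not_ge (coordinateSum_latticeDegree_nonneg q)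

end Main
end Toric

theorem mainTheorem4 {k : Type u} [Field k] {r n : ℕ} (Q : AddSubmonoid (Fin r → ℕ))
    (a : Fin n → Q) (ha : IsMinimalGenerators a) :
    let w : Fin n → (Fin r → ℤ) := fun i => latticeDegree Q (a i)
    let T : ActCat w ⥤ ModuleCat.{u} k := SemigroupRing.toFunctor k (latticeDegree Q) a
    let ρ : BettiCategory T ⥤ ActCat w := bettiInclusion T
    let B : ChainComplex (BettiCategory T ⥤ ModuleCat.{u} k) ℕ :=
      normalizedBar (constModule k (BettiCategory T))
    ∃ e : constModule k (BettiCategory T) ≅ ρ ⋙ T,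
      (∀ (c : BettiCategory T) (q : Q) (h : latticeDegree Q q = c.obj.deg),
        (e.hom.app c).hom (1 : k) =
          (⟨SemigroupRing.monom k a q, SemigroupRing.monom_mem_piece k _ a h⟩ :
            SemigroupRing.piece k (latticeDegree Q) a c.obj.deg)) ∧
      IsFreeResolution (inducedComplex ρ B) (inducedAug ρ B (normalizedBarAug _) e) ∧
      IsFiniteFreeGradedResolution w (totalComplex w (inducedComplex ρ B))
        (fun m => TotalSum.piece ((inducedComplex ρ B).X m))
        (fun γ => (SemigroupRing.piece k (latticeDegree Q) a γ).toAddSubgroup)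
        ((totalFunctor k w).map (inducedAug ρ B (normalizedBarAug _) e) ≫
          SemigroupRing.assemble k (latticeDegree Q) a) := by
  intro w T ρ B
  have hdeg := latticeDegree_injective Q
  -- A minimal generator is nonzero, and a nonzero vector of natural numbers has positive coordinate
  -- sum.
  have hs : ∀ i, 0 < coordinateSum r (w i) := fun i =>
    coordinateSum_latticeDegree_pos (ha.ne_zero i)
  have hfin : Finite (BettiCategory T) := finite_bettiCategory hdeg ha.closure_eq_top
  obtain ⟨e, he⟩ := exists_constModule_iso (k := k) hdeg (bettiObjects T) fun c hc =>
    (bettiObjects_le hdeg hc).1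
  have hres := inducedBar_isFreeResolution hs (toFunctor_latticeDegree_isBoundedBelow Q a) e
  -- The length bound supplied here is the number of Betti objects, above which no nondegenerate
  -- simplices exist.
  exact ⟨e, he, hres, hres.toIsResolution.isFiniteFreeGradedResolution
    (finite_nondegenerateSimplex_fullSubcategory hs _) (inducedBarFreeBasis k ρ)
    fun n => isEmpty_nondegenerateSimplex_fullSubcategory hs _⟩
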